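/- Let $n\ge 4$, let $X$ be a connected closed smooth $n$-manifold, and let $M=\mathbb{T}^n\sharp X$ be a connected sum of $X$ with the torus $\mathbb{T}^n=(S^1)^n$. Let $\pi:M\to\mathbb{T}^n$ be a smooth projection collapsing $X$ to a point (constant on $X$ minus a ball, the identity on $\mathbb{T}^n$ minus a ball inside the disc where the connected sum is performed, and mapping the punctured disc of $\mathbb{T}^n$ into the disc), and let $u=\pi^*[d\theta_1]\in H^1(M,\mathbb{R})$, where $\theta_1$ is the first coordinate on $\mathbb{T}^n$. Let $p:\tilde M\to M$ be the minimal integration cover of $u$, i.e. the connected smooth covering with $p_*\pi_1(\tilde M)=\ker\big(\pi_1(M)\to\mathbb{R},\ [\gamma]\mapsto\int_\gamma u\big)$. Let $\alpha$ be any closed $1$-form in the class $u$ and $f_\alpha:\tilde M\to\mathbb{R}$ any primitive of $p^*\alpha$. For $h\in\mathbb{R}$ let $\star_h$ be the point of the quotient space $\tilde M/\{f_\alpha\le h\}$ given by the collapsed sublevel (which is non-empty), and let the Novikov fundamental group be $$\pi_1(\tilde M,u)=\pi_1(f_\alpha)=\varprojlim_{h\to-\infty}\pi_1\big(\tilde M/\{f_\alpha\le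 h\},\star_h\big),$$ the limit being over $h\in\mathbb{R}$, with the maps $\pi_1(\tilde M/\{f_\alpha\le h\},\star_h)\to\pi_1(\tilde M/\{f_\alpha\le h'\},\star_{h'})$, $h\le h'$, induced by the inclusions of sublevels. Let $(G_k)_{k\in\mathbb{Z}}$ be copies of the group $\pi_1(X)$. For $h\in\mathbb{Z}$ let $\Pi_h=\ast_{k\ge h}G_k$ be the free product and, for $h\le h'$, let $\Pi_h\to\Pi_{h'}$ be the projection that kills $G_k$ for $h\le k<h'$ and is the identity on $G_k$ for $k\ge h'$. Let $\Pi=\varprojlim_{h\to-\infty}\Pi_h$. Then the group $\pi_1(\tilde M,u)$ is isomorphic to $\Pi$. -/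

import Mathlib

open scoped Manifold ContDiff Topology

noncomputable section

/-! ## Inverse limits and free products -/

/-- The inverse limit of a system of groups `G i → G j` (`i ≤ j`), as the subgroup of coherent
families; the limit is taken towards small indices. -/
def InverseLimit {ι : Type*} [Preorder ι] (G : ι → Type*) [∀ i, Group (G i)]
    (r : ∀ i j, i ≤ j → (G i →* G j)) : Subgroup (∀ i, G i) where
  carrier := {g | ∀ i j (hij : i ≤ j), r i j hij (g i) = g j}
  mul_mem' ha hb i j hij := by
    rw [Pi.mul_apply, Pi.mul_apply, map_mul, ha i j hij, hb i j hij]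
  one_mem' i j hij := by rw [Pi.one_apply, Pi.one_apply, map_one]
  inv_mem' ha i j hij := by rw [Pi.inv_apply, Pi.inv_apply, map_inv, ha i j hij]

/-- The free product of copies `G_k` of `G`, one for each integer `k ≥ h`. -/
abbrev FreePower (G : Type*) [Group G] (h : ℤ) : Type _ :=
  Monoid.CoprodI (fun _ : {k : ℤ // h ≤ k} => G)

/-- The projection killing the factors `G_k` with `h ≤ k < h'`, the identity on the others. -/
def FreePower.proj (G : Type*) [Group G] (h h' : ℤ) (_ : h ≤ h') :
    FreePower G h →* FreePower G h' :=
  Monoid.CoprodI.lift fun k : {k : ℤ // h ≤ k} =>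
    if hk : h' ≤ k.1 then
      (Monoid.CoprodI.of (M := fun _ : {k : ℤ // h' ≤ k} => G) (i := ⟨k.1, hk⟩))
    else 1

/-- The inverse limit over `h → -∞` of the free products of the `G_k`, `k ≥ h`. -/
abbrev FreePowerLimit (G : Type*) [Group G] : Type _ :=
  InverseLimit (FreePower G) (FreePower.proj G)

/-! ## The fundamental group relative to sublevels -/

section Zipped

variable {Y : Type*} [TopologicalSpace Y]

/-- Collapse the sublevel `{f ≤ h}` to a point. -/
def sublevelSetoid (f : Y → ℝ) (h : ℝ) : Setoid Y where
  r x y := x = y ∨ (f x ≤ h ∧ f y ≤ h)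
  iseqv := by
    refine ⟨fun x => Or.inl rfl, ?_, ?_⟩
    · rintro x y (rfl | ⟨h1, h2⟩)
      · exact Or.inl rfl
      · exact Or.inr ⟨h2, h1⟩
    · rintro x y z (rfl | ⟨h1, h2⟩) (rfl | ⟨h3, h4⟩)
      · exact Or.inl rfl
      · exact Or.inr ⟨h3, h4⟩
      · exact Or.inr ⟨h1, h2⟩
      · exact Or.inr ⟨h1, h4⟩

/-- The quotient space `Y / {f ≤ h}` with the quotient topology. -/
abbrev Zipped (f : Y → ℝ) (h : ℝ) : Type _ := Quotient (sublevelSetoid f h)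

/-- All the sublevels of `f` are non-empty. -/
def UnboundedBelow (f : Y → ℝ) : Prop := ∀ h : ℝ, ∃ x, f x ≤ h

/-- The base point of `Y / {f ≤ h}`: the class of the (non-empty) sublevel. -/
def Zipped.star {f : Y → ℝ} (hf : UnboundedBelow f) (h : ℝ) : Zipped f h :=
  Quotient.mk _ (hf h).choose

theorem Zipped.mk_eq_star {f : Y → ℝ} (hf : UnboundedBelow f) {h : ℝ} {x : Y} (hx : f x ≤ h) :
    (Quotient.mk (sublevelSetoid f h) x : Zipped f h) = Zipped.star hf h :=
  Quotient.sound (Or.inr ⟨hx, (hf h).choose_spec⟩)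

/-- The map `Y / {f ≤ h} → Y / {f ≤ h'}` induced by the identity of `Y`, for `h ≤ h'`. -/
def Zipped.map (f : Y → ℝ) {h h' : ℝ} (hh : h ≤ h') : C(Zipped f h, Zipped f h') where
  toFun := Quotient.map' id (by
    rintro x y (rfl | ⟨h1, h2⟩)
    · exact Or.inl rfl
    · exact Or.inr ⟨h1.trans hh, h2.trans hh⟩)
  continuous_toFun := by
    refine continuous_quot_lift _ ?_
    exact continuous_quotient_mk'

theorem Zipped.map_star {f : Y → ℝ} (hf : UnboundedBelow f) {h h' : ℝ} (hh : h ≤ h') :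
    Zipped.map f hh (Zipped.star hf h) = Zipped.star hf h' :=
  Zipped.mk_eq_star hf ((hf h).choose_spec.trans hh)

/-- The Novikov fundamental group of a function: the inverse limit, as `h → -∞`, of the groups
`π₁(Y / {f ≤ h}, ⋆_h)`. -/
abbrev NovikovPi1 (f : Y → ℝ) (hf : UnboundedBelow f) : Type _ :=
  InverseLimit (fun h : ℝ => FundamentalGroup (Zipped f h) (Zipped.star hf h))
    (fun _ _ hh => FundamentalGroup.mapOfEq (Zipped.map f hh) (Zipped.map_star hf hh))

end Zipped

/-! ## One-forms, their classes and periods -/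

section Forms

variable {E H E' H' : Type*}
  [NormedAddCommGroup E] [NormedSpace ℝ E] [TopologicalSpace H] (I : ModelWithCorners ℝ E H)
  [NormedAddCommGroup E'] [NormedSpace ℝ E'] [TopologicalSpace H'] (I' : ModelWithCorners ℝ E' H')
  {M : Type*} [TopologicalSpace M] [ChartedSpace H M]
  {M' : Type*} [TopologicalSpace M'] [ChartedSpace H' M']

variable (M) in
/-- Differential `1`-forms (without regularity). -/
abbrev OneForm : Type _ := ∀ x : M, TangentSpace I x →L[ℝ] ℝ

/-- The differential of a function, as a `1`-form. -/
def OneForm.d (g : M → ℝ) : OneForm I M := fun x => mfderiv I 𝓘(ℝ, ℝ) g x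

/-- The pull-back of a `1`-form. -/
def OneForm.pullback (F : M → M') (α : OneForm I' M') : OneForm I M :=
  fun x => (α (F x)).comp (mfderiv I I' F x)

/-- `α` and `β` represent the same de Rham class: they differ by the differential of a smooth
function. (A form cohomologous to a smooth closed form is itself smooth and closed.) -/
def OneForm.Cohomologous (α β : OneForm I M) : Prop :=
  ∃ g : M → ℝ, ContMDiff I 𝓘(ℝ, ℝ) ∞ g ∧ α = β + OneForm.d I g

/-- `c` is the integral of the closed form `α` along the continuous path `γ`: it is the total
variation of a primitive of `α` along `γ`, that is, of a function on `[0,1]` which is locally of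
the form `φ ∘ γ` with `φ` a smooth local primitive of `α`. -/
def OneForm.HasPathIntegral (α : OneForm I M) {x y : M} (γ : Path x y) (c : ℝ) : Prop :=
  ∃ F : unitInterval → ℝ,
    (∀ t : unitInterval, ∃ (U : Set M) (φ : M → ℝ), IsOpen U ∧ γ t ∈ U ∧
      ContMDiffOn I 𝓘(ℝ, ℝ) ∞ φ U ∧ (∀ z ∈ U, OneForm.d I φ z = α z) ∧
      ∀ᶠ s in 𝓝 t, F s = φ (γ s)) ∧
    F 1 - F 0 = c

/-- The kernel of the period homomorphism `π₁(M, x) → ℝ`, `[γ] ↦ ∫_γ α`, of a closed form `α`. -/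
def OneForm.periodKernel (α : OneForm I M) (x : M) : Set (FundamentalGroup M x) :=
  {g | ∃ γ : Path x x, FundamentalGroup.fromPath (Path.Homotopic.Quotient.mk γ) = g ∧
    OneForm.HasPathIntegral I α γ 0}

/-- A connected smooth covering `p : M' → M` is the minimal integration cover of the class of the
closed form `α` if `p_* π₁(M')` is the kernel of the period homomorphism. -/
structure IsMinimalIntegrationCover (p : C(M', M)) (α : OneForm I M) : Prop where
  connected : ConnectedSpace M'
  isCoveringMap : IsCoveringMap p
  isLocalDiffeomorph : IsLocalDiffeomorph I' I ∞ p
  range_eq : ∀ x : M',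
    Set.range (FundamentalGroup.map p x) = OneForm.periodKernel I α (p x)

end Forms

/-! ## The torus -/

/-- The torus `𝕋ⁿ = (S¹)ⁿ`. -/
abbrev Torus (n : ℕ) : Type := Fin n → Circle

/-- The model with corners of the torus (a product of copies of that of the circle). -/
abbrev torusModel (n : ℕ) :
    ModelWithCorners ℝ (Fin n → EuclideanSpace ℝ (Fin 1))
      (ModelPi fun _ : Fin n => EuclideanSpace ℝ (Fin 1)) :=
  ModelWithCorners.pi fun _ : Fin n => 𝓡 1

/-- The angular form `dθ` on the circle: at `z`, a tangent vector `v` (seen in `ℂ`) is sent to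
`Im (conj z * v)`, so `v = i z` is sent to `1`. -/
def circleDTheta : OneForm (𝓡 1) Circle := fun z =>
  Complex.imCLM.comp
    (((ContinuousLinearMap.mul ℝ ℂ) ((starRingEnd ℂ) (z : ℂ))).comp
      (mfderiv (𝓡 1) 𝓘(ℝ, ℂ) (fun w : Circle => (w : ℂ)) z))

/-- The form `dθ_i` on the torus. -/
def torusDTheta {n : ℕ} (i : Fin n) : OneForm (torusModel n) (Torus n) :=
  OneForm.pullback (torusModel n) (𝓡 1) (fun z : Torus n => z i) circleDTheta

/-! ## Connected sums -/

section ConnectedSum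

variable {n : ℕ} {E₁ H₁ E₂ H₂ E H : Type*}
  [NormedAddCommGroup E₁] [NormedSpace ℝ E₁] [TopologicalSpace H₁]
  [NormedAddCommGroup E₂] [NormedSpace ℝ E₂] [TopologicalSpace H₂]
  [NormedAddCommGroup E] [NormedSpace ℝ E] [TopologicalSpace H]
  (n) (I₁ : ModelWithCorners ℝ E₁ H₁) (I₂ : ModelWithCorners ℝ E₂ H₂) (I : ModelWithCorners ℝ E H)
  (N₁ : Type*) [TopologicalSpace N₁] [ChartedSpace H₁ N₁]
  (N₂ : Type*) [TopologicalSpace N₂] [ChartedSpace H₂ N₂]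
  (M : Type*) [TopologicalSpace M] [ChartedSpace H M]

/-- A presentation of `M` as a connected sum `N₁ # N₂` of `n`-manifolds: `M` is obtained from
`N₁ ∖ {disc₁ 0}` and `N₂ ∖ {disc₂ 0}`, for embedded open discs `discᵢ : ℝⁿ → Nᵢ`, by gluing the
punctured discs along the inversion `x ↦ x / ‖x‖²`. This determines `M` up to diffeomorphism:
`M` is covered by two open pieces `incl₁`, `incl₂`, with the prescribed identifications. -/
structure ConnectedSum where
  disc₁ : PartialDiffeomorph 𝓘(ℝ, EuclideanSpace ℝ (Fin n)) I₁ (EuclideanSpace ℝ (Fin n)) N₁ ∞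
  disc₁_source : disc₁.source = Set.univ
  disc₂ : PartialDiffeomorph 𝓘(ℝ, EuclideanSpace ℝ (Fin n)) I₂ (EuclideanSpace ℝ (Fin n)) N₂ ∞
  disc₂_source : disc₂.source = Set.univ
  incl₁ : PartialDiffeomorph I₁ I N₁ M ∞
  incl₁_source : incl₁.source = {disc₁ 0}ᶜ
  incl₂ : PartialDiffeomorph I₂ I N₂ M ∞
  incl₂_source : incl₂.source = {disc₂ 0}ᶜ
  target_union : incl₁.target ∪ incl₂.target = Set.univ
  glue : ∀ y₁ ∈ incl₁.source, ∀ y₂ ∈ incl₂.source, incl₁ y₁ = incl₂ y₂ ↔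
    ∃ x : EuclideanSpace ℝ (Fin n), x ≠ 0 ∧ y₁ = disc₁ x ∧ y₂ = disc₂ ((‖x‖ ^ 2)⁻¹ • x)

variable {n I₁ I₂ I N₁ N₂ M}

/-- `π : N₁ # N₂ → N₁` is a smooth projection collapsing `N₂` to a point: it is the identity on
the part of `N₁` away from some ball of the disc used in the connected sum, it maps the
punctured disc into the disc, and it is constant on `N₂` minus some ball. -/
structure ConnectedSum.IsCollapse (S : ConnectedSum n I₁ I₂ I N₁ N₂ M) (π : M → N₁) : Prop where
  contMDiff : ContMDiff I I₁ ∞ π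
  eq_self : ∃ R : ℝ, 0 < R ∧ ∀ y, y ∉ S.disc₁ '' Metric.ball 0 R → π (S.incl₁ y) = y
  mapsTo_disc : ∀ x, x ≠ 0 → π (S.incl₁ (S.disc₁ x)) ∈ Set.range S.disc₁
  collapse : ∃ r : ℝ, 0 < r ∧ ∃ c : N₁, ∀ y, y ∉ S.disc₂ '' Metric.ball 0 r → π (S.incl₂ y) = c

end ConnectedSum

end

/-! The minimal integration cover is homeomorphic to the fibre product of `M` and `ℝ` over the
circle. This is 𝕋ⁿ⁻¹ × ℝ with one copy of `X` summed in for each integer `k`, at height about 2πk.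
Since `M` is compact, a primitive `f` stays at bounded distance from the unwrapped coordinate
(`exists_homeomorph_of_exp_eq`, `CollapsedSum.nonempty_periodicSum`). Only this coarse information,
recorded in `PeriodicSum`, is used to compute the limit.

Paths of 𝕋ⁿ⁻¹ × ℝ with low end points can be pushed down into the collapsed sublevel. The push
sweeps across the places where copies of `X` are attached, but a punctured ball of dimension at
least three is simply connected, so nothing is picked up there (`PeriodicSum.loopTransport_base`).
What survives comes from the copies of `X` above the level.

For a fixed `h` the sublevel may cut through some copies of `X`, so no single quotient is compared
with a free product by an isomorphism. Instead there are homomorphisms π₁(Q / {f ≤ h}) → Π_m for `m`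
well above `h`, and Π_m → π₁(Q / {f ≤ h'}) for `h'` well above `m`. Their composites are the
structure maps of the two systems (`PeriodicSum.transport_roundtrip_zipped`,
`PeriodicSum.transport_roundtrip_freePower`), so the systems are isomorphic as pro-groups and have
isomorphic limits (`InverseLimit.nonempty_mulEquiv`).

Van Kampen's theorem enters through transports: homotopy invariant functors from paths to a group,
in other words flat connections. Transports on an open cover which agree on overlaps glue
(`exists_isTransport_of_cover`); this constructs the homomorphisms. Transports which agree locally
up to a given gauge agree globally up to it (`IsTransport.eq_gauge`); this reduces the computation
of the composites to local checks. -/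

/-! ## Transports: group-valued functors on paths -/

section Transport

open Set unitInterval

variable {Z : Type*} [TopologicalSpace Z] {G : Type*} [Group G]

/-- A function assigning an element of `G` to every path of `Z`. -/
abbrev PathFunction (Z : Type*) [TopologicalSpace Z] (G : Type*) : Type _ :=
  ∀ ⦃x y : Z⦄, Path x y → G

/-- `F` is functorial and homotopy invariant on the paths in `U`. -/
structure IsTransportOn (F : PathFunction Z G) (U : Set Z) : Prop where
  map_trans : ∀ {x y z : Z} (γ : Path x y) (δ : Path y z), (∀ t, γ t ∈ U) → (∀ t, δ t ∈ U) →
    F (γ.trans δ) = F δ * F γ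
  map_homotopy : ∀ {x y : Z} {γ γ' : Path x y} (H : Path.Homotopy γ γ'), (∀ s, H s ∈ U) →
    F γ = F γ'

/-- `F` is functorial and homotopy invariant: a functor from the fundamental groupoid to `G`. -/
abbrev IsTransport (F : PathFunction Z G) : Prop := IsTransportOn F univ

theorem PathFunction.congr_apply {G : Type*} (F : PathFunction Z G) {x y x' y' : Z}
    (p : Path x y) (q : Path x' y') (h : ∀ t, p t = q t) : F p = F q := by
  obtain rfl : x = x' := by simpa using h 0
  obtain rfl : y = y' := by simpa using h 1
  congr 1
  ext t
  exact h t

theorem Path.trans_mem {x y z : Z} {γ : Path x y} {δ : Path y z} {U : Set Z}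
    (hγ : ∀ t, γ t ∈ U) (hδ : ∀ t, δ t ∈ U) (t : I) : γ.trans δ t ∈ U := by
  rw [Path.trans_apply]
  split_ifs
  exacts [hγ _, hδ _]

namespace IsTransportOn

variable {F F' : PathFunction Z G} {U V : Set Z}

theorem mono (h : IsTransportOn F V) (hUV : U ⊆ V) : IsTransportOn F U :=
  ⟨fun γ δ hγ hδ => h.map_trans γ δ (fun t => hUV (hγ t)) fun t => hUV (hδ t),
    fun H hH => h.map_homotopy H fun s => hUV (hH s)⟩

theorem congr (h : IsTransportOn F U)
    (h' : ∀ ⦃x y : Z⦄ (γ : Path x y), (∀ t, γ t ∈ U) → F' γ = F γ) : IsTransportOn F' U := by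
  refine ⟨fun γ δ hγ hδ => ?_, fun {x y γ γ'} H hH => ?_⟩
  · rw [h' _ hγ, h' _ hδ, h' _ (Path.trans_mem hγ hδ), h.map_trans γ δ hγ hδ]
  · rw [h' _ fun t => by simpa using hH (0, t), h' _ fun t => by simpa using hH (1, t),
      h.map_homotopy H hH]

theorem one : IsTransportOn (fun _ _ _ => (1 : G) : PathFunction Z G) U :=
  ⟨fun _ _ _ _ => (mul_one _).symm, fun _ _ => rfl⟩

theorem map_refl (h : IsTransportOn F U) {x : Z} (hx : x ∈ U) : F (Path.refl x) = 1 := by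
  have := h.map_trans (Path.refl x) (Path.refl x) (fun _ => hx) fun _ => hx
  rw [Path.refl_trans_refl] at this
  exact left_eq_mul.1 this

theorem map_homotopic (h : IsTransport F) {x y : Z} {γ γ' : Path x y} (H : Path.Homotopic γ γ') :
    F γ = F γ' :=
  h.map_homotopy H.some fun _ => mem_univ _

theorem map_trans' (h : IsTransport F) {x y z : Z} (γ : Path x y) (δ : Path y z) :
    F (γ.trans δ) = F δ * F γ :=
  h.map_trans γ δ (fun _ => mem_univ _) fun _ => mem_univ _

theorem map_symm (h : IsTransport F) {x y : Z} (γ : Path x y) : F γ.symm = (F γ)⁻¹ := by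
  rw [eq_inv_iff_mul_eq_one, ← h.map_trans', ← h.map_refl (mem_univ x)]
  exact (h.map_homotopic ⟨Path.Homotopy.reflTransSymm γ⟩).symm

/-- Change of gauge. -/
theorem gauge (h : IsTransportOn F U) (g : Z → G) :
    IsTransportOn (fun x y γ => g y * F γ * (g x)⁻¹) U := by
  refine ⟨fun γ δ hγ hδ => ?_, fun H hH => ?_⟩
  · rw [h.map_trans γ δ hγ hδ]
    group
  · rw [h.map_homotopy H hH]

theorem comp_hom {G' : Type*} [Group G'] (h : IsTransportOn F U) (φ : G →* G') :
    IsTransportOn (fun _ _ γ => φ (F γ)) U := by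
  refine ⟨fun γ δ hγ hδ => ?_, fun H hH => ?_⟩
  · rw [h.map_trans γ δ hγ hδ, map_mul]
  · rw [h.map_homotopy H hH]

end IsTransportOn

/-- The pull-back of a path function by a map, extended by `1` to the paths on which the map is
not continuous. -/
noncomputable def PathFunction.comap {Z' : Type*} [TopologicalSpace Z'] (F : PathFunction Z G)
    (m : Z' → Z) : PathFunction Z' G := fun _ _ γ =>
  open Classical in if h : ContinuousOn m (range γ) then F (γ.map' h) else 1

section Comap

variable {Z' : Type*} [TopologicalSpace Z'] {F : PathFunction Z G} {m : Z' → Z}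
  {U : Set Z} {V : Set Z'}

theorem PathFunction.comap_apply (hm : ContinuousOn m V) {x y : Z'} (γ : Path x y)
    (hγ : ∀ t, γ t ∈ V) :
    F.comap m γ = F (γ.map' (hm.mono (range_subset_iff.2 hγ))) :=
  dif_pos _

theorem PathFunction.comap_eq (hm : ContinuousOn m V) {x y : Z'} (γ : Path x y)
    (hγ : ∀ t, γ t ∈ V) {x' y' : Z} (δ : Path x' y') (hδ : ∀ t, δ t = m (γ t)) :
    F.comap m γ = F δ := by
  rw [comap_apply hm γ hγ]
  exact F.congr_apply _ _ fun t => (hδ t).symm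

theorem IsTransportOn.comap (h : IsTransportOn F U) (hm : ContinuousOn m V) (hVU : MapsTo m V U) :
    IsTransportOn (F.comap m) V := by
  refine ⟨fun γ δ hγ hδ => ?_, fun {x y γ γ'} H hH => ?_⟩
  · rw [PathFunction.comap_apply hm γ hγ, PathFunction.comap_apply hm δ hδ,
      ← h.map_trans _ _ (fun t => hVU (hγ t)) fun t => hVU (hδ t)]
    refine PathFunction.comap_eq hm _ (Path.trans_mem hγ hδ) _ fun t => ?_
    simp only [Path.trans_apply]
    split_ifs <;> rfl
  · have h0 : ∀ t, γ t ∈ V := fun t => by simpa using hH (0, t)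
    have h1 : ∀ t, γ' t ∈ V := fun t => by simpa using hH (1, t)
    rw [PathFunction.comap_apply hm γ h0, PathFunction.comap_apply hm γ' h1]
    refine h.map_homotopy
      ⟨⟨⟨fun s => m (H s), hm.comp_continuous H.continuous hH⟩, fun t => ?_, fun t => ?_⟩,
        fun t x hx => ?_⟩ fun s => hVU (hH s)
    · simp [Path.map']
    · simp [Path.map']
    · have := H.eq_fst t hx
      simp only [ContinuousMap.coe_mk, Path.map', Function.comp]
      exact congrArg m this

end Comap

/-! ### Transport along segments -/

section Segment

variable {E : Type*} [NormedAddCommGroup E] [NormedSpace ℝ E] {F : PathFunction Z G} {U : Set Z}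

/-- The value of a path function on the image of a segment. -/
def PathFunction.segment (F : PathFunction Z G) (H : C(E, Z)) (a b : E) : G :=
  F ((Path.segment a b).map H.continuous)

/-- The straight homotopy of paths in a real vector space. -/
def Path.Homotopy.straight {a b : E} (p q : Path a b) : Path.Homotopy p q where
  toFun s := AffineMap.lineMap (p s.2) (q s.2) (s.1 : ℝ)
  continuous_toFun := by
    simp only [AffineMap.lineMap_apply]
    fun_prop
  map_zero_left t := by simp
  map_one_left t := by simp
  prop' s t ht := by
    rcases ht with rfl | rfl <;> simp

theorem Path.segment_mem {C : Set E} (hC : Convex ℝ C) {a b : E} (ha : a ∈ C) (hb : b ∈ C)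
    (t : I) : Path.segment a b t ∈ C := by
  simpa using hC.lineMap_mem ha hb t.2

/-- The straight homotopy between the broken path and the segment stays in the convex set `C`, hence
its image stays in `U`, the only place where homotopy invariance is known. -/
theorem IsTransportOn.segment_mul (h : IsTransportOn F U) (H : C(E, Z)) {C : Set E}
    (hC : Convex ℝ C) (hCU : MapsTo H C U) {a b c : E} (ha : a ∈ C) (hb : b ∈ C) (hc : c ∈ C) :
    F.segment H b c * F.segment H a b = F.segment H a c := by
  unfold PathFunction.segment
  rw [← h.map_trans _ _ (fun t => hCU (Path.segment_mem hC ha hb t))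
    fun t => hCU (Path.segment_mem hC hb hc t), ← Path.map_trans]
  refine h.map_homotopy ((Path.Homotopy.straight _ _).map H) fun s => hCU ?_
  exact hC.lineMap_mem (Path.trans_mem (Path.segment_mem hC ha hb) (Path.segment_mem hC hb hc) _)
    (Path.segment_mem hC ha hc _) s.1.2

theorem IsTransportOn.segment_self (h : IsTransportOn F U) (H : C(E, Z)) {a : E} (ha : H a ∈ U) :
    F.segment H a a = 1 := by
  have := h.segment_mul H (convex_singleton a) (by rintro _ rfl; exact ha) rfl rfl rfl
  simpa using this

omit [Group G] in
theorem PathFunction.segment_comp {E' : Type*} [NormedAddCommGroup E'] [NormedSpace ℝ E']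
    (F : PathFunction Z G) (H : C(E, Z)) (H' : C(E', Z)) {a b : E} {a' b' : E'}
    (h : ∀ t : I, H (AffineMap.lineMap a b (t : ℝ)) = H' (AffineMap.lineMap a' b' (t : ℝ))) :
    F.segment H a b = F.segment H' a' b' :=
  F.congr_apply _ _ fun t => by simpa using h t

end Segment

/-! ### Gluing of transports -/

section Glue

variable {F : PathFunction Z G}

/-- `φ` is a development along `γ`: its increments are locally given by `F`. -/
def IsDevelopment (F : PathFunction Z G) (γ : C(ℝ, Z)) (φ : ℝ → G) : Prop :=
  ∀ t ∈ Icc (0 : ℝ) 1, ∃ ε > 0, ∀ a ∈ Icc (0 : ℝ) 1, ∀ b ∈ Icc (0 : ℝ) 1,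
    dist a t < ε → dist b t < ε → φ b = F.segment γ a b * φ a

theorem IsDevelopment.mul_right {γ : C(ℝ, Z)} {φ : ℝ → G} (h : IsDevelopment F γ φ) (g : G) :
    IsDevelopment F γ fun t => φ t * g := by
  intro t ht
  obtain ⟨ε, hε, H⟩ := h t ht
  exact ⟨ε, hε, fun a ha b hb hat hbt => by
    beta_reduce
    rw [H a ha b hb hat hbt, mul_assoc]⟩

/-- Both functions are multiplied on the left by the same local increments, so `ψ⁻¹ * φ` is locally
constant on the connected interval. -/
theorem IsDevelopment.eq {γ : C(ℝ, Z)} {φ ψ : ℝ → G} (hφ : IsDevelopment F γ φ)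
    (hψ : IsDevelopment F γ ψ) (h0 : φ 0 = ψ 0) : φ 1 = ψ 1 := by
  have key : ∀ t ∈ Icc (0 : ℝ) 1, ∃ ε > 0, ∀ a ∈ Icc (0 : ℝ) 1, dist a t < ε →
      (ψ a)⁻¹ * φ a = (ψ t)⁻¹ * φ t := by
    intro t ht
    obtain ⟨ε, hε, H⟩ := hφ t ht
    obtain ⟨ε', hε', H'⟩ := hψ t ht
    refine ⟨min ε ε', lt_min hε hε', fun a ha hat => ?_⟩
    rw [H t ht a ha (by simpa) (hat.trans_le (min_le_left _ _)),
      H' t ht a ha (by simpa) (hat.trans_le (min_le_right _ _))]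
    group
  have : (ψ 1)⁻¹ * φ 1 = (ψ 0)⁻¹ * φ 0 := by
    refine isPreconnected_Icc.induction₂ (s := Icc (0 : ℝ) 1)
      (fun a b => (ψ a)⁻¹ * φ a = (ψ b)⁻¹ * φ b) (fun t ht => ?_)
      (fun x y z _ _ _ h h' => h.trans h') (fun x y _ _ h => h.symm) (by simp) (by simp)
    obtain ⟨ε, hε, H⟩ := key t ht
    filter_upwards [inter_mem_nhdsWithin _ (Metric.ball_mem_nhds t hε)] with a ha
    exact (H a ha.1 ha.2).symm
  rw [h0, inv_mul_cancel, inv_mul_eq_one] at this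
  exact this.symm

/-- The slice of a two-parameter family. -/
def sliceMap (H : C(ℝ × ℝ, Z)) (u : ℝ) : C(ℝ, Z) :=
  H.comp ⟨fun t => (u, t), by fun_prop⟩

/-- Every point has an open neighbourhood on which `F` is a transport. -/
def IsLocalTransport (F : PathFunction Z G) : Prop :=
  ∀ z, ∃ U, IsOpen U ∧ z ∈ U ∧ IsTransportOn F U

/-- Developments propagate to neighbouring slices. A Lebesgue number puts each ball around `(u, t)`
inside one set on which `F` is a transport; there the two ways around a small rectangle give the
same value. -/
theorem IsLocalTransport.exists_development (hF : IsLocalTransport F) (H : C(ℝ × ℝ, Z)) (u : ℝ) :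
    ∃ ε > 0, ∀ u' ∈ Metric.ball u ε, ∀ u'' ∈ Metric.ball u ε, ∀ φ : ℝ → G,
      IsDevelopment F (sliceMap H u') φ →
      IsDevelopment F (sliceMap H u'') fun t => F.segment H (u', t) (u'', t) * φ t := by
  choose U hUo hzU hFU using hF
  obtain ⟨ε, hε, hball⟩ := lebesgue_number_lemma_of_metric
    (s := ({u} : Set ℝ) ×ˢ Icc (0 : ℝ) 1) (c := fun z => H ⁻¹' U z)
    (isCompact_singleton.prod isCompact_Icc) (fun z => (hUo z).preimage H.continuous)
    fun x _ => mem_iUnion.2 ⟨H x, hzU _⟩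
  refine ⟨ε, hε, fun u' hu' u'' hu'' φ hφ t ht => ?_⟩
  obtain ⟨ε', hε', hφ'⟩ := hφ t ht
  obtain ⟨z, hz⟩ := hball (u, t) ⟨rfl, ht⟩
  have hmem : ∀ v ∈ Metric.ball u ε, ∀ s, dist s t < ε → (v, s) ∈ Metric.ball (u, t) ε :=
    fun v hv s hs => by
      rw [Metric.mem_ball, Prod.dist_eq]
      exact max_lt hv hs
  have tri := fun {a b c} => (hFU z).segment_mul H (convex_ball (u, t) ε) hz (a := a) (b := b)
    (c := c)
  refine ⟨min ε ε', lt_min hε hε', fun a ha b hb hat hbt => ?_⟩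
  have hat1 := hat.trans_le (min_le_left _ _)
  have hbt1 := hbt.trans_le (min_le_left _ _)
  have e : ∀ v, F.segment (sliceMap H v) a b = F.segment H (v, a) (v, b) := fun v =>
    F.segment_comp _ _ fun t => by
      simp [sliceMap, AffineMap.lineMap_apply]
  beta_reduce
  rw [hφ' a ha b hb (hat.trans_le (min_le_right _ _)) (hbt.trans_le (min_le_right _ _)), e, e,
    ← mul_assoc, ← mul_assoc,
    tri (hmem _ hu' _ hat1) (hmem _ hu' _ hbt1) (hmem _ hu'' _ hbt1),
    tri (hmem _ hu' _ hat1) (hmem _ hu'' _ hat1) (hmem _ hu'' _ hbt1)]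

theorem forall_of_locally_constant {P : ℝ → Prop}
    (h : ∀ u, ∃ ε > 0, ∀ u' ∈ Metric.ball u ε, ∀ u'' ∈ Metric.ball u ε, P u' → P u'')
    {u : ℝ} (hu : P u) (v : ℝ) : P v := by
  refine isPreconnected_univ.induction₂ (s := univ) (fun a b => P a ↔ P b) (fun t _ => ?_)
      (fun x y z _ _ _ h h' => h.trans h') (fun x y _ _ h => h.symm) (mem_univ u) (mem_univ v)
      |>.1 hu
  obtain ⟨ε, hε, H⟩ := h t
  filter_upwards [mem_nhdsWithin_of_mem_nhds (Metric.ball_mem_nhds t hε)] with a ha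
  exact ⟨H _ (Metric.mem_ball_self hε) _ ha, H _ ha _ (Metric.mem_ball_self hε)⟩

theorem IsLocalTransport.isDevelopment_one (hF : IsLocalTransport F) (γ : C(ℝ, Z)) (z : Z)
    (hγ : ∀ t, γ t = z) : IsDevelopment F γ fun _ => 1 := by
  obtain ⟨U, -, hz, hU⟩ := hF z
  refine fun t _ => ⟨1, one_pos, fun a _ b _ _ _ => ?_⟩
  have : F.segment γ a b = F.segment γ a a := F.segment_comp _ _ fun t => by simp [hγ]
  rw [this, hU.segment_self γ (by rwa [hγ]), one_mul]

theorem IsLocalTransport.exists_isDevelopment (hF : IsLocalTransport F) (γ : C(ℝ, Z)) :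
    ∃ φ, IsDevelopment F γ φ ∧ φ 0 = 1 := by
  -- Contract the path to its starting point: the slice at `u = 0` is constant and developed by `1`,
  -- and the slice at `u = 1` is `γ`.
  let H : C(ℝ × ℝ, Z) := γ.comp ⟨fun x => x.1 * x.2, by fun_prop⟩
  have h1 : ∃ φ, IsDevelopment F (sliceMap H 1) φ := by
    refine forall_of_locally_constant (P := fun u => ∃ φ, IsDevelopment F (sliceMap H u) φ)
      (fun u => ?_) (u := 0) ⟨_, hF.isDevelopment_one _ (γ 0) fun t => by simp [sliceMap, H]⟩ 1
    obtain ⟨ε, hε, h⟩ := hF.exists_development H u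
    exact ⟨ε, hε, fun u' hu' u'' hu'' ⟨φ, hφ⟩ => ⟨_, h u' hu' u'' hu'' φ hφ⟩⟩
  obtain ⟨φ, hφ⟩ := h1
  have : sliceMap H 1 = γ := by
    ext t
    simp [sliceMap, H]
  rw [this] at hφ
  exact ⟨_, hφ.mul_right (φ 0)⁻¹, mul_inv_cancel _⟩

/-- The value of the glued transport. -/
noncomputable def IsLocalTransport.glue (hF : IsLocalTransport F) : PathFunction Z G := fun _ _ γ =>
  (hF.exists_isDevelopment γ.extend).choose 1

theorem IsLocalTransport.glue_eq (hF : IsLocalTransport F) {x y : Z} {γ : Path x y} {φ : ℝ → G}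
    (hφ : IsDevelopment F γ.extend φ) (h0 : φ 0 = 1) : hF.glue γ = φ 1 :=
  have h := (hF.exists_isDevelopment γ.extend).choose_spec
  h.1.eq hφ (h.2.trans h0.symm)

theorem IsLocalTransport.glue_eq_of_isTransportOn (hF : IsLocalTransport F) {U : Set Z}
    (hU : IsTransportOn F U) {x y : Z} (γ : Path x y) (hγ : ∀ t, γ t ∈ U) : hF.glue γ = F γ := by
  have hm : MapsTo γ.extend (Icc 0 1) U := fun t ht => by
    rw [Path.extend_apply γ ht]
    exact hγ _
  have h0 : (0 : ℝ) ∈ Icc (0 : ℝ) 1 := by simp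
  have hd : IsDevelopment F γ.extend (F.segment γ.extend 0) := fun t ht =>
    ⟨1, one_pos, fun a ha b hb _ _ =>
      (hU.segment_mul γ.extend (convex_Icc 0 1) hm h0 ha hb).symm⟩
  rw [hF.glue_eq hd (hU.segment_self _ (hm h0))]
  refine F.congr_apply _ _ fun t => ?_
  simp [AffineMap.lineMap_apply]

/-- With `c = 0` and `c = 1` this reads off developments of the two halves of a concatenation from
one of the whole. -/
theorem IsDevelopment.reparam {γ γ' : C(ℝ, Z)} {φ : ℝ → G} (h : IsDevelopment F γ φ) {c : ℝ}
    (hc : c ∈ Icc (0 : ℝ) 1) (hγ : ∀ t ∈ Icc (0 : ℝ) 1, γ' t = γ ((t + c) / 2)) :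
    IsDevelopment F γ' fun t => φ ((t + c) / 2) := by
  have hI : ∀ t ∈ Icc (0 : ℝ) 1, (t + c) / 2 ∈ Icc (0 : ℝ) 1 := fun t ht =>
    ⟨by linarith [ht.1, hc.1], by linarith [ht.2, hc.2]⟩
  have hd : ∀ a t ε : ℝ, dist a t < ε → dist ((a + c) / 2) ((t + c) / 2) < ε := by
    intro a t ε h
    have : (a + c) / 2 - (t + c) / 2 = (a - t) / 2 := by ring
    rw [Real.dist_eq] at h ⊢
    rw [this, abs_div, abs_two]
    linarith [abs_nonneg (a - t)]
  intro t ht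
  obtain ⟨ε, hε, H⟩ := h _ (hI t ht)
  refine ⟨ε, hε, fun a ha b hb hat hbt => ?_⟩
  beta_reduce
  rw [H _ (hI a ha) _ (hI b hb) (hd _ _ _ hat) (hd _ _ _ hbt)]
  congr 1
  refine F.segment_comp _ _ fun s => ?_
  rw [hγ _ ((convex_Icc (0 : ℝ) 1).lineMap_mem ha hb s.2)]
  congr 1
  simp only [AffineMap.lineMap_apply, vsub_eq_sub, smul_eq_mul, vadd_eq_add]
  ring

/-- Homotopy classes of paths with values in a local transport: van Kampen's theorem. -/
theorem IsLocalTransport.isTransport_glue (hF : IsLocalTransport F) : IsTransport hF.glue := by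
  refine ⟨fun {x y z} γ δ _ _ => ?_, fun {x y γ γ'} H _ => ?_⟩
  · obtain ⟨φ, hφ, h0⟩ := hF.exists_isDevelopment (γ.trans δ).extend
    have h1 := hφ.reparam (γ' := γ.extend) (c := 0) (by simp) fun t ht => by
      rw [Path.extend_trans_of_le_half _ _ (by linarith [ht.2])]
      congr 1
      ring
    have h2 := (hφ.reparam (γ' := δ.extend) (c := 1) (by simp) fun t ht => by
      rw [Path.extend_trans_of_half_le _ _ (by linarith [ht.1])]
      congr 1
      ring).mul_right (φ (1 / 2))⁻¹
    rw [hF.glue_eq hφ h0, hF.glue_eq h1 (by simpa using h0), hF.glue_eq h2 (by simp)]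
    norm_num
  · obtain ⟨φ, hφ, h0⟩ := hF.exists_isDevelopment γ.extend
    let K : C(ℝ × ℝ, Z) :=
      ⟨fun s => H (projIcc 0 1 zero_le_one s.1, projIcc 0 1 zero_le_one s.2), by fun_prop⟩
    have K0 : ∀ u, K (u, 0) = x := fun u => by
      change H (_, projIcc 0 1 zero_le_one 0) = x
      rw [projIcc_left]
      exact H.source _
    have K1 : ∀ u, K (u, 1) = y := fun u => by
      change H (_, projIcc 0 1 zero_le_one 1) = y
      rw [projIcc_right]
      exact H.target _
    -- The homotopy fixes the end points, so the transverse segments at times `0` and `1` are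
    -- constant. Passing to a neighbouring slice therefore keeps both end values of the development.
    have e : ∀ (t z), (∀ u, K (u, t) = z) → ∀ u' u'', F.segment K (u', t) (u'', t) = 1 := by
      intro t z h u' u''
      obtain ⟨U, -, hz, hU⟩ := hF z
      rw [← hU.segment_self K (a := (u', t)) (by rwa [h])]
      refine F.segment_comp _ _ fun s => ?_
      simp [AffineMap.lineMap_apply, h]
    have hP : ∃ ψ, IsDevelopment F (sliceMap K 1) ψ ∧ ψ 0 = 1 ∧ ψ 1 = φ 1 := by
      refine forall_of_locally_constant
        (P := fun u => ∃ ψ, IsDevelopment F (sliceMap K u) ψ ∧ ψ 0 = 1 ∧ ψ 1 = φ 1)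
        (fun u => ?_) (u := 0) ⟨φ, ?_, h0, rfl⟩ 1
      · obtain ⟨ε, hε, h⟩ := hF.exists_development K u
        refine ⟨ε, hε, fun u' hu' u'' hu'' ⟨ψ, hψ, hψ0, hψ1⟩ => ⟨_, h u' hu' u'' hu'' ψ hψ, ?_, ?_⟩⟩
        · rw [e 0 x K0, hψ0, one_mul]
        · rw [e 1 y K1, hψ1, one_mul]
      · convert! hφ
        ext t
        simp [sliceMap, K, Path.extend]
        rfl
    obtain ⟨ψ, hψ, hψ0, hψ1⟩ := hP
    have : sliceMap K 1 = γ'.extend := by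
      ext t
      simp [sliceMap, K, Path.extend]
      rfl
    rw [this] at hψ
    rw [hF.glue_eq hφ h0, hF.glue_eq hψ hψ0, hψ1]

/-- Transports on the members of an open cover which agree on the intersections can be glued. -/
theorem exists_isTransport_of_cover {ι : Type*} {U : ι → Set Z} (hU : ∀ i, IsOpen (U i))
    (hcov : ∀ z, ∃ i, z ∈ U i) {F : ι → PathFunction Z G} (hF : ∀ i, IsTransportOn (F i) (U i))
    (hFF : ∀ i j ⦃x y : Z⦄ (γ : Path x y), (∀ t, γ t ∈ U i) → (∀ t, γ t ∈ U j) →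
      F i γ = F j γ) :
    ∃ F' : PathFunction Z G, IsTransport F' ∧
      ∀ i ⦃x y : Z⦄ (γ : Path x y), (∀ t, γ t ∈ U i) → F' γ = F i γ := by
  classical
  -- The default value on paths not contained in one member of the cover is immaterial: the gluing
  -- only relies on `F₀` near each point.
  let F₀ : PathFunction Z G := fun x y γ =>
    if h : ∃ i, ∀ t, γ t ∈ U i then F h.choose γ else 1
  have e : ∀ i ⦃x y : Z⦄ (γ : Path x y), (∀ t, γ t ∈ U i) → F₀ γ = F i γ := fun i x y γ h => by
    have h' : ∃ i, ∀ t, γ t ∈ U i := ⟨i, h⟩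
    simp only [F₀, dif_pos h']
    exact hFF _ _ γ h'.choose_spec h
  have hF₀ : ∀ i, IsTransportOn F₀ (U i) := fun i => (hF i).congr (e i)
  have hloc : IsLocalTransport F₀ := fun z =>
    let ⟨i, hi⟩ := hcov z
    ⟨U i, hU i, hi, hF₀ i⟩
  exact ⟨hloc.glue, hloc.isTransport_glue, fun i x y γ h =>
    (hloc.glue_eq_of_isTransportOn (hF₀ i) γ h).trans (e i γ h)⟩

/-- Two transports which differ locally by a change of gauge differ by it globally. -/
theorem IsTransport.eq_gauge {F F' : PathFunction Z G} (hF : IsTransport F) (hF' : IsTransport F')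
    (g : Z → G) {L : Set Z}
    (h : ∀ z ∈ L, ∃ U, IsOpen U ∧ z ∈ U ∧ ∀ ⦃x y : Z⦄ (γ : Path x y), (∀ t, γ t ∈ U) →
      (∀ t, γ t ∈ L) → F γ = g y * F' γ * (g x)⁻¹)
    {x y : Z} (γ : Path x y) (hγ : ∀ t, γ t ∈ L) : F γ = g y * F' γ * (g x)⁻¹ := by
  have hd : ∀ t ∈ Icc (0 : ℝ) 1, γ.extend t ∈ L := fun t ht => by
    rw [Path.extend_apply γ ht]
    exact hγ _
  have e1 : ∀ F₀ : PathFunction Z G, F₀.segment γ.extend 0 1 = F₀ γ := fun F₀ =>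
    F₀.congr_apply _ _ fun t => by simp [AffineMap.lineMap_apply]
  have tri : ∀ {F₀ : PathFunction Z G}, IsTransport F₀ → ∀ a b c,
      F₀.segment γ.extend b c * F₀.segment γ.extend a b = F₀.segment γ.extend a c := fun h a b c =>
    h.segment_mul γ.extend convex_univ (mapsTo_univ _ _) (mem_univ a) (mem_univ b) (mem_univ c)
  -- Evaluated on the piece of `γ` from `0` to `t`, both sides become developments for `F` with
  -- initial value `1`, so they have the same final value.
  have hφ : IsDevelopment F γ.extend (F.segment γ.extend 0) := fun t _ =>
    ⟨1, one_pos, fun a _ b _ _ _ => (tri hF 0 a b).symm⟩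
  have hψ : IsDevelopment F γ.extend
      fun t => g (γ.extend t) * F'.segment γ.extend 0 t * (g x)⁻¹ := by
    intro t ht
    obtain ⟨U, hUo, hz, hU⟩ := h _ (hd t ht)
    obtain ⟨ε, hε, hball⟩ := Metric.isOpen_iff.1 (hUo.preimage γ.extend.continuous) t hz
    refine ⟨ε, hε, fun a ha b hb hat hbt => ?_⟩
    have : F.segment γ.extend a b =
        g (γ.extend b) * F'.segment γ.extend a b * (g (γ.extend a))⁻¹ := by
      refine hU _ (fun s => ?_) fun s => ?_
      · exact hball (Path.segment_mem (convex_ball t ε) hat hbt s)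
      · exact hd _ (Path.segment_mem (convex_Icc 0 1) ha hb s)
    beta_reduce
    rw [this, ← tri hF' 0 a b]
    group
  have s0 : ∀ {F₀ : PathFunction Z G}, IsTransport F₀ → F₀.segment γ.extend 0 0 = 1 := fun h =>
    h.segment_self _ (mem_univ _)
  have := hφ.eq hψ (by simp [s0 hF, s0 hF'])
  rwa [e1, e1, γ.extend_one] at this

theorem IsTransport.eq_one {F : PathFunction Z G} (hF : IsTransport F) {L : Set Z}
    (h : ∀ z ∈ L, ∃ U, IsOpen U ∧ z ∈ U ∧ ∀ ⦃x y : Z⦄ (γ : Path x y), (∀ t, γ t ∈ U) →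
      (∀ t, γ t ∈ L) → F γ = 1) {x y : Z} (γ : Path x y) (hγ : ∀ t, γ t ∈ L) : F γ = 1 := by
  have := IsTransport.eq_gauge hF (F' := fun _ _ _ => 1) IsTransportOn.one (fun _ => 1)
    (by simpa using h) γ hγ
  simpa using this

end Glue

/-! ### Transports and fundamental groups -/

section FundamentalGroup

open Path.Homotopic (Quotient)

/-- The homomorphism on the fundamental group induced by a transport. -/
def IsTransport.toHom {F : PathFunction Z G} (hF : IsTransport F) (z : Z) :
    FundamentalGroup Z z →* G where
  toFun p := _root_.Quotient.lift (fun γ : Path z z => F γ)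
    (fun _ _ h => IsTransportOn.map_homotopic hF h) p
  map_one' := hF.map_refl (mem_univ z)
  map_mul' p q := by
    induction p, q using Path.Homotopic.Quotient.ind₂ with
    -- The product `p * q` of the fundamental group runs through `q` first; this is why `map_trans`
    -- reverses the factors.
    | mk p q => exact IsTransportOn.map_trans' hF q p

variable {z₀ : Z}

/-- The transport defined by a choice of paths from the base point. -/
noncomputable def loopTransport (ν : ∀ z, Path z₀ z) : PathFunction Z (FundamentalGroup Z z₀) :=
  fun x y γ => Path.Homotopic.Quotient.mk ((ν x).trans (γ.trans (ν y).symm))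

theorem isTransport_loopTransport (ν : ∀ z, Path z₀ z) : IsTransport (loopTransport ν) := by
  refine ⟨fun γ δ _ _ => ?_, fun H _ => ?_⟩
  · rw [loopTransport, loopTransport, loopTransport, FundamentalGroup.mul_def]
    simp only [Path.Homotopic.Quotient.mk_trans, Path.Homotopic.Quotient.mk_symm]
    simp only [Path.Homotopic.Quotient.trans_assoc]
    rw [← Path.Homotopic.Quotient.trans_assoc (Path.Homotopic.Quotient.symm _),
      Path.Homotopic.Quotient.symm_trans, Path.Homotopic.Quotient.refl_trans]
  · simp only [loopTransport, Path.Homotopic.Quotient.mk_trans,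
      (Path.Homotopic.Quotient.eq.2 ⟨H⟩ :)]

theorem loopTransport_of_eq_refl {ν : ∀ z, Path z₀ z} (hν : ν z₀ = Path.refl z₀)
    (γ : Path z₀ z₀) : loopTransport ν γ = Path.Homotopic.Quotient.mk γ := by
  rw [loopTransport, hν, Path.refl_symm]
  simp only [Path.Homotopic.Quotient.mk_trans, Path.Homotopic.Quotient.mk_refl,
    Path.Homotopic.Quotient.refl_trans, Path.Homotopic.Quotient.trans_refl]

theorem exists_paths [PathConnectedSpace Z] (z₀ : Z) :
    ∃ ν : ∀ z, Path z₀ z, ν z₀ = Path.refl z₀ := by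
  classical
  refine ⟨fun z => if h : z₀ = z then (Path.refl z₀).cast rfl h.symm else
    PathConnectedSpace.somePath z₀ z, ?_⟩
  beta_reduce
  rw [dif_pos rfl]
  rfl

theorem IsTransportOn.map_symm' {F : PathFunction Z G} {U : Set Z} (h : IsTransportOn F U)
    {x y : Z} (γ : Path x y) (hγ : ∀ t, γ t ∈ U) : F γ.symm = (F γ)⁻¹ := by
  rw [eq_inv_iff_mul_eq_one, ← h.map_trans _ _ hγ fun t => hγ _,
    ← h.map_refl (γ.source ▸ hγ 0 : x ∈ U)]
  exact (h.map_homotopy (Path.Homotopy.reflTransSymm γ) fun s => hγ _).symm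

/-- A transport on a simply connected set is trivial in a suitable gauge. -/
theorem IsTransportOn.exists_gauge {F : PathFunction Z G} {U : Set Z} (h : IsTransportOn F U)
    (hU : IsSimplyConnected U) :
    ∃ κ : Z → G, ∀ ⦃x y : Z⦄ (γ : Path x y), (∀ t, γ t ∈ U) → F γ = κ y * (κ x)⁻¹ := by
  classical
  rw [isSimplyConnected_iff_exists_homotopy_refl_forall_mem] at hU
  obtain ⟨w, hw, hj⟩ := hU.1
  refine ⟨fun y => if hy : y ∈ U then F (hj hy).somePath else 1, fun x y γ hγ => ?_⟩
  have hx : x ∈ U := γ.source ▸ hγ 0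
  have hy : y ∈ U := γ.target ▸ hγ 1
  simp only [dif_pos hx, dif_pos hy]
  have h1 := (hj hx).somePath_mem
  have h2 := (hj hy).somePath_mem
  have h3 : ∀ t, ((hj hy).somePath.symm) t ∈ U := fun t => h2 _
  obtain ⟨H, hH⟩ := hU.2 w (((hj hx).somePath.trans γ).trans (hj hy).somePath.symm)
    (Path.trans_mem (Path.trans_mem h1 hγ) h3)
  have := h.map_homotopy H hH
  rw [h.map_refl hw, h.map_trans _ _ (Path.trans_mem h1 hγ) h3, h.map_trans _ _ h1 hγ,
    h.map_symm' _ h2, inv_mul_eq_one] at this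
  rw [this, mul_inv_cancel_right]

theorem Path.Homotopic.Quotient.eq_one_iff {γ : Path z₀ z₀} :
    FundamentalGroup.fromPath (Path.Homotopic.Quotient.mk γ) = 1 ↔
      Path.Homotopic γ (Path.refl z₀) :=
  Path.Homotopic.Quotient.eq

/-- A union of two simply connected open sets with path connected intersection is simply
connected. -/
theorem simplyConnectedSpace_of_union {U V : Set Z} (hUo : IsOpen U) (hVo : IsOpen V)
    (hUV : U ∪ V = univ) (hU : IsSimplyConnected U) (hV : IsSimplyConnected V)
    (hI : IsPathConnected (U ∩ V)) : SimplyConnectedSpace Z := by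
  classical
  have hpc : PathConnectedSpace Z := by
    rw [pathConnectedSpace_iff_univ, ← hUV]
    exact hU.isPathConnected.union hV.isPathConnected hI.nonempty
  refine simply_connected_iff_loops_nullhomotopic.2 ⟨hpc, fun z₀ γ => ?_⟩
  obtain ⟨ν, hν⟩ := exists_paths z₀
  have hF := isTransport_loopTransport ν
  obtain ⟨κ, hκ⟩ := (hF.mono (subset_univ U)).exists_gauge hU
  obtain ⟨κ', hκ'⟩ := (hF.mono (subset_univ V)).exists_gauge hV
  obtain ⟨w, hw, hj⟩ := hI
  -- Normalised at `w`, both gauges compute the transport along a path of the intersection from `w`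
  -- to `x`. They therefore patch to a global gauge, which makes every loop trivial.
  have e : ∀ x ∈ U ∩ V, κ x * (κ w)⁻¹ = κ' x * (κ' w)⁻¹ := fun x hx => by
    rw [← hκ (hj hx).somePath fun t => ((hj hx).somePath_mem t).1,
      ← hκ' (hj hx).somePath fun t => ((hj hx).somePath_mem t).2]
  let g : Z → FundamentalGroup Z z₀ := fun x =>
    if x ∈ U then κ x * (κ w)⁻¹ else κ' x * (κ' w)⁻¹
  have gU : ∀ x ∈ U, g x = κ x * (κ w)⁻¹ := fun x hx => if_pos hx
  have gV : ∀ x ∈ V, g x = κ' x * (κ' w)⁻¹ := fun x hx => by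
    by_cases hxU : x ∈ U
    · rw [gU x hxU, e x ⟨hxU, hx⟩]
    · exact if_neg hxU
  have := IsTransport.eq_gauge hF (F' := fun _ _ _ => 1) IsTransportOn.one g (L := univ)
    (fun z _ => ?_) γ fun _ => mem_univ _
  · rw [loopTransport_of_eq_refl hν, mul_one, mul_inv_cancel] at this
    exact Path.Homotopic.Quotient.eq_one_iff.1 this
  · rcases (hUV ▸ mem_univ z : z ∈ U ∪ V) with hz | hz
    · refine ⟨U, hUo, hz, fun x y γ hγ _ => ?_⟩
      rw [hκ γ hγ, gU x (γ.source ▸ hγ 0), gU y (γ.target ▸ hγ 1)]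
      group
    · refine ⟨V, hVo, hz, fun x y γ hγ _ => ?_⟩
      rw [hκ' γ hγ, gV x (γ.source ▸ hγ 0), gV y (γ.target ▸ hγ 1)]
      group

end FundamentalGroup

end Transport

/-! ## Isomorphisms of inverse limits -/

section Limits

variable {ι κ : Type*} [LinearOrder ι] [LinearOrder κ]
  {A : ι → Type*} [∀ i, Group (A i)] {B : κ → Type*} [∀ k, Group (B k)]
  {r : ∀ i j, i ≤ j → (A i →* A j)} {s : ∀ i j, i ≤ j → (B i →* B j)}
  {L : ι → κ → Prop} {L' : κ → ι → Prop}

/-- The component at `m` is read off at any `h` with `L h m`. The choice does not matter: two terms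
`A h` and `A h'` both receive a map from a sufficiently low `B m₀`, and the composites being
structure maps expresses both values through the same element of `B m₀`. -/
theorem InverseLimit.exists_hom
    (hs : ∀ i j k (hij : i ≤ j) (hjk : j ≤ k) x, s j k hjk (s i j hij x) = s i k (hij.trans hjk) x)
    (Φ : ∀ h m, L h m → (A h →* B m)) (Ψ : ∀ m h, L' m h → (B m →* A h))
    (hL : ∀ m, ∃ h, L h m) (hL' : ∀ h, ∃ m, L' m h)
    (hLmono' : ∀ m m' h, m ≤ m' → L' m' h → L' m h)
    (hAle : ∀ h m h', L h m → L' m h' → h ≤ h')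
    (hBle : ∀ m h m', L' m h → L h m' → m ≤ m')
    (hA : ∀ h m h' (l : L h m) (l' : L' m h') x, Ψ m h' l' (Φ h m l x) = r h h' (hAle _ _ _ l l') x)
    (hB : ∀ m h m' (l' : L' m h) (l : L h m') x,
      Φ h m' l (Ψ m h l' x) = s m m' (hBle _ _ _ l' l) x) :
    ∃ F : InverseLimit A r →* InverseLimit B s,
      ∀ g h m (l : L h m), (F g : ∀ k, B k) m = Φ h m l ((g : ∀ i, A i) h) := by
  choose c hc using hL
  choose d hd using hL'
  have key : ∀ (g : InverseLimit A r) h m (l : L h m) h' m' (l' : L h' m'),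
      ∃ m₀ b, ∃ (hm : m₀ ≤ m) (hm' : m₀ ≤ m'), Φ h m l ((g : ∀ i, A i) h) = s m₀ m hm b ∧
        Φ h' m' l' ((g : ∀ i, A i) h') = s m₀ m' hm' b := by
    intro g h m l h' m' l'
    have l1 : L' (min (d h) (d h')) h := hLmono' _ _ _ (min_le_left _ _) (hd h)
    have l2 : L' (min (d h) (d h')) h' := hLmono' _ _ _ (min_le_right _ _) (hd h')
    have l0 := hc (min (d h) (d h'))
    refine ⟨_, Φ _ _ l0 ((g : ∀ i, A i) _), hBle _ _ _ l1 l, hBle _ _ _ l2 l', ?_, ?_⟩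
    · rw [← hB _ _ _ l1 l, hA _ _ _ l0 l1, g.2]
    · rw [← hB _ _ _ l2 l', hA _ _ _ l0 l2, g.2]
  refine ⟨⟨⟨fun g => ⟨fun m => Φ _ m (hc m) ((g : ∀ i, A i) _), fun m m' hm => ?_⟩, ?_⟩, ?_⟩, ?_⟩
  · obtain ⟨m₀, b, h1, h2, e1, e2⟩ := key g _ m (hc m) _ m' (hc m')
    beta_reduce
    rw [e1, e2, hs]
  · ext m
    simp
  · intro g g'
    ext m
    simp
  · intro g h m l
    obtain ⟨m₀, b, h1, h2, e1, e2⟩ := key g _ m (hc m) h m l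
    exact e1.trans e2.symm

/-- Two inverse systems which are isomorphic as pro-groups have isomorphic limits. -/
theorem InverseLimit.nonempty_mulEquiv
    (hr : ∀ i j k (hij : i ≤ j) (hjk : j ≤ k) x, r j k hjk (r i j hij x) = r i k (hij.trans hjk) x)
    (hs : ∀ i j k (hij : i ≤ j) (hjk : j ≤ k) x, s j k hjk (s i j hij x) = s i k (hij.trans hjk) x)
    (Φ : ∀ h m, L h m → (A h →* B m)) (Ψ : ∀ m h, L' m h → (B m →* A h))
    (hL : ∀ m, ∃ h, L h m) (hL' : ∀ h, ∃ m, L' m h)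
    (hLmono : ∀ h h' m, h ≤ h' → L h' m → L h m)
    (hLmono' : ∀ m m' h, m ≤ m' → L' m' h → L' m h)
    (hAle : ∀ h m h', L h m → L' m h' → h ≤ h')
    (hBle : ∀ m h m', L' m h → L h m' → m ≤ m')
    (hA : ∀ h m h' (l : L h m) (l' : L' m h') x, Ψ m h' l' (Φ h m l x) = r h h' (hAle _ _ _ l l') x)
    (hB : ∀ m h m' (l' : L' m h) (l : L h m') x,
      Φ h m' l (Ψ m h l' x) = s m m' (hBle _ _ _ l' l) x) :
    Nonempty (InverseLimit A r ≃* InverseLimit B s) := by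
  obtain ⟨F, hF⟩ := InverseLimit.exists_hom hs Φ Ψ hL hL' hLmono' hAle hBle hA hB
  obtain ⟨F', hF'⟩ := InverseLimit.exists_hom hr Ψ Φ hL' hL hLmono hBle hAle hB hA
  refine ⟨F.toMulEquiv F' ?_ ?_⟩
  · ext g h
    obtain ⟨m, hm⟩ := hL' h
    obtain ⟨h₀, hh₀⟩ := hL m
    simp only [MonoidHom.comp_apply, MonoidHom.id_apply]
    rw [hF' _ _ _ hm, hF _ _ _ hh₀, hA]
    exact g.2 _ _ _
  · ext g m
    obtain ⟨h, hh⟩ := hL m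
    obtain ⟨m₀, hm₀⟩ := hL' h
    simp only [MonoidHom.comp_apply, MonoidHom.id_apply]
    rw [hF _ _ _ hh, hF' _ _ _ hm₀, hB]
    exact g.2 _ _ _

end Limits

/-! ### Functoriality of the projections between free products -/

section FreePower

variable {G : Type*} [Group G]

theorem FreePower.proj_of_le {h h' : ℤ} (hh : h ≤ h') (k : {k : ℤ // h ≤ k}) (hk : h' ≤ k.1)
    (x : G) : FreePower.proj G h h' hh (Monoid.CoprodI.of (i := k) x) =
      Monoid.CoprodI.of (M := fun _ : {k : ℤ // h' ≤ k} => G) (i := ⟨k.1, hk⟩) x := by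
  rw [FreePower.proj, Monoid.CoprodI.lift_of, dif_pos hk]

theorem FreePower.proj_of_lt {h h' : ℤ} (hh : h ≤ h') (k : {k : ℤ // h ≤ k}) (hk : ¬ h' ≤ k.1)
    (x : G) : FreePower.proj G h h' hh (Monoid.CoprodI.of (i := k) x) = 1 := by
  rw [FreePower.proj, Monoid.CoprodI.lift_of, dif_neg hk, MonoidHom.one_apply]

theorem FreePower.proj_proj (i j k : ℤ) (hij : i ≤ j) (hjk : j ≤ k) (x : FreePower G i) :
    FreePower.proj G j k hjk (FreePower.proj G i j hij x) =
      FreePower.proj G i k (hij.trans hjk) x := by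
  rw [← MonoidHom.comp_apply]
  congr 1
  refine Monoid.CoprodI.ext_hom _ _ fun l => ?_
  ext x
  simp only [MonoidHom.comp_apply]
  by_cases hj : j ≤ l.1
  · rw [FreePower.proj_of_le hij l hj]
    by_cases hk : k ≤ l.1
    · rw [FreePower.proj_of_le hjk ⟨l.1, hj⟩ hk, FreePower.proj_of_le (hij.trans hjk) l hk]
    · rw [FreePower.proj_of_lt hjk ⟨l.1, hj⟩ hk, FreePower.proj_of_lt (hij.trans hjk) l hk]
  · rw [FreePower.proj_of_lt hij l hj, map_one,
      FreePower.proj_of_lt (hij.trans hjk) l fun h => hj (hjk.trans h)]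

end FreePower

/-! ## Quotients by sublevels -/

section ZippedLemmas

open Set

variable {Q : Type*} [TopologicalSpace Q] {f : Q → ℝ} {h : ℝ}

variable (f h) in
/-- The projection to the quotient by a sublevel. -/
def Zipped.mk : C(Q, Zipped f h) := ⟨Quotient.mk _, continuous_quotient_mk'⟩

theorem Zipped.mk_eq_mk_iff {x y : Q} :
    Zipped.mk f h x = Zipped.mk f h y ↔ x = y ∨ (f x ≤ h ∧ f y ≤ h) :=
  Quotient.eq (r := sublevelSetoid f h)

theorem Zipped.mk_out (z : Zipped f h) : Zipped.mk f h z.out = z := Quotient.out_eq z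

theorem Zipped.out_mk_cases (x : Q) :
    (Zipped.mk f h x).out = x ∨ (f (Zipped.mk f h x).out ≤ h ∧ f x ≤ h) :=
  Zipped.mk_eq_mk_iff.1 (Zipped.mk_out _)

/-- Sets containing the sublevel are saturated, and so, in the primed version, are sets avoiding it.
The open ones have open images; these two kinds provide the open sets used for all local arguments
on the quotient. -/
theorem Zipped.mem_image_iff {V : Set Q} (hV : ∀ x, f x ≤ h → x ∈ V) {x : Q} :
    Zipped.mk f h x ∈ Zipped.mk f h '' V ↔ x ∈ V := by
  refine ⟨?_, fun hx => ⟨x, hx, rfl⟩⟩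
  rintro ⟨y, hy, e⟩
  rcases Zipped.mk_eq_mk_iff.1 e with rfl | h'
  exacts [hy, hV _ h'.2]

theorem Zipped.mem_image_iff' {V : Set Q} (hV : ∀ x ∈ V, h < f x) {x : Q} :
    Zipped.mk f h x ∈ Zipped.mk f h '' V ↔ x ∈ V := by
  refine ⟨?_, fun hx => ⟨x, hx, rfl⟩⟩
  rintro ⟨y, hy, e⟩
  rcases Zipped.mk_eq_mk_iff.1 e with rfl | h'
  exacts [hy, absurd h'.1 (hV _ hy).not_ge]

theorem Zipped.isOpen_image {V : Set Q} (hVo : IsOpen V)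
    (hV : ∀ x, f x ≤ h → x ∈ V) : IsOpen (Zipped.mk f h '' V) := by
  refine (isQuotientMap_quotient_mk' (s := sublevelSetoid f h)).isOpen_preimage.1 ?_
  convert hVo using 1
  ext x
  exact Zipped.mem_image_iff hV

theorem Zipped.isOpen_image' {V : Set Q} (hVo : IsOpen V)
    (hV : ∀ x ∈ V, h < f x) : IsOpen (Zipped.mk f h '' V) := by
  refine (isQuotientMap_quotient_mk' (s := sublevelSetoid f h)).isOpen_preimage.1 ?_
  convert hVo using 1
  ext x
  exact Zipped.mem_image_iff' hV

theorem Zipped.out_mk {x : Q} (hx : h < f x) : (Zipped.mk f h x).out = x :=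
  (Zipped.out_mk_cases x).resolve_right fun h' => hx.not_ge h'.2

/-- Off the sublevel the projection is injective, so the chosen representative is a genuine inverse
there, and open sets avoiding the sublevel have open images. -/
theorem Zipped.continuousOn_out {V : Set Q} (hVo : IsOpen V) (hV : ∀ x ∈ V, h < f x) :
    ContinuousOn (fun z : Zipped f h => z.out) (Zipped.mk f h '' V) := by
  refine continuousOn_iff'.2 fun O hO => ⟨Zipped.mk f h '' (V ∩ O),
    Zipped.isOpen_image' (hVo.inter hO) fun x hx => hV x hx.1, ?_⟩
  ext z
  constructor
  · rintro ⟨hz, x, hx, rfl⟩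
    rw [mem_preimage, Zipped.out_mk (hV x hx)] at hz
    exact ⟨⟨x, ⟨hx, hz⟩, rfl⟩, x, hx, rfl⟩
  · rintro ⟨⟨x, ⟨hx, hxO⟩, rfl⟩, -⟩
    refine ⟨?_, x, hx, rfl⟩
    rwa [mem_preimage, Zipped.out_mk (hV x hx)]

/-- Paths avoiding the base point lift. -/
theorem Zipped.exists_lift {V : Set Q} (hVo : IsOpen V) (hV : ∀ x ∈ V, h < f x)
    {z w : Zipped f h} (γ : Path z w) (hγ : ∀ t, γ t ∈ Zipped.mk f h '' V) :
    ∃ δ : Path z.out w.out, (∀ t, δ t ∈ V) ∧ ∀ t, Zipped.mk f h (δ t) = γ t := by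
  refine ⟨γ.map' ((Zipped.continuousOn_out hVo hV).mono (range_subset_iff.2 hγ)), fun t => ?_,
    fun t => Zipped.mk_out _⟩
  obtain ⟨x, hx, e⟩ := hγ t
  change (γ t).out ∈ V
  rwa [← e, Zipped.out_mk (hV x hx)]

theorem Zipped.mapOfEq_mk (hf : UnboundedBelow f) {h' : ℝ} (hh : h ≤ h')
    (γ : Path (Zipped.star hf h) (Zipped.star hf h)) :
    FundamentalGroup.mapOfEq (Zipped.map f hh) (Zipped.map_star hf hh)
        (FundamentalGroup.fromPath (Path.Homotopic.Quotient.mk γ)) =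
      FundamentalGroup.fromPath (Path.Homotopic.Quotient.mk
        ((γ.map (Zipped.map f hh).continuous).cast (Zipped.map_star hf hh).symm
          (Zipped.map_star hf hh).symm)) :=
  FundamentalGroup.mapOfEq_apply _ _ _

theorem Zipped.mapOfEq_mapOfEq (hf : UnboundedBelow f) (i j k : ℝ) (hij : i ≤ j) (hjk : j ≤ k)
    (p : FundamentalGroup (Zipped f i) (Zipped.star hf i)) :
    FundamentalGroup.mapOfEq (Zipped.map f hjk) (Zipped.map_star hf hjk)
        (FundamentalGroup.mapOfEq (Zipped.map f hij) (Zipped.map_star hf hij) p) =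
      FundamentalGroup.mapOfEq (Zipped.map f (hij.trans hjk))
        (Zipped.map_star hf (hij.trans hjk)) p := by
  induction p using Path.Homotopic.Quotient.ind with
  | mk γ =>
    erw [Zipped.mapOfEq_mk, Zipped.mapOfEq_mk, Zipped.mapOfEq_mk]
    refine congrArg (fun γ => FundamentalGroup.fromPath (Path.Homotopic.Quotient.mk γ)) ?_
    ext t
    obtain ⟨x, hx⟩ := Quotient.exists_rep (γ t)
    simp [← hx]
    rfl

instance [PathConnectedSpace Q] : PathConnectedSpace (Zipped f h) :=
  Quotient.mk_surjective.pathConnectedSpace continuous_quotient_mk'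

end ZippedLemmas

/-! ## Periodic connected sums -/

section Core

open Set unitInterval

/-- `Q` is, topologically, obtained from a space `Y` with a height function by gluing in copies of
`X`, one for each integer `k`, near height `T * k`; the function `f` on `Q` is at bounded distance
from the height. -/
structure PeriodicSum (Q X Y : Type*) [TopologicalSpace Q] [TopologicalSpace X]
    [TopologicalSpace Y] (f : Q → ℝ) where
  height : C(Y, ℝ)
  flow : C(ℝ × Y, Y)
  flow_zero : ∀ y, flow (0, y) = y
  height_flow : ∀ s y, height (flow (s, y)) = height y - s
  base : OpenPartialHomeomorph Q Y
  summand : ℤ → OpenPartialHomeomorph Q X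
  hole : ℤ → Set Y
  disc : Set X
  isOpen_hole : ∀ k, IsOpen (hole k)
  isOpen_disc : IsOpen disc
  isSimplyConnected_disc : IsSimplyConnected disc
  isSimplyConnected_hole : ∀ k, IsSimplyConnected (hole k ∩ base.target)
  isPathConnected_base : IsPathConnected base.source
  cover : ∀ x, x ∈ base.source ∨ ∃ k, x ∈ (summand k).source
  cover_base : ∀ y, y ∈ base.target ∨ ∃ k, y ∈ hole k
  cover_summand : ∀ k x, x ∈ (summand k).target ∨ x ∈ disc
  disjoint_summand : ∀ k l x, x ∈ (summand k).source → x ∈ (summand l).source → k = l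
  disjoint_hole : ∀ k l y, y ∈ hole k → y ∈ hole l → k = l
  mem_base_iff : ∀ k, ∀ x ∈ (summand k).source, x ∈ base.source ↔ summand k x ∈ disc
  period : ℝ
  period_pos : 0 < period
  bound : ℝ
  bound_pos : 0 < bound
  base_bound : ∀ x ∈ base.source, |f x - height (base x)| ≤ bound
  summand_bound : ∀ k, ∀ x ∈ (summand k).source, |f x - period * k| ≤ bound
  hole_bound : ∀ k, ∀ y ∈ hole k, |height y - period * k| ≤ bound
  exists_low : ∀ s, ∃ x ∈ base.source, f x ≤ s
  continuous_fun : Continuous f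

namespace PeriodicSum

variable {Q X Y : Type*} [TopologicalSpace Q] [TopologicalSpace X] [TopologicalSpace Y]
  {f : Q → ℝ} (S : PeriodicSum Q X Y f)

include S in
theorem unboundedBelow : UnboundedBelow f := fun s =>
  let ⟨x, _, hx⟩ := S.exists_low s
  ⟨x, hx⟩

/-- A transport on `Y` which is trivial on paths with low end points in `base.target`, provided it
is so locally. -/
theorem transport_eq_one {G : Type*} [Group G] {F : PathFunction Y G} (hF : IsTransport F) {s : ℝ}
    (hlow : ∀ ⦃x y : Y⦄ (γ : Path x y), (∀ t, S.height (γ t) < s) → F γ = 1)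
    {x y : Y} (γ : Path x y) (hx : S.height x < s) (hy : S.height y < s) : F γ = 1 := by
  obtain ⟨B, hB⟩ : ∃ B, ∀ t : I, S.height (γ t) ≤ B := by
    obtain ⟨B, hB⟩ := (isCompact_range (S.height.continuous.comp γ.continuous)).bddAbove
    exact ⟨B, fun t => hB ⟨t, rfl⟩⟩
  -- `K` is the time after which the flow has brought the whole path, of height at most `B`, below
  -- `s`.
  let K : ℝ := max 0 (B - s + 1)
  let H : C(ℝ × ℝ, Y) := S.flow.comp ⟨fun u => (K * u.1, γ.extend u.2), by fun_prop⟩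
  have hH : ∀ u, S.height (H u) = S.height (γ.extend u.2) - K * u.1 := fun u => S.height_flow _ _
  have hK : 0 ≤ K := le_max_left _ _
  have tri : ∀ a b c, F.segment H b c * F.segment H a b = F.segment H a c := fun a b c =>
    hF.segment_mul H convex_univ (mapsTo_univ _ _) (mem_univ a) (mem_univ b) (mem_univ c)
  have low : ∀ a b : ℝ × ℝ, (∀ t : I, S.height (H (AffineMap.lineMap a b (t : ℝ))) < s) →
      F.segment H a b = 1 := fun a b h => hlow _ fun t => by simpa using h t
  have e1 : F.segment H (0, 0) (0, 1) = F γ := F.congr_apply _ _ fun t => by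
    simp [H, AffineMap.lineMap_apply, S.flow_zero]
  have e2 : F.segment H (0, 0) (1, 0) = 1 := low _ _ fun t => by
    rw [hH]
    simp only [AffineMap.lineMap_apply]
    simp
    nlinarith [t.2.1]
  have e3 : F.segment H (0, 1) (1, 1) = 1 := low _ _ fun t => by
    rw [hH]
    simp only [AffineMap.lineMap_apply]
    simp
    nlinarith [t.2.1]
  have e4 : F.segment H (1, 0) (1, 1) = 1 := low _ _ fun t => by
    rw [hH]
    simp only [AffineMap.lineMap_apply]
    simp
    have := hB t
    have h2 : B - s + 1 ≤ K := le_max_right _ _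
    linarith
  -- Compare the two ways around the square swept by the flow. The pushed path is low, and the
  -- tracks of the end points start low and descend, so three sides are trivial and so is the
  -- fourth, which is `γ`.
  have h1 := tri (0, 0) (0, 1) (1, 1)
  rw [← tri (0, 0) (1, 0) (1, 1), e1, e2, e3, e4] at h1
  simpa using h1

variable {h : ℝ} {z₀ : Zipped f h}

/-- Paths in the base with low end points are null homotopic modulo a sublevel. -/
theorem loopTransport_base (ν : ∀ z, Path z₀ z)
    (hz₀ : ∀ x, f x ≤ h → Zipped.mk f h x = z₀)
    {x y : Q} (γ : Path x y) (hγ : ∀ t, γ t ∈ S.base.source)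
    (hx : f x ≤ h - 5 * S.bound) (hy : f y ≤ h - 5 * S.bound) :
    loopTransport ν (γ.map (Zipped.mk f h).continuous) = 1 := by
  classical
  set C := S.bound with hC
  have C0 : 0 < C := S.bound_pos
  have hT := isTransport_loopTransport ν
  let m : Y → Zipped f h := fun y => Zipped.mk f h (S.base.symm y)
  have hm : ContinuousOn m S.base.target :=
    (Zipped.mk f h).continuous.comp_continuousOn S.base.continuousOn_symm
  have hFW : IsTransportOn ((loopTransport ν).comap m) S.base.target :=
    hT.comap hm (mapsTo_univ _ _)
  have hlow : ∀ y ∈ S.base.target, S.height y ≤ h - C → m y = z₀ := fun y hy h' => by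
    have := abs_le.1 (S.base_bound _ (S.base.map_target hy))
    rw [S.base.right_inv hy] at this
    exact hz₀ _ (by linarith [this.2])
  have hlowT : ∀ ⦃x y : Y⦄ (γ : Path x y), (∀ t, γ t ∈ S.base.target) →
      (∀ t, S.height (γ t) ≤ h - C) → (loopTransport ν).comap m γ = 1 := fun x y γ h1 h2 => by
    rw [PathFunction.comap_eq hm γ h1 (Path.refl z₀) fun t => (hlow _ (h1 t) (h2 t)).symm,
      hT.map_refl (mem_univ _)]
  choose κ hκ using fun k => (hFW.mono (inter_subset_right (s := S.hole k))).exists_gauge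
    (S.isSimplyConnected_hole k)
  -- The gauge trivialises the transport on the punctured holes with `h < period * k + 2 * C`. The
  -- other holes have height at most `h - C`, so they map to the base point and need no correction.
  -- The corrected holes lie above `h - 3 * C`, so the gauge is `1` below that height.
  let g : Y → FundamentalGroup (Zipped f h) z₀ := fun y =>
    if hy : ∃ k, y ∈ S.hole k ∧ h < S.period * k + 2 * C then (κ hy.choose y)⁻¹ else 1
  have g1 : ∀ k y, y ∈ S.hole k → h < S.period * k + 2 * C → g y = (κ k y)⁻¹ := by
    intro k y hy hk
    have hy' : ∃ k, y ∈ S.hole k ∧ h < S.period * k + 2 * C := ⟨k, hy, hk⟩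
    simp only [g, dif_pos hy']
    rw [S.disjoint_hole _ _ _ hy'.choose_spec.1 hy]
  have g2 : ∀ k y, y ∈ S.hole k → ¬ h < S.period * k + 2 * C → g y = 1 := by
    intro k y hy hk
    refine dif_neg ?_
    rintro ⟨l, hl, hl'⟩
    rw [S.disjoint_hole _ _ _ hl hy] at hl'
    exact hk hl'
  have g3 : ∀ y, S.height y < h - 3 * C → g y = 1 := by
    intro y hy
    refine dif_neg ?_
    rintro ⟨l, hl, hl'⟩
    have := abs_le.1 (S.hole_bound l y hl)
    linarith [this.1]
  have hF' := hFW.gauge g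
  have key : ∀ k, ∀ ⦃x y : Y⦄ (γ : Path x y), (∀ t, γ t ∈ S.base.target) →
      (∀ t, γ t ∈ S.hole k) → g y * (loopTransport ν).comap m γ * (g x)⁻¹ = 1 := by
    intro k x y γ h1 h2
    have hx : x ∈ S.hole k := by simpa using h2 0
    have hy : y ∈ S.hole k := by simpa using h2 1
    by_cases hk : h < S.period * k + 2 * C
    · rw [g1 k y hy hk, g1 k x hx hk, hκ k γ fun t => ⟨h2 t, h1 t⟩]
      group
    · rw [g2 k y hy hk, g2 k x hx hk, hlowT γ h1 fun t => ?_]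
      · group
      · have := abs_le.1 (S.hole_bound k _ (h2 t))
        linarith [this.2]
  -- Being trivial on the punctured holes after the gauge change, the transport extends over the
  -- full holes by `1`. It is then defined on all of `Y`, where the flow is available.
  obtain ⟨F, hF, hFe⟩ := exists_isTransport_of_cover
    (U := fun i : Option ℤ => i.elim S.base.target S.hole)
    (F := fun i : Option ℤ => i.elim
      (fun x y γ => g y * (loopTransport ν).comap m γ * (g x)⁻¹) fun _ _ _ _ => 1)
    (fun i => by
      cases i
      exacts [S.base.open_target, S.isOpen_hole _])
    (fun y => by
      rcases S.cover_base y with hy | ⟨k, hy⟩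
      exacts [⟨none, hy⟩, ⟨some k, hy⟩])
    (fun i => by
      cases i
      exacts [hF', IsTransportOn.one])
    (fun i j x y γ hi hj => by
      cases i with
      | none => cases j with
        | none => rfl
        | some k => exact key k γ hi hj
      | some k => cases j with
        | none => exact (key k γ hj hi).symm
        | some l => rfl)
  have hF1 : ∀ ⦃x y : Y⦄ (γ : Path x y), (∀ t, S.height (γ t) < h - 3 * C) → F γ = 1 := by
    intro x y γ hγ
    refine IsTransport.eq_one hF (L := {y | S.height y < h - 3 * C}) (fun z hz => ?_) γ hγ
    rcases S.cover_base z with hz | ⟨k, hz⟩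
    · refine ⟨_, S.base.open_target, hz, fun x y γ h1 h2 => ?_⟩
      have e := hFe none γ h1
      simp only [Option.elim_none] at e
      rw [e, g3 x (by simpa using h2 0), g3 y (by simpa using h2 1), hlowT γ h1 fun t => ?_]
      · group
      · have := h2 t
        rw [mem_ofPred_eq] at this
        linarith
    · exact ⟨_, S.isOpen_hole k, hz, fun x y γ h1 h2 => hFe (some k) γ h1⟩
  -- Passing from `f` to the height costs one `C`, which gives at most `h - 4 * C`; this leaves room
  -- for the strict bound `h - 3 * C`.
  have hb : ∀ z ∈ S.base.source, f z ≤ h - 5 * C → S.height (S.base z) < h - 3 * C := by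
    intro z hz hz'
    have := abs_le.1 (S.base_bound z hz)
    linarith [this.1]
  have hxs : x ∈ S.base.source := by simpa using hγ 0
  have hys : y ∈ S.base.source := by simpa using hγ 1
  let γ' : Path (S.base x) (S.base y) :=
    γ.map' (S.base.continuousOn.mono (range_subset_iff.2 hγ))
  have hγ' : ∀ t, γ' t ∈ S.base.target := fun t => S.base.map_source (hγ t)
  have h1 := S.transport_eq_one hF hF1 γ' (hb x hxs hx) (hb y hys hy)
  have e := hFe none γ' hγ'
  simp only [Option.elim_none] at e
  rw [e, g3 _ (hb x hxs hx), g3 _ (hb y hys hy), inv_one, one_mul, mul_one,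
    PathFunction.comap_eq hm γ' hγ' (γ.map (Zipped.mk f h).continuous) fun t => ?_] at h1
  · exact h1
  · exact congrArg (Zipped.mk f h) (S.base.left_inv (hγ t)).symm

end PeriodicSum

end Core

/-! ### Transports on the summands and on the quotient by a sublevel -/

section Core

open Set unitInterval

namespace PeriodicSum

variable {Q X Y : Type*} [TopologicalSpace Q] [TopologicalSpace X] [TopologicalSpace Y]
  {f : Q → ℝ} (S : PeriodicSum Q X Y f) {h : ℝ} {z₀ : Zipped f h}

/-- The transport on `Q` defined by the fundamental group of `Q / {f ≤ h}`. -/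
noncomputable def transport (ν : ∀ z, Path z₀ z) : PathFunction Q (FundamentalGroup _ z₀) :=
  fun _ _ γ => loopTransport ν (γ.map (Zipped.mk f h).continuous)

theorem isTransport_transport (ν : ∀ z, Path z₀ z) : IsTransport (transport ν) := by
  refine ((isTransport_loopTransport ν).comap (Zipped.mk f h).continuous.continuousOn
    (mapsTo_univ univ _)).congr fun x y γ _ => ?_
  exact (PathFunction.comap_eq (Zipped.mk f h).continuous.continuousOn γ (fun _ => mem_univ _) _
    fun _ => rfl).symm

/-- In a suitable gauge, this transport is trivial on the base. -/
theorem exists_gauge_base (ν : ∀ z, Path z₀ z)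
    (hz₀ : ∀ x, f x ≤ h → Zipped.mk f h x = z₀) :
    ∃ g : Q → FundamentalGroup (Zipped f h) z₀,
      (∀ x, f x ≤ h - 5 * S.bound → g x = 1) ∧
      (∀ ⦃x y : Q⦄ (γ : Path x y), (∀ t, γ t ∈ S.base.source) →
        g y * transport ν γ * (g x)⁻¹ = 1) ∧
      ∀ x ∈ S.base.source, ∃ (w : Q) (ρ : Path w x), f w ≤ h - 5 * S.bound ∧
        (∀ t, ρ t ∈ S.base.source) ∧ g x = (transport ν ρ)⁻¹ := by
  classical
  -- The gauge undoes the transport along a path of the base from one low point `w`. By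
  -- `loopTransport_base`, loops of the base at `w` are trivial, so the choice of path is
  -- irrelevant; for the same reason the gauge is `1` at low points.
  obtain ⟨w, hw, hwlow⟩ := S.exists_low (h - 5 * S.bound)
  have hT := isTransport_transport ν
  have hj : ∀ x ∈ S.base.source, JoinedIn S.base.source w x := fun x hx =>
    S.isPathConnected_base.joinedIn w hw x hx
  let g : Q → FundamentalGroup (Zipped f h) z₀ := fun x =>
    if hx : x ∈ S.base.source then (transport ν (hj x hx).somePath)⁻¹ else 1
  have g1 : ∀ x (hx : x ∈ S.base.source), g x = (transport ν (hj x hx).somePath)⁻¹ :=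
    fun x hx => dif_pos hx
  refine ⟨g, fun x hx => ?_, fun x y γ hγ => ?_, fun x hx =>
    ⟨w, _, hwlow, (hj x hx).somePath_mem, g1 x hx⟩⟩
  · by_cases hx' : x ∈ S.base.source
    · rw [g1 x hx', inv_eq_one]
      exact S.loopTransport_base ν hz₀ _ (hj x hx').somePath_mem hwlow hx
    · exact dif_neg hx'
  · have hx : x ∈ S.base.source := by simpa using hγ 0
    have hy : y ∈ S.base.source := by simpa using hγ 1
    rw [g1 x hx, g1 y hy, inv_inv, mul_assoc, ← hT.map_trans', ← hT.map_symm, ← hT.map_trans']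
    exact S.loopTransport_base ν hz₀ _
      (Path.trans_mem (Path.trans_mem (hj x hx).somePath_mem hγ)
        fun t => (hj y hy).somePath_mem _) hwlow hwlow

/-- A transport on `Q` which is trivial on the base induces one on each summand. -/
theorem exists_transport_summand {G : Type*} [Group G] {F : PathFunction Q G} (hF : IsTransport F)
    (hFW : ∀ ⦃x y : Q⦄ (γ : Path x y), (∀ t, γ t ∈ S.base.source) → F γ = 1) (k : ℤ) :
    ∃ F' : PathFunction X G, IsTransport F' ∧
      (∀ ⦃x y : X⦄ (γ : Path x y), (∀ t, γ t ∈ S.disc) → F' γ = 1) ∧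
      ∀ ⦃x y : Q⦄ (δ : Path x y) ⦃x' y' : X⦄ (γ : Path x' y'),
        (∀ t, δ t ∈ (S.summand k).source) → (∀ t, γ t = S.summand k (δ t)) → F' γ = F δ := by
  have hc := (S.summand k).continuousOn_symm
  have key : ∀ ⦃x y : X⦄ (γ : Path x y), (∀ t, γ t ∈ (S.summand k).target) →
      (∀ t, γ t ∈ S.disc) → F.comap (S.summand k).symm γ = 1 := by
    intro x y γ h1 h2
    rw [PathFunction.comap_apply hc γ h1]
    refine hFW _ fun t => ?_
    refine (S.mem_base_iff k _ ((S.summand k).map_target (h1 t))).2 ?_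
    rw [(S.summand k).right_inv (h1 t)]
    exact h2 t
  obtain ⟨F', hF', he⟩ := exists_isTransport_of_cover
    (U := fun i : Bool => cond i S.disc (S.summand k).target)
    (F := fun i : Bool => cond i (fun _ _ _ => 1) (F.comap (S.summand k).symm))
    (fun i => by
      cases i
      exacts [(S.summand k).open_target, S.isOpen_disc])
    (fun x => by
      rcases S.cover_summand k x with hx | hx
      exacts [⟨false, hx⟩, ⟨true, hx⟩])
    (fun i => by
      cases i
      exacts [hF.comap hc (mapsTo_univ _ _), IsTransportOn.one])
    (fun i j x y γ hi hj => by
      cases i <;> cases j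
      exacts [rfl, key γ hi hj, (key γ hj hi).symm, rfl])
  refine ⟨F', hF', he true, fun x y δ x' y' γ hδ hγ => ?_⟩
  have hγ' : ∀ t, γ t ∈ (S.summand k).target := fun t => by
    rw [hγ]
    exact (S.summand k).map_source (hδ t)
  rw [he false γ hγ']
  exact PathFunction.comap_eq hc γ hγ' δ fun t => by rw [hγ, (S.summand k).left_inv (hδ t)]

include S in
/-- A transport on `X` which computes the fundamental group and is trivial on the disc. -/
theorem exists_paths_disc [PathConnectedSpace X] : ∃ (x₁ : X) (ν : ∀ x, Path x₁ x),
    x₁ ∈ S.disc ∧ ν x₁ = Path.refl x₁ ∧ (∀ x ∈ S.disc, ∀ t, ν x t ∈ S.disc) ∧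
    ∀ ⦃x y : X⦄ (γ : Path x y), (∀ t, γ t ∈ S.disc) → loopTransport ν γ = 1 := by
  classical
  obtain ⟨hpc, hloop⟩ := isSimplyConnected_iff_exists_homotopy_refl_forall_mem.1
    S.isSimplyConnected_disc
  obtain ⟨x₁, hx₁, hj⟩ := hpc
  let ν : ∀ x, Path x₁ x := fun x =>
    if h : x₁ = x then (Path.refl x₁).cast rfl h.symm else
      if h : x ∈ S.disc then (hj h).somePath else PathConnectedSpace.somePath x₁ x
  have h1 : ν x₁ = Path.refl x₁ := by
    simp only [ν, dif_pos]
    rfl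
  have h2 : ∀ x ∈ S.disc, ∀ t, ν x t ∈ S.disc := by
    intro x hx t
    by_cases h : x₁ = x
    · subst h
      rw [h1]
      exact hx
    · simp only [ν, dif_neg h, dif_pos hx]
      exact (hj hx).somePath_mem t
  refine ⟨x₁, ν, hx₁, h1, h2, fun x y γ hγ => ?_⟩
  have hx : x ∈ S.disc := by simpa using hγ 0
  have hy : y ∈ S.disc := by simpa using hγ 1
  obtain ⟨H, -⟩ := hloop x₁ ((ν x).trans (γ.trans (ν y).symm))
    (Path.trans_mem (h2 x hx) (Path.trans_mem hγ fun t => h2 y hy _))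
  exact Path.Homotopic.Quotient.eq_one_iff.2 ⟨H⟩

variable {G : Type*} [Group G]

/-- The index `m` lies above the sublevel `h`. -/
def Above (h : ℝ) (m : ℤ) : Prop := h + 1 + S.bound < S.period * m

/-- The index `m` lies below the sublevel `h`. -/
def Below (m : ℤ) (h : ℝ) : Prop := S.period * m + 6 * S.bound ≤ h

-- The unit of slack in `Above` keeps the open neighbourhood `{f < h + 1}` of the collapsed sublevel
-- away from all summands of index at least `m`.
variable {S} in
theorem Above.lt_of_mem {m : ℤ} (hm : S.Above h m) {k : ℤ} (hk : m ≤ k) {x : Q}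
    (hx : x ∈ (S.summand k).source) : h + 1 < f x := by
  have h1 := abs_le.1 (S.summand_bound k x hx)
  have h2 : S.period * m ≤ S.period * k :=
    mul_le_mul_of_nonneg_left (by exact_mod_cast hk) S.period_pos.le
  have h3 : h + 1 + S.bound < S.period * m := hm
  linarith [h1.1]

-- Of the six bounds in `Below`, one absorbs the spread of `f` on a summand; the other five bring it
-- to the range where the gauge of `exists_gauge_base` is `1`.
variable {S} in
theorem Below.le_of_mem {m : ℤ} (hm : S.Below m h) {k : ℤ} (hk : k ≤ m) {x : Q}
    (hx : x ∈ (S.summand k).source) : f x ≤ h - 5 * S.bound := by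
  have h1 := abs_le.1 (S.summand_bound k x hx)
  have h2 : S.period * k ≤ S.period * m :=
    mul_le_mul_of_nonneg_left (by exact_mod_cast hk) S.period_pos.le
  have h3 : S.period * m + 6 * S.bound ≤ h := hm
  linarith [h1.2]

/-- The complement of the cores of the summands of index at least `m`. -/
def lower (m : ℤ) : Set Q := S.base.source ∪ ⋃ k < m, (S.summand k).source

theorem isOpen_lower (m : ℤ) : IsOpen (S.lower m) :=
  S.base.open_source.union (isOpen_biUnion fun k _ => (S.summand k).open_source)

variable {S} in
theorem Above.mem_lower {m : ℤ} (hm : S.Above h m) {x : Q} (hx : f x ≤ h + 1) : x ∈ S.lower m := by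
  rcases S.cover x with hx' | ⟨k, hk⟩
  · exact Or.inl hx'
  · refine Or.inr (mem_biUnion (x := k) (show k < m from ?_) hk)
    by_contra! hkm
    exact (hm.lt_of_mem hkm hk).not_ge hx

/-- The transport on `Q / {f ≤ h}` given by the summands of index at least `m`. -/
theorem exists_transport_zipped {F : PathFunction X G} (hF : IsTransport F)
    (hFd : ∀ ⦃x y : X⦄ (γ : Path x y), (∀ t, γ t ∈ S.disc) → F γ = 1) {m : ℤ}
    (hm : S.Above h m) :
    ∃ F' : PathFunction (Zipped f h) (FreePower G m), IsTransport F' ∧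
      (∀ ⦃x y⦄ (γ : Path x y), (∀ t, γ t ∈ Zipped.mk f h '' S.lower m) → F' γ = 1) ∧
      ∀ (k : ℤ) (hk : m ≤ k) ⦃x y : Q⦄ (δ : Path x y) ⦃x' y' : X⦄ (γ : Path x' y')
        ⦃z w : Zipped f h⦄ (ε : Path z w),
        (∀ t, δ t ∈ (S.summand k).source) → (∀ t, γ t = S.summand k (δ t)) →
        (∀ t, ε t = Zipped.mk f h (δ t)) →
        F' ε = Monoid.CoprodI.of (M := fun _ : {k : ℤ // m ≤ k} => G) (i := ⟨k, hk⟩) (F γ) := by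
  have hV : ∀ x, f x ≤ h → x ∈ S.lower m := fun x hx => hm.mem_lower (by linarith)
  have hV' : ∀ i : {k : ℤ // m ≤ k}, ∀ x ∈ (S.summand i.1).source, h < f x := fun i x hx => by
    linarith [hm.lt_of_mem i.2 hx]
  have hc : ∀ i : {k : ℤ // m ≤ k}, ContinuousOn (fun z : Zipped f h => S.summand i.1 z.out)
      (Zipped.mk f h '' (S.summand i.1).source) := fun i =>
    (S.summand i.1).continuousOn.comp
      (Zipped.continuousOn_out (S.summand i.1).open_source (hV' i)) (by
        rintro _ ⟨x, hx, rfl⟩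
        rwa [Zipped.out_mk (hV' i x hx)])
  have hloc : ∀ i : {k : ℤ // m ≤ k},
      IsTransportOn (F.comap fun z : Zipped f h => S.summand i.1 z.out)
        (Zipped.mk f h '' (S.summand i.1).source) := fun i => hF.comap (hc i) (mapsTo_univ _ _)
  -- A point of a summand of index at least `m` that lies in `lower m` cannot belong to a summand of
  -- smaller index, hence lies in the base and maps to `disc`, where `F` is trivial.
  have key : ∀ (i : {k : ℤ // m ≤ k}) ⦃x y⦄ (γ : Path x y),
      (∀ t, γ t ∈ Zipped.mk f h '' S.lower m) →
      (∀ t, γ t ∈ Zipped.mk f h '' (S.summand i.1).source) →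
      F.comap (fun z : Zipped f h => S.summand i.1 z.out) γ = 1 := by
    intro i x y γ h1 h2
    rw [PathFunction.comap_apply (hc i) γ h2]
    refine hFd _ fun t => ?_
    obtain ⟨x, hx, e⟩ := h2 t
    have hx' := h1 t
    rw [← e, Zipped.mem_image_iff hV] at hx'
    change S.summand i.1 (γ t).out ∈ S.disc
    rw [← e, Zipped.out_mk (hV' i x hx), ← S.mem_base_iff i.1 x hx]
    refine hx'.resolve_right fun hx'' => ?_
    simp only [mem_iUnion] at hx''
    obtain ⟨l, hl, hl'⟩ := hx''
    rw [S.disjoint_summand l i.1 x hl' hx] at hl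
    exact hl.not_ge i.2
  have key' : ∀ (i j : {k : ℤ // m ≤ k}) (z : Zipped f h),
      z ∈ Zipped.mk f h '' (S.summand i.1).source → z ∈ Zipped.mk f h '' (S.summand j.1).source →
      i = j := by
    rintro i j _ ⟨x, hx, rfl⟩ hj
    rw [Zipped.mem_image_iff' (hV' j)] at hj
    exact Subtype.ext (S.disjoint_summand _ _ x hx hj)
  obtain ⟨F', hF', he⟩ := exists_isTransport_of_cover (G := FreePower G m)
    (U := fun i : Option {k : ℤ // m ≤ k} => i.elim (Zipped.mk f h '' S.lower m)
      fun i => Zipped.mk f h '' (S.summand i.1).source)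
    (F := fun i : Option {k : ℤ // m ≤ k} => i.elim (fun _ _ _ => 1) fun i x y γ =>
      Monoid.CoprodI.of (M := fun _ : {k : ℤ // m ≤ k} => G) (i := i)
        (F.comap (fun z : Zipped f h => S.summand i.1 z.out) γ))
    (fun i => by
      cases i
      exacts [Zipped.isOpen_image (S.isOpen_lower m) hV,
        Zipped.isOpen_image' (S.summand _).open_source (hV' _)])
    (fun z => by
      obtain ⟨x, rfl⟩ : ∃ x, Zipped.mk f h x = z := ⟨_, Zipped.mk_out z⟩
      by_cases hx : x ∈ S.lower m
      · exact ⟨none, x, hx, rfl⟩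
      · obtain ⟨k, hk⟩ := (S.cover x).resolve_left fun h' => hx (Or.inl h')
        refine ⟨some ⟨k, ?_⟩, x, hk, rfl⟩
        by_contra! hkm
        exact hx (Or.inr (mem_biUnion (x := k) hkm hk)))
    (fun i => by
      cases i
      exacts [IsTransportOn.one, (hloc _).comp_hom _])
    (fun i j x y γ hi hj => by
      cases i with
      | none => cases j with
        | none => rfl
        | some k => exact ((congrArg _ (key k γ hi hj)).trans (map_one
            (Monoid.CoprodI.of (M := fun _ : {k : ℤ // m ≤ k} => G) (i := k)))).symm
      | some k => cases j with
        | none => exact (congrArg _ (key k γ hj hi)).trans (map_one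
            (Monoid.CoprodI.of (M := fun _ : {k : ℤ // m ≤ k} => G) (i := k)))
        | some l =>
          obtain rfl := key' k l _ (hi 0) (hj 0)
          rfl)
  refine ⟨F', hF', he none, fun k hk x y δ x' y' γ z w ε hδ hγ hε => ?_⟩
  have hε' : ∀ t, ε t ∈ Zipped.mk f h '' (S.summand k).source := fun t => ⟨δ t, hδ t, (hε t).symm⟩
  refine (he (some ⟨k, hk⟩) ε hε').trans (congrArg
    (Monoid.CoprodI.of (M := fun _ : {k : ℤ // m ≤ k} => G) (i := ⟨k, hk⟩)) ?_)
  refine PathFunction.comap_eq (hc ⟨k, hk⟩) ε hε' γ fun t => ?_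
  rw [hγ, hε, Zipped.out_mk (hV' ⟨k, hk⟩ _ (hδ t))]

end PeriodicSum

end Core

/-! ### The two composites, and the limit for a periodic sum -/

section Core

open Set unitInterval

namespace PeriodicSum

variable {Q X Y : Type*} [TopologicalSpace Q] [TopologicalSpace X] [TopologicalSpace Y]
  {f : Q → ℝ} (S : PeriodicSum Q X Y f) {h : ℝ} {z₀ : Zipped f h}
  {G : Type*} [Group G]

/-- Going from a sublevel `h` to the free product and back to a higher sublevel `h'`. -/
theorem transport_roundtrip_zipped {h' : ℝ} (hh : h ≤ h') {m : ℤ} (hm : S.Above h m)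
    (hm' : S.Below m h')
    {z₁ : Zipped f h'} (hz₁ : ∀ x, f x ≤ h' → Zipped.mk f h' x = z₁) (ν : ∀ z, Path z₁ z)
    {g : Q → FundamentalGroup (Zipped f h') z₁}
    (g2 : ∀ x, f x ≤ h' - 5 * S.bound → g x = 1)
    (g3 : ∀ ⦃x y : Q⦄ (γ : Path x y), (∀ t, γ t ∈ S.base.source) →
        g y * transport ν γ * (g x)⁻¹ = 1)
    {P : ℤ → PathFunction X (FundamentalGroup (Zipped f h') z₁)}
    (P2 : ∀ k ⦃x y : X⦄ (γ : Path x y), (∀ t, γ t ∈ S.disc) → P k γ = 1)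
    (P3 : ∀ k ⦃x y : Q⦄ (δ : Path x y) ⦃x' y' : X⦄ (γ : Path x' y'),
        (∀ t, δ t ∈ (S.summand k).source) → (∀ t, γ t = S.summand k (δ t)) →
        P k γ = g y * transport ν δ * (g x)⁻¹)
    {x₁ : X} {ρ : ∀ x, Path x₁ x} (hρ : ∀ x ∈ S.disc, ∀ t, ρ x t ∈ S.disc)
    {F : PathFunction X G}
    {R : PathFunction (Zipped f h) (FreePower G m)} (hR : IsTransport R)
    (R2 : ∀ ⦃x y⦄ (γ : Path x y), (∀ t, γ t ∈ Zipped.mk f h '' S.lower m) → R γ = 1)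
    (R3 : ∀ (k : ℤ) (hk : m ≤ k) ⦃x y : Q⦄ (δ : Path x y) ⦃x' y' : X⦄ (γ : Path x' y')
        ⦃z w : Zipped f h⦄ (ε : Path z w),
        (∀ t, δ t ∈ (S.summand k).source) → (∀ t, γ t = S.summand k (δ t)) →
        (∀ t, ε t = Zipped.mk f h (δ t)) →
        R ε = Monoid.CoprodI.of (M := fun _ : {k : ℤ // m ≤ k} => G) (i := ⟨k, hk⟩) (F γ))
    {Ψ : FreePower G m →* FundamentalGroup (Zipped f h') z₁}
    (hΨ : ∀ (k : {k : ℤ // m ≤ k}) ⦃x y : X⦄ (γ : Path x y),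
      Ψ (Monoid.CoprodI.of (M := fun _ : {k : ℤ // m ≤ k} => G) (i := k) (F γ)) =
        (P k.1 (ρ y))⁻¹ * P k.1 γ * P k.1 (ρ x))
    (hz₀' : f z₀.out ≤ h) (γ : Path z₀ z₀) :
    Ψ (R γ) = loopTransport ν (γ.map (Zipped.map f hh).continuous) := by
  classical
  have hb := S.bound_pos
  have hhh : h + 1 ≤ h' - 5 * S.bound := by
    have h1 : h + 1 + S.bound < S.period * m := hm
    have h2 : S.period * m + 6 * S.bound ≤ h' := hm'
    linarith
  have hT := isTransport_loopTransport ν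
  -- By `hΨ`, the map `Ψ` reproduces `P k` only up to the connecting paths `ρ`, and `P k` is the
  -- transport in the gauge `g`. The product `ψ * g` collects both corrections; it is `1` on the
  -- sublevel, so it descends to the quotient.
  let ψ : Q → FundamentalGroup (Zipped f h') z₁ := fun x =>
    if hx : ∃ k, m ≤ k ∧ x ∈ (S.summand k).source then
      (P hx.choose (ρ (S.summand hx.choose x)))⁻¹ else 1
  have ψ1 : ∀ k x, m ≤ k → x ∈ (S.summand k).source → ψ x = (P k (ρ (S.summand k x)))⁻¹ := by
    intro k x hk hx
    have hx' : ∃ k, m ≤ k ∧ x ∈ (S.summand k).source := ⟨k, hk, hx⟩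
    simp only [ψ, dif_pos hx']
    rw [S.disjoint_summand _ _ x hx'.choose_spec.2 hx]
  have ψ2 : ∀ x, f x ≤ h + 1 → ψ x = 1 := by
    intro x hx
    refine dif_neg ?_
    rintro ⟨k, hk, hx'⟩
    exact (hm.lt_of_mem hk hx').not_ge hx
  have ψ3 : ∀ x ∈ S.base.source, ψ x = 1 := by
    intro x hx
    by_cases hx' : ∃ k, m ≤ k ∧ x ∈ (S.summand k).source
    · obtain ⟨k, hk, hxk⟩ := hx'
      rw [ψ1 k x hk hxk, P2 k _ (hρ _ ((S.mem_base_iff k x hxk).1 hx)), inv_one]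
    · exact dif_neg hx'
  let Γ : Zipped f h → FundamentalGroup (Zipped f h') z₁ := fun z => ψ z.out * g z.out
  have Γlow : ∀ x, f x ≤ h → ψ x * g x = 1 := fun x hx => by
    rw [ψ2 x (by linarith), g2 x (by linarith), one_mul]
  have Γ1 : ∀ x, Γ (Zipped.mk f h x) = ψ x * g x := by
    intro x
    rcases Zipped.out_mk_cases (f := f) (h := h) x with e | ⟨h1, h2⟩
    · change ψ _ * g _ = _
      rw [e]
    · rw [Γlow x h2]
      exact Γlow _ h1
  have key := IsTransport.eq_gauge (hR.comp_hom Ψ)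
    (F' := (loopTransport ν).comap (Zipped.map f hh))
    (hT.comap (Zipped.map f hh).continuous.continuousOn (mapsTo_univ _ _)) Γ (L := univ)
    (fun z _ => ?_) γ fun _ => mem_univ _
  · rw [key, PathFunction.comap_apply (Zipped.map f hh).continuous.continuousOn γ
      fun _ => mem_univ _]
    have : Γ z₀ = 1 := Γlow _ hz₀'
    rw [this, inv_one, one_mul, mul_one]
    rfl
  · have hF' : ∀ ⦃x y : Zipped f h⦄ (γ : Path x y) ⦃x' y' : Q⦄ (δ : Path x' y'),
        (∀ t, Zipped.mk f h (δ t) = γ t) →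
        (loopTransport ν).comap (Zipped.map f hh) γ = transport ν δ := fun x y γ x' y' δ hδ =>
      PathFunction.comap_eq (V := univ) (Zipped.map f hh).continuous.continuousOn γ
        (fun _ => mem_univ _) _ fun t => by
          rw [← hδ]
          rfl
    have hconst : ∀ ⦃x y : Zipped f h⦄ (γ : Path x y),
        (∀ t, Zipped.map f hh (γ t) = z₁) →
        (loopTransport ν).comap (Zipped.map f hh) γ = 1 := fun x y γ h1 => by
      rw [PathFunction.comap_eq (V := univ) (Zipped.map f hh).continuous.continuousOn γ
        (fun _ => mem_univ _) (Path.refl z₁) fun t => (h1 t).symm, hT.map_refl (mem_univ _)]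
    obtain ⟨x, rfl⟩ : ∃ x, Zipped.mk f h x = z := ⟨_, Zipped.mk_out z⟩
    -- Four local cases: near the sublevel, in the base, in a summand of index at least `m`, in a
    -- lower summand. In the first and last everything is collapsed at level `h'` and both
    -- transports are trivial.
    by_cases hx : f x < h + 1
    · have hV : ∀ x, f x ≤ h → x ∈ {x | f x < h + 1} := fun x hx =>
        show f x < h + 1 by linarith
      refine ⟨_, Zipped.isOpen_image (isOpen_lt S.continuous_fun continuous_const) hV,
        ⟨x, hx, rfl⟩, fun z w γ h1 _ => ?_⟩
      have hΓ : ∀ z ∈ Zipped.mk f h '' {x | f x < h + 1}, Γ z = 1 := by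
        rintro _ ⟨x, hx, rfl⟩
        have hx' : f x < h + 1 := hx
        rw [Γ1, ψ2 x hx'.le, g2 x (by linarith), one_mul]
      rw [hΓ z (by simpa using h1 0), hΓ w (by simpa using h1 1), R2 γ fun t => ?_,
        hconst γ fun t => ?_, map_one]
      · group
      · obtain ⟨x, hx, e⟩ := h1 t
        rw [← e]
        exact hz₁ x (by have hx' : f x < h + 1 := hx; linarith)
      · obtain ⟨x, hx, e⟩ := h1 t
        have hx' : f x < h + 1 := hx
        exact ⟨x, hm.mem_lower hx'.le, e⟩
    · have hopen : IsOpen {x | h < f x} := isOpen_lt continuous_const S.continuous_fun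
      have hxh : h < f x := by linarith
      by_cases hxW : x ∈ S.base.source
      · refine ⟨_, Zipped.isOpen_image' (S.base.open_source.inter hopen) fun x hx => hx.2,
          ⟨x, ⟨hxW, hxh⟩, rfl⟩, fun z w γ h1 _ => ?_⟩
        obtain ⟨δ, hδ, e⟩ := Zipped.exists_lift (S.base.open_source.inter hopen)
          (fun x hx => hx.2) γ h1
        have g3' := g3 δ fun t => (hδ t).1
        have hz : z.out ∈ S.base.source := by simpa using (hδ 0).1
        have hw : w.out ∈ S.base.source := by simpa using (hδ 1).1
        rw [hF' γ δ e, R2 γ fun t => ⟨δ t, Or.inl (hδ t).1, e t⟩, map_one]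
        simp only [Γ]
        rw [ψ3 _ hz, ψ3 _ hw, one_mul, one_mul, g3']
      · obtain ⟨k, hk⟩ := (S.cover x).resolve_left hxW
        by_cases hmk : m ≤ k
        · have hV : ∀ x ∈ (S.summand k).source, h < f x := fun x hx => by
            linarith [hm.lt_of_mem hmk hx]
          refine ⟨_, Zipped.isOpen_image' (S.summand k).open_source hV, ⟨x, hk, rfl⟩,
            fun z w γ h1 _ => ?_⟩
          obtain ⟨δ, hδ, e⟩ := Zipped.exists_lift (S.summand k).open_source hV γ h1
          have hz : z.out ∈ (S.summand k).source := by simpa using hδ 0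
          have hw : w.out ∈ (S.summand k).source := by simpa using hδ 1
          let ε : Path (S.summand k z.out) (S.summand k w.out) :=
            δ.map' ((S.summand k).continuousOn.mono (range_subset_iff.2 hδ))
          rw [hF' γ δ e, R3 k hmk δ ε γ hδ (fun _ => rfl) fun t => (e t).symm, hΨ ⟨k, hmk⟩,
            P3 k δ ε hδ fun _ => rfl]
          simp only [Γ]
          rw [ψ1 k _ hmk hz, ψ1 k _ hmk hw]
          group
        · have hlow : ∀ x ∈ (S.summand k).source ∩ {x | h < f x}, f x ≤ h' - 5 * S.bound :=
            fun x hx => hm'.le_of_mem (not_le.1 hmk).le hx.1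
          refine ⟨_, Zipped.isOpen_image' ((S.summand k).open_source.inter hopen) fun x hx => hx.2,
            ⟨x, ⟨hk, hxh⟩, rfl⟩, fun z w γ h1 _ => ?_⟩
          have hΓ : ∀ z ∈ Zipped.mk f h '' ((S.summand k).source ∩ {x | h < f x}), Γ z = 1 := by
            rintro _ ⟨x, hx, rfl⟩
            rw [Γ1, g2 x (hlow x hx), mul_one]
            refine dif_neg ?_
            rintro ⟨l, hl, hl'⟩
            rw [S.disjoint_summand _ _ x hl' hx.1] at hl
            exact hmk hl
          rw [hΓ z (by simpa using h1 0), hΓ w (by simpa using h1 1), R2 γ fun t => ?_,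
            hconst γ fun t => ?_, map_one]
          · group
          · obtain ⟨x, hx, e⟩ := h1 t
            rw [← e]
            exact hz₁ x (by linarith [hlow x hx])
          · obtain ⟨x, hx, e⟩ := h1 t
            exact ⟨x, Or.inr (mem_biUnion (x := k) (not_le.1 hmk) hx.1), e⟩

/-- Going from the free product to a sublevel `h` and back to the free product. -/
theorem transport_roundtrip_freePower {m m' : ℤ} (hmm : m ≤ m')
    (hz₀ : ∀ x, f x ≤ h → Zipped.mk f h x = z₀) {ν : ∀ z, Path z₀ z} (hν : ν z₀ = Path.refl z₀)
    {g : Q → FundamentalGroup (Zipped f h) z₀}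
    (g4 : ∀ x ∈ S.base.source, ∃ (w : Q) (ρ : Path w x), f w ≤ h - 5 * S.bound ∧
        (∀ t, ρ t ∈ S.base.source) ∧ g x = (transport ν ρ)⁻¹)
    {k : ℤ} (hk : m ≤ k)
    {P : PathFunction X (FundamentalGroup (Zipped f h) z₀)} (P1 : IsTransport P)
    (P2 : ∀ ⦃x y : X⦄ (γ : Path x y), (∀ t, γ t ∈ S.disc) → P γ = 1)
    (P3 : ∀ ⦃x y : Q⦄ (δ : Path x y) ⦃x' y' : X⦄ (γ : Path x' y'),
        (∀ t, δ t ∈ (S.summand k).source) → (∀ t, γ t = S.summand k (δ t)) →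
        P γ = g y * transport ν δ * (g x)⁻¹)
    {F : PathFunction X G} (hF : IsTransport F)
    (hFd : ∀ ⦃x y : X⦄ (γ : Path x y), (∀ t, γ t ∈ S.disc) → F γ = 1)
    {R : PathFunction (Zipped f h) (FreePower G m')} (hR : IsTransport R)
    (R2 : ∀ ⦃x y⦄ (γ : Path x y), (∀ t, γ t ∈ Zipped.mk f h '' S.lower m') → R γ = 1)
    (R3 : ∀ (k : ℤ) (hk : m' ≤ k) ⦃x y : Q⦄ (δ : Path x y) ⦃x' y' : X⦄ (γ : Path x' y')
        ⦃z w : Zipped f h⦄ (ε : Path z w),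
        (∀ t, δ t ∈ (S.summand k).source) → (∀ t, γ t = S.summand k (δ t)) →
        (∀ t, ε t = Zipped.mk f h (δ t)) →
        R ε = Monoid.CoprodI.of (M := fun _ : {k : ℤ // m' ≤ k} => G) (i := ⟨k, hk⟩) (F γ))
    {x₁ : X} (hx₁ : x₁ ∈ S.disc) (γ : Path x₁ x₁) :
    IsTransport.toHom hR z₀ (P γ) = FreePower.proj G m m' hmm
      (Monoid.CoprodI.of (M := fun _ : {k : ℤ // m ≤ k} => G) (i := ⟨k, hk⟩) (F γ)) := by
  classical
  set Φ := IsTransport.toHom hR z₀ with hΦ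
  let φ : G →* FreePower G m' := (FreePower.proj G m m' hmm).comp
    (Monoid.CoprodI.of (M := fun _ : {k : ℤ // m ≤ k} => G) (i := ⟨k, hk⟩))
  have hΦT : ∀ ⦃x y : Q⦄ (δ : Path x y), Φ (transport ν δ) =
      (R (ν (Zipped.mk f h y)))⁻¹ * R (δ.map (Zipped.mk f h).continuous) *
        R (ν (Zipped.mk f h x)) := fun x y δ => by
    rw [← hR.map_symm, ← hR.map_trans', ← hR.map_trans']
    rfl
  let s := (S.summand k).symm
  -- On the summand, `Φ` of the gauged transport differs from `R` by `g` and by the connecting paths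
  -- `ν`. On `disc` the correction is `1`: by `g4`, `g` is the inverse transport along a path of the
  -- base from a low point, and `R` is trivial on the base.
  let Γ : X → FreePower G m' := fun x =>
    if x ∈ S.disc then 1 else Φ (g (s x)) * (R (ν (Zipped.mk f h (s x))))⁻¹
  have Γ1 : ∀ x ∈ S.disc, Γ x = 1 := fun x hx => if_pos hx
  have Γ2 : ∀ x ∈ (S.summand k).target, Γ x = Φ (g (s x)) * (R (ν (Zipped.mk f h (s x))))⁻¹ := by
    intro x hx
    by_cases hxd : x ∈ S.disc
    · have hsx : s x ∈ S.base.source := by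
        refine (S.mem_base_iff k _ ((S.summand k).map_target hx)).2 ?_
        rwa [(S.summand k).right_inv hx]
      obtain ⟨w, ρ, hw, hρ, e⟩ := g4 _ hsx
      have hw' : R (ν (Zipped.mk f h w)) = 1 := by
        rw [hz₀ w (by linarith [S.bound_pos]), hν, hR.map_refl (mem_univ _)]
      rw [Γ1 x hxd, e, map_inv, hΦT, hw',
        R2 (ρ.map (Zipped.mk f h).continuous) fun t => ⟨ρ t, Or.inl (hρ t), rfl⟩]
      group
    · exact if_neg hxd
  have key := IsTransport.eq_gauge (P1.comp_hom Φ) (hF.comp_hom φ) Γ (L := univ)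
    (fun x _ => ?_) γ fun _ => mem_univ _
  · rw [key, Γ1 _ hx₁]
    simp [φ]
  · rcases S.cover_summand k x with hx | hx
    · refine ⟨_, (S.summand k).open_target, hx, fun x y γ h1 _ => ?_⟩
      let δ : Path (s x) (s y) :=
        γ.map' ((S.summand k).continuousOn_symm.mono (range_subset_iff.2 h1))
      have hδ : ∀ t, δ t ∈ (S.summand k).source := fun t => (S.summand k).map_target (h1 t)
      have hδ' : ∀ t, γ t = S.summand k (δ t) := fun t => ((S.summand k).right_inv (h1 t)).symm
      have e : R (δ.map (Zipped.mk f h).continuous) = φ (F γ) := by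
        by_cases hk' : m' ≤ k
        · rw [R3 k hk' δ γ _ hδ hδ' fun _ => rfl]
          exact (FreePower.proj_of_le hmm ⟨k, hk⟩ hk' _).symm
        · rw [R2 _ fun t => ⟨δ t, Or.inr (mem_biUnion (x := k) (not_le.1 hk') (hδ t)), rfl⟩]
          exact (FreePower.proj_of_lt hmm ⟨k, hk⟩ hk' _).symm
      rw [P3 δ γ hδ hδ', map_mul, map_mul, map_inv, hΦT, e, Γ2 x (by simpa using h1 0),
        Γ2 y (by simpa using h1 1)]
      group
    · refine ⟨_, S.isOpen_disc, hx, fun x y γ h1 _ => ?_⟩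
      rw [P2 γ h1, hFd γ h1, Γ1 x (by simpa using h1 0), Γ1 y (by simpa using h1 1), map_one, map_one]
      group

/-- The Novikov fundamental group of a periodic connected sum. -/
theorem nonempty_mulEquiv [PathConnectedSpace Q] [PathConnectedSpace X]
    (e : ∀ x : X, FundamentalGroup X x ≃* G) :
    Nonempty (NovikovPi1 f S.unboundedBelow ≃* FreePowerLimit G) := by
  classical
  have hf := S.unboundedBelow
  have hb := S.bound_pos
  have hstar : ∀ h x, f x ≤ h → Zipped.mk f h x = Zipped.star hf h := fun h x hx =>
    Zipped.mk_eq_star hf hx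
  have hstar' : ∀ h, f (Zipped.star hf h).out ≤ h := fun h => by
    obtain ⟨x, hx⟩ := hf h
    rw [← hstar h x hx]
    rcases Zipped.out_mk_cases (h := h) x with e | h'
    exacts [e.symm ▸ hx, h'.1]
  obtain ⟨x₁, ρ, hx₁, hρ1, hρ2, hρ3⟩ := S.exists_paths_disc
  let F : PathFunction X G := fun _ _ γ => e x₁ (loopTransport ρ γ)
  have hF : IsTransport F := (isTransport_loopTransport ρ).comp_hom (e x₁).toMonoidHom
  have hFd : ∀ ⦃x y : X⦄ (γ : Path x y), (∀ t, γ t ∈ S.disc) → F γ = 1 := fun x y γ hγ => by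
    simp only [F]
    rw [hρ3 γ hγ, map_one]
  choose ν hν using fun h => exists_paths (Zipped.star hf h)
  choose g g2 g3 g4 using fun h => S.exists_gauge_base (ν h) (hstar h)
  choose P P1 P2 P3 using fun h k =>
    S.exists_transport_summand ((isTransport_transport (ν h)).gauge (g h)) (g3 h) k
  choose R R1 R2 R3 using fun h m (hm : S.Above h m) => S.exists_transport_zipped hF hFd hm
  let Φ : ∀ h m, S.Above h m →
      (FundamentalGroup (Zipped f h) (Zipped.star hf h) →* FreePower G m) :=
    fun h m hm => IsTransport.toHom (R1 h m hm) (Zipped.star hf h)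
  let Ψ : ∀ m h, S.Below m h →
      (FreePower G m →* FundamentalGroup (Zipped f h) (Zipped.star hf h)) := fun m h _ =>
    Monoid.CoprodI.lift fun k =>
      (IsTransport.toHom (P1 h k.1) x₁).comp (e x₁).symm.toMonoidHom
  -- `F γ` is the class of the loop made of `ρ x`, `γ` and `ρ y` reversed; applying `P` to that loop
  -- gives the conjugating factors.
  have hΨ : ∀ m h (hm : S.Below m h) (k : {k : ℤ // m ≤ k}) ⦃x y : X⦄ (γ : Path x y),
      Ψ m h hm (Monoid.CoprodI.of (M := fun _ : {k : ℤ // m ≤ k} => G) (i := k) (F γ)) =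
        (P h k.1 (ρ y))⁻¹ * P h k.1 γ * P h k.1 (ρ x) := by
    intro m h hm k x y γ
    simp only [Ψ, F]
    rw [Monoid.CoprodI.lift_of, MonoidHom.comp_apply]
    simp only [MulEquiv.toMonoidHom_eq_coe, MonoidHom.coe_coe, MulEquiv.symm_apply_apply]
    rw [← (P1 h k.1).map_symm, ← (P1 h k.1).map_trans', ← (P1 h k.1).map_trans']
    rfl
  refine InverseLimit.nonempty_mulEquiv (L := S.Above) (L' := S.Below)
    (fun i j k hij hjk x => Zipped.mapOfEq_mapOfEq hf i j k hij hjk x)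
    (fun i j k hij hjk x => FreePower.proj_proj i j k hij hjk x) Φ Ψ ?_ ?_ ?_ ?_ ?_ ?_ ?_ ?_
  · exact fun m => ⟨S.period * m - S.bound - 2, by unfold Above; linarith⟩
  · intro h
    refine ⟨⌊(h - 6 * S.bound) / S.period⌋, ?_⟩
    have := Int.floor_le ((h - 6 * S.bound) / S.period)
    rw [le_div_iff₀ S.period_pos] at this
    unfold Below
    linarith
  · intro h h' m hh hm
    unfold Above at *
    linarith
  · intro m m' h hmm hm
    unfold Below at *
    have : S.period * m ≤ S.period * m' :=
      mul_le_mul_of_nonneg_left (by exact_mod_cast hmm) S.period_pos.le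
    linarith
  · intro h m h' h1 h2
    unfold Above at h1
    unfold Below at h2
    linarith
  · intro m h m' h1 h2
    unfold Above at h2
    unfold Below at h1
    have h3 : S.period * m < S.period * m' := by linarith
    exact_mod_cast (lt_of_mul_lt_mul_left h3 S.period_pos.le).le
  · intro h m h' hm hm' p
    induction p using Path.Homotopic.Quotient.ind with
    | mk γ =>
      have hh : h ≤ h' := by
        unfold Above at hm
        unfold Below at hm'
        linarith
      refine (S.transport_roundtrip_zipped hh hm hm' (hstar h') (ν h') (g2 h') (g3 h')
        (P2 h') (P3 h') hρ2 (R1 h m hm) (R2 h m hm) (R3 h m hm) (hΨ m h' hm') (hstar' h) γ).trans ?_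
      refine Eq.trans ?_ (Zipped.mapOfEq_mk hf hh γ).symm
      rw [← loopTransport_of_eq_refl (hν h')]
      exact PathFunction.congr_apply _ _ _ fun _ => rfl
  · intro m h m' hm hm' x
    have hmm : m ≤ m' := by
      unfold Above at hm'
      unfold Below at hm
      have h3 : S.period * m < S.period * m' := by linarith
      exact_mod_cast (lt_of_mul_lt_mul_left h3 S.period_pos.le).le
    rw [← MonoidHom.comp_apply]
    congr 1
    refine Monoid.CoprodI.ext_hom _ _ fun k => ?_
    ext x
    obtain ⟨p, rfl⟩ := (e x₁).surjective x
    induction p using Path.Homotopic.Quotient.ind with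
    | mk γ =>
      have hFγ : F γ = e x₁ (Path.Homotopic.Quotient.mk γ) := by
        simp only [F]
        rw [loopTransport_of_eq_refl hρ1]
      simp only [MonoidHom.comp_apply]
      have := S.transport_roundtrip_freePower hmm (hstar h) (hν h) (g4 h) k.2 (P1 h k.1)
        (P2 h k.1) (P3 h k.1) hF hFd (R1 h m' hm') (R2 h m' hm') (R3 h m' hm') hx₁ γ
      rw [hFγ] at this
      refine Eq.trans (congrArg _ ?_) this
      simp only [Ψ]
      rw [Monoid.CoprodI.lift_of, MonoidHom.comp_apply]
      simp only [MulEquiv.toMonoidHom_eq_coe, MonoidHom.coe_coe, MulEquiv.symm_apply_apply]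
      rfl

end PeriodicSum

end Core

/-! ## Punctured balls -/

section PuncturedBall

open Set

variable {E : Type*} [NormedAddCommGroup E] [NormedSpace ℝ E]

/-- The complement of the ray opposite to `e` is star-shaped around `e`, hence contractible. -/
theorem isSimplyConnected_compl_ray {e : E} (he : e ≠ 0) :
    IsSimplyConnected ((fun t : ℝ => t • e) '' Iic 0)ᶜ := by
  have hstar : StarConvex ℝ e ((fun t : ℝ => t • e) '' Iic 0)ᶜ := by
    intro x hx a b ha hb hab
    rintro ⟨t, ht, h⟩
    have ht' : t ≤ 0 := ht
    beta_reduce at h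
    rcases hb.eq_or_lt with rfl | hb
    · have : (t - a) • e = 0 := by
        rw [sub_smul, h]
        simp
      rcases smul_eq_zero.1 this with h' | h'
      · linarith
      · exact he h'
    · refine hx ⟨b⁻¹ * (t - a), ?_, ?_⟩
      · exact mem_Iic.2 (mul_nonpos_of_nonneg_of_nonpos (inv_nonneg.2 hb.le)
          (by linarith : t - a ≤ 0))
      · beta_reduce
        rw [mul_smul, sub_smul, h, add_sub_cancel_left, smul_smul, inv_mul_cancel₀ hb.ne', one_smul]
  have hne : (((fun t : ℝ => t • e) '' Iic 0)ᶜ : Set E).Nonempty := by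
    refine ⟨e, ?_⟩
    rintro ⟨t, ht, h⟩
    have ht' : t ≤ 0 := ht
    have : (t - 1) • e = 0 := by
      rw [sub_smul, one_smul]
      exact sub_eq_zero.2 h
    rcases smul_eq_zero.1 this with h' | h'
    · linarith
    · exact he h'
  have := hstar.contractibleSpace hne
  exact SimplyConnectedSpace.ofContractible _

theorem IsSimplyConnected.union {Z : Type*} [TopologicalSpace Z] {U V : Set Z} (hUo : IsOpen U)
    (hVo : IsOpen V) (hU : IsSimplyConnected U) (hV : IsSimplyConnected V)
    (hI : IsPathConnected (U ∩ V)) : IsSimplyConnected (U ∪ V) := by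
  have hemb : Topology.IsEmbedding ((↑) : ↥(U ∪ V) → Z) := .subtypeVal
  have hr : ∀ W : Set Z, W ⊆ U ∪ V → ((↑) : ↥(U ∪ V) → Z) '' ((↑) ⁻¹' W) = W := fun W hW => by
    rw [Subtype.image_preimage_coe, inter_eq_right.2 hW]
  refine simplyConnectedSpace_of_union (U := (↑) ⁻¹' U) (V := (↑) ⁻¹' V)
    (hUo.preimage continuous_subtype_val) (hVo.preimage continuous_subtype_val) ?_ ?_ ?_ ?_
  · rw [← preimage_union]
    exact Subtype.coe_preimage_self _
  · rwa [← hemb.isSimplyConnected_image, hr U subset_union_left]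
  · rwa [← hemb.isSimplyConnected_image, hr V subset_union_right]
  · rwa [← preimage_inter, hemb.isInducing.isPathConnected_iff,
      hr _ (inter_subset_left.trans subset_union_left)]

/-- The punctured space is the union of the complements of two opposite closed rays. They meet in
the complement of a line, which is path connected because the codimension is at least two. -/
theorem isSimplyConnected_compl_zero [FiniteDimensional ℝ E] (hE : 3 ≤ Module.finrank ℝ E) :
    IsSimplyConnected ({0}ᶜ : Set E) := by
  have : Nontrivial E := Module.nontrivial_of_finrank_pos (R := ℝ) (by omega)
  obtain ⟨e, he⟩ := exists_ne (0 : E)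
  have h1 : (fun t : ℝ => t • -e) '' Iic 0 = (fun t : ℝ => t • e) '' Ici 0 := by
    ext x
    constructor
    · rintro ⟨t, ht, rfl⟩
      exact ⟨-t, mem_Ici.2 (neg_nonneg.2 (mem_Iic.1 ht)), by simp⟩
    · rintro ⟨t, ht, rfl⟩
      exact ⟨-t, mem_Iic.2 (neg_nonpos.2 (mem_Ici.1 ht)), by simp⟩
  have hsc := isSimplyConnected_compl_ray (neg_ne_zero.2 he)
  rw [h1] at hsc
  have hcl : ∀ s : Set ℝ, IsClosed s → IsOpen ((fun t : ℝ => t • e) '' s)ᶜ := fun s hs =>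
    (isClosedMap_smul_left e s hs).isOpen_compl
  have hI : ((fun t : ℝ => t • e) '' Iic 0)ᶜ ∩ ((fun t : ℝ => t • e) '' Ici 0)ᶜ =
      ((Submodule.span ℝ {e} : Submodule ℝ E) : Set E)ᶜ := by
    rw [← compl_union, ← image_union, Iic_union_Ici, image_univ]
    congr 1
    ext x
    simp [Submodule.mem_span_singleton]
  have hrank : 1 < Module.rank ℝ (E ⧸ (Submodule.span ℝ {e} : Submodule ℝ E)) := by
    rw [← Module.finrank_eq_rank]
    have h2 := Submodule.finrank_quotient_add_finrank (Submodule.span ℝ {e} : Submodule ℝ E)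
    rw [finrank_span_singleton he] at h2
    exact_mod_cast (by omega : 1 < Module.finrank ℝ (E ⧸ (Submodule.span ℝ {e} : Submodule ℝ E)))
  have := IsSimplyConnected.union (hcl _ isClosed_Iic) (hcl _ isClosed_Ici)
    (isSimplyConnected_compl_ray he) hsc (by
      rw [hI]
      exact isPathConnected_compl_of_one_lt_codim hrank)
  convert this using 1
  rw [← compl_inter]
  congr 1
  ext x
  constructor
  · rintro rfl
    exact ⟨⟨0, by simp⟩, ⟨0, by simp⟩⟩
  · rintro ⟨⟨t, ht, h⟩, ⟨s, hs, h'⟩⟩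
    have ht' : t ≤ 0 := ht
    have hs' : 0 ≤ s := hs
    have : (s - t) • e = 0 := by
      rw [sub_smul]
      exact sub_eq_zero.2 (h'.trans h.symm)
    obtain h0 := (smul_eq_zero.1 this).resolve_right he
    obtain rfl : t = 0 := by linarith
    simpa using h.symm

theorem isSimplyConnected_ball_diff_zero {E : Type*} [NormedAddCommGroup E] [InnerProductSpace ℝ E]
    [FiniteDimensional ℝ E] (hE : 3 ≤ Module.finrank ℝ E) :
    IsSimplyConnected (Metric.ball (0 : E) 1 \ {0}) := by
  let u : OpenPartialHomeomorph E E := .univUnitBall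
  have hu : Topology.IsOpenEmbedding u := u.isOpenEmbedding rfl
  have h := (hu.isEmbedding.isSimplyConnected_image).2 (isSimplyConnected_compl_zero hE)
  convert h using 1
  have h0 : u 0 = 0 := OpenPartialHomeomorph.univUnitBall_apply_zero
  have hr : range u = Metric.ball 0 1 := by
    rw [← image_univ]
    exact u.image_source_eq_target
  rw [image_compl_eq_range_sdiff_image hu.injective, hr, image_singleton, h0]

end PuncturedBall

/-! ## The infinite cyclic covering of the torus -/

section TorusCover

open Set

variable {n : ℕ} (i : Fin n)

/-- The covering of the torus which unwraps the `i`-th coordinate. -/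
abbrev TorusCover : Type := {y : Torus n × ℝ // Circle.exp y.2 = y.1 i}

namespace TorusCover

variable {i}

/-- The height on the covering. -/
noncomputable def height : C(TorusCover i, ℝ) := ⟨fun y => y.1.2, by fun_prop⟩

/-- The vertical flow. -/
noncomputable def flow : C(ℝ × TorusCover i, TorusCover i) where
  toFun x := ⟨(Function.update x.2.1.1 i (Circle.exp (-x.1) * x.2.1.1 i), x.2.1.2 - x.1), by
    simp [← x.2.2, sub_eq_neg_add, Circle.exp_add, Circle.exp_neg]⟩
  continuous_toFun := by
    refine Continuous.subtype_mk (.prodMk ?_ (by fun_prop)) _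
    refine Continuous.update (by fun_prop) i ?_
    fun_prop

theorem flow_zero (y : TorusCover i) : flow (0, y) = y := by
  refine Subtype.ext (Prod.ext ?_ ?_)
  · simp [flow]
  · simp [flow]

theorem height_flow (s : ℝ) (y : TorusCover i) : height (flow (s, y)) = height y - s := rfl

/-- The universal covering of the torus, as a covering of the infinite cyclic covering. -/
noncomputable def ofReal : C(Fin n → ℝ, TorusCover i) :=
  ⟨fun v => ⟨(fun j => Circle.exp (v j), v i), rfl⟩, by fun_prop⟩

theorem exists_ofReal (y : TorusCover i) : ∃ v, ofReal v = y := by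
  choose v hv using fun j => Circle.exp_surjective (y.1.1 j)
  refine ⟨Function.update v i y.1.2, Subtype.ext (Prod.ext ?_ ?_)⟩
  · funext j
    by_cases hj : j = i
    · subst hj
      simp [ofReal, y.2]
    · simp [ofReal, hj, hv]
  · simp [ofReal]

/-- The deleted fibre pulls back to a countable subset of ℝⁿ, whose complement is path connected in
dimension at least two and maps onto the set in question. -/
theorem isPathConnected_compl (hn : 2 ≤ n) (z : Torus n) :
    IsPathConnected {y : TorusCover i | y.1.1 ≠ z} := by
  have hc : {v : Fin n → ℝ | ∀ j, Circle.exp (v j) = z j}.Countable := by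
    choose w hw using fun j => Circle.exp_surjective (z j)
    refine (countable_range fun (k : Fin n → ℤ) (j : Fin n) =>
      w j + k j * (2 * Real.pi)).mono fun v hv => ?_
    choose k hk using fun j => Circle.exp_eq_exp.1 ((hv j).trans (hw j).symm)
    exact ⟨k, (funext hk).symm⟩
  have hr : 1 < Module.rank ℝ (Fin n → ℝ) := by
    rw [rank_fin_fun]
    exact_mod_cast hn
  have h := (hc.isPathConnected_compl_of_one_lt_rank hr).image (ofReal (i := i)).continuous
  convert h using 1
  ext y
  constructor
  · intro hy
    obtain ⟨v, rfl⟩ := exists_ofReal y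
    exact ⟨v, fun hv => hy (funext hv), rfl⟩
  · rintro ⟨v, hv, rfl⟩ h
    exact hv fun j => congrFun h j

end TorusCover

theorem exists_circle_lift {E : Type*} [NormedAddCommGroup E] [NormedSpace ℝ E]
    (D : C(E, Circle)) : ∃ τ : C(E, ℝ), ∀ v, Circle.exp (τ v) = D v := by
  obtain ⟨t, ht⟩ := Circle.exp_surjective (D 0)
  obtain ⟨τ, ⟨-, hτ⟩, -⟩ := Circle.isCoveringMap_exp.existsUnique_continuousMap_lifts D 0 t ht
  exact ⟨τ, fun v => congrFun hτ v⟩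

end TorusCover

/-! ## Topological connected sums with the torus -/

section CollapsedSum

open Set

/-- A map into an ambient space, corrected off a set to take values in a subtype. -/
noncomputable def subtypeLift {A B : Type*} {P : B → Prop} (b : Subtype P) (g : A → B) (a : A) :
    Subtype P :=
  open Classical in if h : P (g a) then ⟨g a, h⟩ else b

theorem coe_subtypeLift {A B : Type*} {P : B → Prop} {b : Subtype P} {g : A → B} {a : A}
    (h : P (g a)) : (subtypeLift b g a : B) = g a := by
  rw [subtypeLift, dif_pos h]

theorem continuousOn_subtypeLift {A B : Type*} [TopologicalSpace A] [TopologicalSpace B]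
    {P : B → Prop} (b : Subtype P) {g : A → B} {s : Set A} (hg : ContinuousOn g s)
    (h : ∀ a ∈ s, P (g a)) : ContinuousOn (subtypeLift b g) s := by
  refine (Topology.IsInducing.subtypeVal (t := {b | P b})).continuousOn_iff.2 ?_
  exact hg.congr fun a ha => coe_subtypeLift (h a ha)

/-- A topological connected sum of the torus and `X`, with a map to the torus that collapses `X`
to a point. -/
structure CollapsedSum (n : ℕ) (X M : Type*) [TopologicalSpace X] [TopologicalSpace M] where
  disc₁ : OpenPartialHomeomorph (EuclideanSpace ℝ (Fin n)) (Torus n)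
  disc₁_source : disc₁.source = univ
  disc₂ : OpenPartialHomeomorph (EuclideanSpace ℝ (Fin n)) X
  disc₂_source : disc₂.source = univ
  incl₁ : OpenPartialHomeomorph (Torus n) M
  incl₁_source : incl₁.source = {disc₁ 0}ᶜ
  incl₂ : OpenPartialHomeomorph X M
  incl₂_source : incl₂.source = {disc₂ 0}ᶜ
  target_union : incl₁.target ∪ incl₂.target = univ
  glue : ∀ y₁ ∈ incl₁.source, ∀ y₂ ∈ incl₂.source, incl₁ y₁ = incl₂ y₂ ↔
    ∃ x : EuclideanSpace ℝ (Fin n), x ≠ 0 ∧ y₁ = disc₁ x ∧ y₂ = disc₂ ((‖x‖ ^ 2)⁻¹ • x)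
  proj : C(M, Torus n)
  eq_self : ∃ R : ℝ, 0 < R ∧ ∀ y, y ∉ disc₁ '' Metric.ball 0 R → proj (incl₁ y) = y
  mapsTo_disc : ∀ x, x ≠ 0 → proj (incl₁ (disc₁ x)) ∈ disc₁.target
  collapse : ∃ r : ℝ, 0 < r ∧ ∃ c, ∀ y, y ∉ disc₂ '' Metric.ball 0 r → proj (incl₂ y) = c

namespace CollapsedSum

variable {n : ℕ} {X M : Type*} [TopologicalSpace X] [TopologicalSpace M] (S : CollapsedSum n X M)

theorem isOpenEmbedding_disc₁ : Topology.IsOpenEmbedding S.disc₁ :=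
  S.disc₁.isOpenEmbedding S.disc₁_source

theorem isOpenEmbedding_disc₂ : Topology.IsOpenEmbedding S.disc₂ :=
  S.disc₂.isOpenEmbedding S.disc₂_source

theorem range_disc₁ : range S.disc₁ = S.disc₁.target := by
  rw [← image_univ, ← S.disc₁_source, S.disc₁.image_source_eq_target]

theorem range_disc₂ : range S.disc₂ = S.disc₂.target := by
  rw [← image_univ, ← S.disc₂_source, S.disc₂.image_source_eq_target]

theorem disc₁_mem (v : EuclideanSpace ℝ (Fin n)) : S.disc₁ v ∈ S.disc₁.target :=
  S.range_disc₁ ▸ mem_range_self v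

theorem disc₂_mem (v : EuclideanSpace ℝ (Fin n)) : S.disc₂ v ∈ S.disc₂.target :=
  S.range_disc₂ ▸ mem_range_self v

theorem mem_incl₁_source {z : Torus n} : z ∈ S.incl₁.source ↔ z ≠ S.disc₁ 0 := by
  rw [S.incl₁_source]
  rfl

theorem mem_incl₂_source {x : X} : x ∈ S.incl₂.source ↔ x ≠ S.disc₂ 0 := by
  rw [S.incl₂_source]
  rfl

theorem disc₁_symm (v : EuclideanSpace ℝ (Fin n)) : S.disc₁.symm (S.disc₁ v) = v :=
  S.disc₁.left_inv (S.disc₁_source ▸ mem_univ v)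

theorem incl₁_disc₁ {v : EuclideanSpace ℝ (Fin n)} (hv : v ≠ 0) :
    S.incl₁ (S.disc₁ v) = S.incl₂ (S.disc₂ ((‖v‖ ^ 2)⁻¹ • v)) := by
  refine (S.glue _ ?_ _ ?_).2 ⟨v, hv, rfl, rfl⟩
  · exact S.mem_incl₁_source.2 (S.isOpenEmbedding_disc₁.injective.ne hv)
  · refine S.mem_incl₂_source.2 (S.isOpenEmbedding_disc₂.injective.ne ?_)
    have := norm_pos_iff.2 hv
    exact smul_ne_zero (by positivity) hv

theorem incl₂_disc₂ {v : EuclideanSpace ℝ (Fin n)} (hv : v ≠ 0) :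
    S.incl₂ (S.disc₂ v) = S.incl₁ (S.disc₁ ((‖v‖ ^ 2)⁻¹ • v)) := by
  have h0 := norm_pos_iff.2 hv
  rw [S.incl₁_disc₁ (smul_ne_zero (by positivity) hv)]
  congr 2
  rw [smul_smul, norm_smul, norm_inv, norm_pow, norm_norm]
  conv_lhs => rw [← one_smul ℝ v]
  congr 1
  field_simp

theorem incl₂_mem_target₁ {x : X} (hx : x ∈ S.incl₂.source) :
    S.incl₂ x ∈ S.incl₁.target ↔ x ∈ S.disc₂.target := by
  constructor
  · intro h
    obtain ⟨v, -, -, rfl⟩ := (S.glue _ (S.incl₁.map_target h) x hx).1 (S.incl₁.right_inv h)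
    exact S.disc₂_mem _
  · intro h
    obtain ⟨v, rfl⟩ := S.range_disc₂.symm ▸ h
    have hv : v ≠ 0 := fun h => S.mem_incl₂_source.1 hx (h ▸ rfl)
    rw [S.incl₂_disc₂ hv]
    refine S.incl₁.map_source (S.mem_incl₁_source.2 (S.isOpenEmbedding_disc₁.injective.ne ?_))
    have := norm_pos_iff.2 hv
    exact smul_ne_zero (by positivity) hv

/-- Away from a ball of `X` the projection has a constant value, which is also taken at a point of
the disc with norm `r`; so it lies in the disc of the torus too. -/
theorem proj_mem [NeZero n] {m : M} (hm : m ∈ S.incl₂.target) : S.proj m ∈ S.disc₁.target := by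
  obtain ⟨x, hx, rfl⟩ : ∃ x ∈ S.incl₂.source, S.incl₂ x = m :=
    ⟨_, S.incl₂.map_target hm, S.incl₂.right_inv hm⟩
  have key : ∀ v : EuclideanSpace ℝ (Fin n), v ≠ 0 →
      S.proj (S.incl₂ (S.disc₂ v)) ∈ S.disc₁.target := fun v hv => by
    have := norm_pos_iff.2 hv
    rw [S.incl₂_disc₂ hv]
    exact S.mapsTo_disc _ (smul_ne_zero (by positivity) hv)
  by_cases h : x ∈ S.disc₂.target
  · obtain ⟨v, rfl⟩ := S.range_disc₂.symm ▸ h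
    exact key v fun h => S.mem_incl₂_source.1 hx (h ▸ rfl)
  · obtain ⟨r, hr, c, hc⟩ := S.collapse
    obtain ⟨v, hv⟩ := exists_norm_eq (EuclideanSpace ℝ (Fin n)) hr.le
    rw [hc x fun ⟨w, _, hw⟩ => h (hw ▸ S.disc₂_mem w), ← hc (S.disc₂ v)]
    · exact key v (norm_pos_iff.1 (hv ▸ hr))
    · rintro ⟨w, hw, hwv⟩
      rw [S.isOpenEmbedding_disc₂.injective hwv, mem_ball_zero_iff, hv] at hw
      exact lt_irrefl _ hw

/-- The complement of the closed unit disc in `X`. -/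
def core : Set X := (S.disc₂ '' Metric.closedBall 0 1)ᶜ

theorem core_subset : S.core ⊆ S.incl₂.source := fun _ hx =>
  S.mem_incl₂_source.2 fun h => hx ⟨0, by simp, h.symm⟩

theorem isOpen_core [T2Space X] : IsOpen S.core :=
  ((isCompact_closedBall _ _).image S.isOpenEmbedding_disc₂.continuous).isClosed.isOpen_compl

/-- Follow a path to the centre of the disc until just before it first meets the closed unit disc.
At that moment it is still in the core but already in the open disc. -/
theorem exists_joinedIn_core [T2Space X] [PathConnectedSpace X] {x : X} (hx : x ∈ S.core) :
    ∃ y ∈ S.disc₂.target, JoinedIn S.core x y := by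
  let γ := PathConnectedSpace.somePath x (S.disc₂ 0)
  have hK : IsClosed (S.disc₂ '' Metric.closedBall 0 1) :=
    ((isCompact_closedBall _ _).image S.isOpenEmbedding_disc₂.continuous).isClosed
  have hne : (Icc 0 1 ∩ γ.extend ⁻¹' (S.disc₂ '' Metric.closedBall 0 1)).Nonempty :=
    ⟨1, by simp, by simpa using ⟨0, by simp, rfl⟩⟩
  obtain ⟨t, ⟨ht, htK⟩, hmin⟩ :=
    (isCompact_Icc.inter_right (hK.preimage γ.continuous_extend)).exists_isLeast hne
  have ht0 : 0 < t := lt_of_le_of_ne ht.1 fun h => hx (by simpa [← h] using htK)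
  have hmem : γ.extend ⁻¹' S.disc₂.target ∈ 𝓝 t := by
    refine (S.disc₂.open_target.preimage γ.continuous_extend).mem_nhds ?_
    obtain ⟨v, -, hv⟩ := htK
    exact mem_preimage.2 (hv ▸ S.disc₂_mem v)
  obtain ⟨s, hs, hst⟩ : ∃ s ∈ Ioo 0 t, γ.extend s ∈ S.disc₂.target :=
    ((Filter.Eventually.and (Ioo_mem_nhdsLT ht0) (mem_nhdsWithin_of_mem_nhds hmem)).exists)
  refine ⟨_, hst, ?_⟩
  have hp := ((convex_Icc 0 s).isPathConnected ⟨0, by simp [hs.1.le]⟩).image γ.continuous_extend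
  refine (hp.joinedIn x ⟨0, by simp [hs.1.le], by simp⟩ _
    ⟨s, by simp [hs.1.le], rfl⟩).mono ?_
  rintro _ ⟨u, hu, rfl⟩ h
  exact absurd (hmin ⟨⟨hu.1, hu.2.trans (hs.2.le.trans ht.2)⟩, h⟩) (by linarith [hu.2, hs.2])

theorem exists_lift (i : Fin n) :
    ∃ τ : C(EuclideanSpace ℝ (Fin n), ℝ), ∀ v, Circle.exp (τ v) = S.disc₁ v i :=
  exists_circle_lift ⟨fun v => S.disc₁ v i,
    (continuous_apply i).comp S.isOpenEmbedding_disc₁.continuous⟩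

/-- The `i`-th angle on the disc of the torus. -/
noncomputable def angle (i : Fin n) : C(EuclideanSpace ℝ (Fin n), ℝ) := (S.exists_lift i).choose

theorem exp_angle (i : Fin n) (v : EuclideanSpace ℝ (Fin n)) :
    Circle.exp (S.angle i v) = S.disc₁ v i :=
  (S.exists_lift i).choose_spec v

theorem exp_angle_symm (i : Fin n) {z : Torus n} (hz : z ∈ S.disc₁.target) :
    Circle.exp (S.angle i (S.disc₁.symm z)) = z i := by
  rw [exp_angle, S.disc₁.right_inv hz]

/-- The `i`-th angle on the disc, pulled back by the projection. -/
noncomputable def projAngle (i : Fin n) (m : M) : ℝ := S.angle i (S.disc₁.symm (S.proj m))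

theorem exp_projAngle [NeZero n] (i : Fin n) {m : M} (hm : m ∈ S.incl₂.target) :
    Circle.exp (S.projAngle i m) = S.proj m i :=
  S.exp_angle_symm i (S.proj_mem hm)

theorem continuousOn_projAngle [NeZero n] (i : Fin n) :
    ContinuousOn (S.projAngle i) S.incl₂.target :=
  (S.angle i).continuous.comp_continuousOn
    (S.disc₁.continuousOn_symm.comp S.proj.continuous.continuousOn fun _ => S.proj_mem)

theorem exists_projAngle_le [NeZero n] [CompactSpace X] (i : Fin n) {r : ℝ} (hr : 0 < r) :
    ∃ C, ∀ x, x ∉ S.disc₂ '' Metric.ball 0 r → |S.projAngle i (S.incl₂ x)| ≤ C := by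
  have hK : IsCompact (S.disc₂ '' Metric.ball 0 r)ᶜ :=
    (S.isOpenEmbedding_disc₂.isOpenMap _ Metric.isOpen_ball).isClosed_compl.isCompact
  have hs : (S.disc₂ '' Metric.ball 0 r)ᶜ ⊆ S.incl₂.source := fun x hx =>
    S.mem_incl₂_source.2 fun h => hx ⟨0, by simpa using hr, h.symm⟩
  obtain ⟨C, hC⟩ := hK.exists_bound_of_continuousOn
    ((S.continuousOn_projAngle i).comp (S.incl₂.continuousOn.mono hs) fun x hx =>
      S.incl₂.map_source (hs hx))
  exact ⟨C, hC⟩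

open Classical in
/-- The difference of the `i`-th angles of the projection of a point of the punctured torus and of
the point. -/
noncomputable def defect (i : Fin n) (z : Torus n) : ℝ :=
  if z ∈ S.disc₁.target then S.projAngle i (S.incl₁ z) - S.angle i (S.disc₁.symm z) else 0

theorem defect_of_mem (i : Fin n) {z : Torus n} (hz : z ∈ S.disc₁.target) :
    S.defect i z = S.projAngle i (S.incl₁ z) - S.angle i (S.disc₁.symm z) :=
  if_pos hz

theorem proj_incl₁_mem {z : Torus n} (hz : z ≠ S.disc₁ 0) (h : z ∈ S.disc₁.target) :
    S.proj (S.incl₁ z) ∈ S.disc₁.target := by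
  obtain ⟨v, rfl⟩ := S.range_disc₁.symm ▸ h
  exact S.mapsTo_disc v fun h => hz (h ▸ rfl)

theorem defect_eq_zero (i : Fin n) {z : Torus n} (hz : S.proj (S.incl₁ z) = z) :
    S.defect i z = 0 := by
  rw [defect]
  split_ifs with h
  · rw [projAngle, hz, sub_self]
  · rfl

theorem exp_defect (i : Fin n) {z : Torus n} (hz : z ≠ S.disc₁ 0) :
    Circle.exp (S.defect i z) * z i = S.proj (S.incl₁ z) i := by
  by_cases h : z ∈ S.disc₁.target
  · rw [S.defect_of_mem i h, Circle.exp_sub, S.exp_angle_symm i h, projAngle,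
      S.exp_angle_symm i (S.proj_incl₁_mem hz h), div_mul_cancel]
  · obtain ⟨R, -, hR⟩ := S.eq_self
    have := hR z fun ⟨v, _, hv⟩ => h (hv ▸ S.disc₁_mem v)
    rw [S.defect_eq_zero i this, this, Circle.exp_zero, one_mul]

/-- Outside a compact ball of the disc the projection is the identity and the defect vanishes, which
matches the default value `0` off the disc. -/
theorem continuousOn_defect (i : Fin n) : ContinuousOn (S.defect i) {S.disc₁ 0}ᶜ := by
  obtain ⟨R, -, hR⟩ := S.eq_self
  intro z hz
  refine ContinuousAt.continuousWithinAt ?_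
  have hz' : z ∈ S.incl₁.source := S.mem_incl₁_source.2 hz
  by_cases h : z ∈ S.disc₁.target
  · have hc : ContinuousAt (fun z => S.projAngle i (S.incl₁ z) - S.angle i (S.disc₁.symm z)) z := by
      refine ContinuousAt.sub ?_ ?_
      · have h1 : ContinuousAt (fun z => S.proj (S.incl₁ z)) z :=
          S.proj.continuous.continuousAt.comp (S.incl₁.continuousAt hz')
        exact ((S.angle i).continuousAt _).comp (ContinuousAt.comp
          (f := fun z => S.proj (S.incl₁ z)) (S.disc₁.continuousAt_symm (S.proj_incl₁_mem hz h)) h1)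
      · exact ((S.angle i).continuousAt _).comp (S.disc₁.continuousAt_symm h)
    refine hc.congr ?_
    filter_upwards [S.disc₁.open_target.mem_nhds h] with w hw
    exact (S.defect_of_mem i hw).symm
  · have hK : IsClosed (S.disc₁ '' Metric.closedBall 0 R) :=
      ((isCompact_closedBall _ _).image S.isOpenEmbedding_disc₁.continuous).isClosed
    refine (continuousAt_const (y := (0 : ℝ))).congr ?_
    filter_upwards [hK.isOpen_compl.mem_nhds fun ⟨v, _, hv⟩ => h (hv ▸ S.disc₁_mem v)] with w hw
    exact (S.defect_eq_zero i (hR w fun h => hw (image_mono Metric.ball_subset_closedBall h))).symm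

theorem exists_angle_le (i : Fin n) (r : ℝ) :
    ∃ C, ∀ v : EuclideanSpace ℝ (Fin n), ‖v‖ ≤ r → |S.angle i v| ≤ C := by
  obtain ⟨C, hC⟩ := (isCompact_closedBall (0 : EuclideanSpace ℝ (Fin n)) r).exists_bound_of_continuousOn
    (S.angle i).continuous.continuousOn
  exact ⟨C, fun v hv => hC v (by simpa using hv)⟩

/-- The defect vanishes off the ball of radius `R`. Inside it, the inversion moves the point out of
the ball of radius `R⁻¹` of `X`, into a compact set on which the projected angle is bounded. -/
theorem exists_defect_le [NeZero n] [CompactSpace X] (i : Fin n) :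
    ∃ C, ∀ z ≠ S.disc₁ 0, |S.defect i z| ≤ C := by
  obtain ⟨R, hR, hself⟩ := S.eq_self
  obtain ⟨A, hA⟩ := S.exists_angle_le i R
  obtain ⟨B, hB⟩ := S.exists_projAngle_le i (inv_pos.2 hR)
  refine ⟨max 0 (B + A), fun z hz => ?_⟩
  by_cases h : z ∈ S.disc₁ '' Metric.ball 0 R
  · obtain ⟨v, hv, rfl⟩ := h
    have hv0 : v ≠ 0 := fun h => hz (h ▸ rfl)
    have h0 := norm_pos_iff.2 hv0
    rw [mem_ball_zero_iff] at hv
    rw [S.defect_of_mem i (S.disc₁_mem v), S.disc₁_symm, S.incl₁_disc₁ hv0]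
    refine le_max_of_le_right ((abs_sub _ _).trans (add_le_add (hB _ ?_) (hA v hv.le)))
    rintro ⟨w, hw, hwv⟩
    rw [S.isOpenEmbedding_disc₂.injective hwv, mem_ball_zero_iff, norm_smul, norm_inv, norm_pow,
      norm_norm, pow_two, mul_inv, mul_assoc, inv_mul_cancel₀ h0.ne', mul_one] at hw
    exact absurd ((inv_lt_inv₀ h0 hR).1 hw) (not_lt.2 hv.le)
  · rw [S.defect_eq_zero i (hself z h), abs_zero]
    exact le_max_left _ _

end CollapsedSum

end CollapsedSum

/-! ### The infinite cyclic covering of the connected sum as a periodic sum -/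

section CollapsedSumCover

open Set

theorem Circle.exists_int_of_exp_eq {s t : ℝ} (h : Circle.exp s = Circle.exp t) :
    ∃ k : ℤ, s = t + 2 * Real.pi * k := by
  obtain ⟨k, hk⟩ := Circle.exp_eq_exp.1 h
  exact ⟨k, by rw [hk]; ring⟩

theorem Circle.exp_add_two_pi_mul (t : ℝ) (k : ℤ) :
    Circle.exp (t + 2 * Real.pi * k) = Circle.exp t :=
  Circle.exp_eq_exp.2 ⟨k, by ring⟩

/-- This turns equality of two angles with the same exponential, a closed condition, into an open
one; the sheets of the covering are open for this reason. -/
theorem Circle.eq_of_abs_sub_lt {s t : ℝ} (h : Circle.exp s = Circle.exp t)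
    (hst : |s - t| < 2 * Real.pi) : s = t := by
  obtain ⟨k, hk⟩ := Circle.exists_int_of_exp_eq h
  have hk' : s - t = 2 * Real.pi * k := by linarith
  rw [hk', abs_mul, abs_of_pos Real.two_pi_pos] at hst
  have h1 : |(k : ℝ)| < 1 := by nlinarith [Real.two_pi_pos]
  have h2 : |k| < 1 := by exact_mod_cast h1
  rw [Int.abs_lt_one_iff] at h2
  simp [hk, h2]

theorem Int.eq_of_two_pi_mul_eq {k l : ℤ} (h : 2 * Real.pi * k = 2 * Real.pi * l) : k = l := by
  exact_mod_cast mul_left_cancel₀ Real.two_pi_pos.ne' h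

namespace CollapsedSum

variable {n : ℕ} {X M : Type*} [TopologicalSpace X] [TopologicalSpace M] (S : CollapsedSum n X M)
  (i : Fin n)

/-- The covering of the connected sum which unwraps the `i`-th coordinate. -/
abbrev Cover : Type _ := {q : M × ℝ // Circle.exp q.2 = S.proj q.1 i}

theorem nonempty_cover [NeZero n] : Nonempty (S.Cover i) := by
  obtain ⟨v, hv⟩ := exists_ne (0 : EuclideanSpace ℝ (Fin n))
  obtain ⟨t, ht⟩ := Circle.exp_surjective (S.proj (S.incl₁ (S.disc₁ v)) i)
  exact ⟨⟨(_, t), ht⟩⟩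

variable {S i} in
theorem exp_sub_defect {q : S.Cover i} (hq : q.1.1 ∈ S.incl₁.target) :
    Circle.exp (q.1.2 - S.defect i (S.incl₁.symm q.1.1)) = S.incl₁.symm q.1.1 i := by
  have h := S.exp_defect i (S.mem_incl₁_source.1 (S.incl₁.map_target hq))
  rw [S.incl₁.right_inv hq, ← q.2] at h
  rw [Circle.exp_sub, ← h, mul_div_cancel_left]

variable {S i} in
theorem exp_add_defect {y : TorusCover i} (hy : y.1.1 ≠ S.disc₁ 0) :
    Circle.exp (y.1.2 + S.defect i y.1.1) = S.proj (S.incl₁ y.1.1) i := by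
  rw [Circle.exp_add, y.2, mul_comm, S.exp_defect i hy]

/-- The map to the covering of the torus, over the punctured torus. -/
noncomputable def toTorusCover : S.Cover i → TorusCover i :=
  subtypeLift (TorusCover.ofReal 0) fun q : S.Cover i =>
    (S.incl₁.symm q.1.1, q.1.2 - S.defect i (S.incl₁.symm q.1.1))

/-- The map from the covering of the torus, over the punctured torus. -/
noncomputable def ofTorusCover [NeZero n] : TorusCover i → S.Cover i :=
  subtypeLift (S.nonempty_cover i).some fun y : TorusCover i =>
    (S.incl₁ y.1.1, y.1.2 + S.defect i y.1.1)

theorem coe_toTorusCover {q : S.Cover i} (hq : q.1.1 ∈ S.incl₁.target) :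
    (S.toTorusCover i q).1 = (S.incl₁.symm q.1.1, q.1.2 - S.defect i (S.incl₁.symm q.1.1)) :=
  coe_subtypeLift (P := fun y : Torus n × ℝ => Circle.exp y.2 = y.1 i) (exp_sub_defect hq)

theorem coe_ofTorusCover [NeZero n] {y : TorusCover i} (hy : y.1.1 ≠ S.disc₁ 0) :
    (S.ofTorusCover i y).1 = (S.incl₁ y.1.1, y.1.2 + S.defect i y.1.1) :=
  coe_subtypeLift (P := fun q : M × ℝ => Circle.exp q.2 = S.proj q.1 i) (exp_add_defect hy)

/-- The part of the covering over the punctured torus. -/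
noncomputable def coverBase [NeZero n] : OpenPartialHomeomorph (S.Cover i) (TorusCover i) where
  toFun := S.toTorusCover i
  invFun := S.ofTorusCover i
  source := {q | q.1.1 ∈ S.incl₁.target}
  target := {y | y.1.1 ≠ S.disc₁ 0}
  map_source' q hq := by
    rw [mem_ofPred_eq, S.coe_toTorusCover i hq]
    exact S.mem_incl₁_source.1 (S.incl₁.map_target hq)
  map_target' y hy := by
    rw [mem_ofPred_eq, S.coe_ofTorusCover i hy]
    exact S.incl₁.map_source (S.mem_incl₁_source.2 hy)
  left_inv' q hq := by
    have h0 := S.mem_incl₁_source.1 (S.incl₁.map_target hq)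
    have h1 := S.coe_toTorusCover i hq
    refine Subtype.ext ?_
    rw [S.coe_ofTorusCover i (by rw [h1]; exact h0), h1]
    refine Prod.ext (S.incl₁.right_inv hq) ?_
    simp
  right_inv' y hy := by
    have h0 := S.mem_incl₁_source.2 hy
    have h1 := S.coe_ofTorusCover i hy
    refine Subtype.ext ?_
    rw [S.coe_toTorusCover i (by rw [h1]; exact S.incl₁.map_source h0), h1]
    refine Prod.ext (S.incl₁.left_inv h0) ?_
    simp [S.incl₁.left_inv h0]
  open_source := S.incl₁.open_target.preimage (by fun_prop)
  open_target := by
    have : IsOpen {z : Torus n | z ≠ S.disc₁ 0} := isOpen_ne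
    exact this.preimage (f := fun y : TorusCover i => y.1.1) (by fun_prop)
  continuousOn_toFun := by
    refine continuousOn_subtypeLift _ ?_ fun q hq => exp_sub_defect hq
    have h1 : ContinuousOn (fun q : S.Cover i => S.incl₁.symm q.1.1) {q | q.1.1 ∈ S.incl₁.target} :=
      S.incl₁.continuousOn_symm.comp (Continuous.continuousOn (by fun_prop)) fun _ hq => hq
    refine h1.prodMk (ContinuousOn.sub (Continuous.continuousOn (by fun_prop)) ?_)
    exact (S.continuousOn_defect i).comp h1 fun q hq =>
      S.mem_incl₁_source.1 (S.incl₁.map_target hq)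
  continuousOn_invFun := by
    refine continuousOn_subtypeLift _ ?_ fun y hy => exp_add_defect hy
    have h1 : ContinuousOn (fun y : TorusCover i => y.1.1) {y | y.1.1 ≠ S.disc₁ 0} :=
      Continuous.continuousOn (by fun_prop)
    refine (S.incl₁.continuousOn.comp h1 fun y hy => S.mem_incl₁_source.2 hy).prodMk
      (ContinuousOn.add (Continuous.continuousOn (by fun_prop)) ?_)
    exact (S.continuousOn_defect i).comp h1 fun y hy => hy

theorem isPathConnected_coverBase_source [NeZero n] (hn : 2 ≤ n) :
    IsPathConnected (S.coverBase i).source := by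
  rw [← (S.coverBase i).symm_image_target_eq_source]
  exact (TorusCover.isPathConnected_compl hn (S.disc₁ 0)).image' (S.coverBase i).continuousOn_symm

variable {i} in
theorem exp_projAngle_add [NeZero n] (k : ℤ) {x : X} (hx : x ∈ S.core) :
    Circle.exp (S.projAngle i (S.incl₂ x) + 2 * Real.pi * k) = S.proj (S.incl₂ x) i := by
  rw [Circle.exp_add_two_pi_mul, S.exp_projAngle i (S.incl₂.map_source (S.core_subset hx))]

/-- The `k`-th lift of the map from the core of `X` to the covering. -/
noncomputable def ofCore [NeZero n] (k : ℤ) : X → S.Cover i :=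
  subtypeLift (S.nonempty_cover i).some fun x =>
    (S.incl₂ x, S.projAngle i (S.incl₂ x) + 2 * Real.pi * k)

theorem coe_ofCore [NeZero n] (k : ℤ) {x : X} (hx : x ∈ S.core) :
    (S.ofCore i k x).1 = (S.incl₂ x, S.projAngle i (S.incl₂ x) + 2 * Real.pi * k) :=
  coe_subtypeLift (P := fun q : M × ℝ => Circle.exp q.2 = S.proj q.1 i) (S.exp_projAngle_add k hx)

/-- The `k`-th lift of the core of `X` to the covering. -/
noncomputable def coverSummand [NeZero n] [T2Space X] (k : ℤ) :
    OpenPartialHomeomorph (S.Cover i) X where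
  toFun q := S.incl₂.symm q.1.1
  invFun := S.ofCore i k
  source := {q | q.1.1 ∈ S.incl₂.target ∧ S.incl₂.symm q.1.1 ∈ S.core ∧
    q.1.2 = S.projAngle i q.1.1 + 2 * Real.pi * k}
  target := S.core
  map_source' q hq := hq.2.1
  map_target' x hx := by
    rw [mem_ofPred_eq, S.coe_ofCore i k hx]
    have h := S.core_subset hx
    exact ⟨S.incl₂.map_source h, by rwa [S.incl₂.left_inv h], rfl⟩
  left_inv' q hq := by
    refine Subtype.ext ?_
    rw [S.coe_ofCore i k hq.2.1, S.incl₂.right_inv hq.1, ← hq.2.2]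
  right_inv' x hx := by
    rw [S.coe_ofCore i k hx]
    exact S.incl₂.left_inv (S.core_subset hx)
  open_source := by
    have h1 : IsOpen {q : S.Cover i | q.1.1 ∈ S.incl₂.target} :=
      S.incl₂.open_target.preimage (by fun_prop)
    have h2 : ContinuousOn (fun q : S.Cover i =>
        (S.incl₂.symm q.1.1, q.1.2 - (S.projAngle i q.1.1 + 2 * Real.pi * k)))
        {q : S.Cover i | q.1.1 ∈ S.incl₂.target} := by
      have h3 : ContinuousOn (fun q : S.Cover i => q.1.1)
        {q : S.Cover i | q.1.1 ∈ S.incl₂.target} := Continuous.continuousOn (by fun_prop)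
      refine (S.incl₂.continuousOn_symm.comp h3 fun _ hq => hq).prodMk
        (ContinuousOn.sub (Continuous.continuousOn (by fun_prop)) (ContinuousOn.add ?_
          continuousOn_const))
      exact (S.continuousOn_projAngle i).comp h3 fun _ hq => hq
    convert h2.isOpen_inter_preimage h1 (S.isOpen_core.prod (Metric.isOpen_ball (x := (0 : ℝ))
      (ε := 2 * Real.pi))) using 1
    ext q
    constructor
    · rintro ⟨h4, h5, h6⟩
      exact ⟨h4, h5, by simp [h6, Real.pi_pos]⟩
    · rintro ⟨h4, h5, h6⟩
      refine ⟨h4, h5, Circle.eq_of_abs_sub_lt ?_ (by simpa using h6)⟩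
      rw [q.2, Circle.exp_add_two_pi_mul, S.exp_projAngle i h4]
  open_target := S.isOpen_core
  continuousOn_toFun := S.incl₂.continuousOn_symm.comp
    (Continuous.continuousOn (by fun_prop)) fun _ hq => hq.1
  continuousOn_invFun := by
    refine continuousOn_subtypeLift _ ?_ fun x hx => S.exp_projAngle_add k hx
    have h1 := S.incl₂.continuousOn.mono S.core_subset
    exact h1.prodMk (((S.continuousOn_projAngle i).comp h1 fun x hx =>
      S.incl₂.map_source (S.core_subset hx)).add continuousOn_const)

theorem coverSummand_mem_base_iff [NeZero n] [T2Space X] (k : ℤ) {q : S.Cover i}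
    (hq : q ∈ (S.coverSummand i k).source) :
    q ∈ (S.coverBase i).source ↔ S.coverSummand i k q ∈ S.disc₂.target := by
  have h := S.incl₂_mem_target₁ (S.incl₂.map_target hq.1)
  rwa [S.incl₂.right_inv hq.1] at h

theorem mem_cover [NeZero n] [T2Space X] (q : S.Cover i) :
    q ∈ (S.coverBase i).source ∨ ∃ k, q ∈ (S.coverSummand i k).source := by
  by_cases h1 : q.1.1 ∈ S.incl₁.target
  · exact .inl h1
  · have h2 : q.1.1 ∈ S.incl₂.target :=
      (S.target_union.ge (mem_univ q.1.1)).resolve_left h1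
    obtain ⟨k, hk⟩ := Circle.exists_int_of_exp_eq (q.2.trans (S.exp_projAngle i h2).symm)
    refine .inr ⟨k, h2, fun ⟨v, _, hv⟩ => h1 ?_, hk⟩
    have h3 := S.incl₂_mem_target₁ (S.incl₂.map_target h2)
    rw [S.incl₂.right_inv h2, ← hv] at h3
    exact h3.2 (S.disc₂_mem v)

theorem pathConnectedSpace_cover [NeZero n] [T2Space X] [PathConnectedSpace X] (hn : 2 ≤ n) :
    PathConnectedSpace (S.Cover i) := by
  have hb := S.isPathConnected_coverBase_source i hn
  obtain ⟨q₀, -⟩ := hb.nonempty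
  have key : ∀ q : S.Cover i, ∃ q' ∈ (S.coverBase i).source, Joined q q' := fun q => by
    rcases S.mem_cover i q with hq | ⟨k, hk⟩
    · exact ⟨q, hq, .refl q⟩
    · let b := S.coverSummand i k
      obtain ⟨y, hy, hj⟩ := S.exists_joinedIn_core (b.map_source hk)
      obtain ⟨γ, hγ⟩ := hj
      have hyc : y ∈ b.target := by
        have := hγ 1
        rwa [γ.target] at this
      refine ⟨b.symm y, ?_, ?_⟩
      · rwa [S.coverSummand_mem_base_iff i k (b.map_target hyc), b.right_inv hyc]
      · have := (γ.map' (b.continuousOn_symm.mono (range_subset_iff.2 hγ)))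
        rw [b.left_inv hk] at this
        exact ⟨this⟩
  refine ⟨⟨q₀⟩, fun q q' => ?_⟩
  obtain ⟨r, hr, h1⟩ := key q
  obtain ⟨r', hr', h2⟩ := key q'
  exact (h1.trans (hb.joinedIn r hr r' hr').joined).trans h2.symm

/-- The `k`-th lift of the disc to the covering of the torus. -/
noncomputable def discLift (k : ℤ) (v : EuclideanSpace ℝ (Fin n)) : TorusCover i :=
  ⟨(S.disc₁ v, S.angle i v + 2 * Real.pi * k), by
    rw [Circle.exp_add_two_pi_mul, S.exp_angle]⟩

theorem isEmbedding_discLift (k : ℤ) : Topology.IsEmbedding (S.discLift i k) := by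
  refine Topology.IsEmbedding.of_comp (g := fun y : TorusCover i => y.1.1) ?_ (by fun_prop)
    S.isOpenEmbedding_disc₁.isEmbedding
  have := S.isOpenEmbedding_disc₁.continuous
  exact Continuous.subtype_mk (by fun_prop) _

theorem isOpen_image_discLift (k : ℤ) {U : Set (EuclideanSpace ℝ (Fin n))} (hU : IsOpen U) :
    IsOpen (S.discLift i k '' U) := by
  have h1 : IsOpen {y : TorusCover i | y.1.1 ∈ S.disc₁.target} :=
    S.disc₁.open_target.preimage (by fun_prop)
  have h2 : ContinuousOn (fun y : TorusCover i =>
      (S.disc₁.symm y.1.1, y.1.2 - (S.angle i (S.disc₁.symm y.1.1) + 2 * Real.pi * k)))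
      {y : TorusCover i | y.1.1 ∈ S.disc₁.target} := by
    have h3 : ContinuousOn (fun y : TorusCover i => S.disc₁.symm y.1.1)
        {y : TorusCover i | y.1.1 ∈ S.disc₁.target} :=
      S.disc₁.continuousOn_symm.comp (Continuous.continuousOn (by fun_prop)) fun _ hq => hq
    refine h3.prodMk (ContinuousOn.sub (Continuous.continuousOn (by fun_prop)) (ContinuousOn.add ?_
      continuousOn_const))
    exact (S.angle i).continuous.comp_continuousOn h3
  convert h2.isOpen_inter_preimage h1 (hU.prod (Metric.isOpen_ball (x := (0 : ℝ))
    (ε := 2 * Real.pi))) using 1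
  ext y
  constructor
  · rintro ⟨v, hv, rfl⟩
    exact ⟨S.disc₁_mem v, by simpa [discLift, S.disc₁_symm] using hv,
      by simp [discLift, S.disc₁_symm, Real.pi_pos]⟩
  · rintro ⟨h4, h5, h6⟩
    refine ⟨_, h5, Subtype.ext (Prod.ext (S.disc₁.right_inv h4) ?_)⟩
    refine (Circle.eq_of_abs_sub_lt (s := y.1.2)
      (t := S.angle i (S.disc₁.symm y.1.1) + 2 * Real.pi * k) ?_ (by simpa using h6)).symm
    rw [y.2, Circle.exp_add_two_pi_mul, S.exp_angle_symm i h4]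

/-- The covering is a periodic sum, with respect to any function at bounded distance from the
unwrapped coordinate. -/
theorem nonempty_periodicSum [T2Space X] [CompactSpace X] (hn : 3 ≤ n)
    {Q : Type*} [TopologicalSpace Q] (e : Q ≃ₜ S.Cover i) {f : Q → ℝ} (hf : Continuous f)
    {C : ℝ} (hC : ∀ x, |f x - (e x).1.2| ≤ C) : Nonempty (PeriodicSum Q X (TorusCover i) f) := by
  have : NeZero n := ⟨by omega⟩
  obtain ⟨A, hA⟩ := S.exists_angle_le i 1
  obtain ⟨B, hB⟩ := S.exists_projAngle_le i zero_lt_one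
  obtain ⟨B', hB'⟩ := S.exists_defect_le i
  obtain ⟨N, hN⟩ : ∃ N, N = |A| + |B| + |B'| + |C| + 1 := ⟨_, rfl⟩
  exact ⟨{
    height := TorusCover.height
    flow := TorusCover.flow
    flow_zero := TorusCover.flow_zero
    height_flow := TorusCover.height_flow
    base := e.transOpenPartialHomeomorph (S.coverBase i)
    -- Only the complement of the closed unit disc of `X` is lifted. Near the deleted centre of
    -- `disc₂` the points approach the outer end of `disc₁`, where the angle need not be bounded.
    summand := fun k => e.transOpenPartialHomeomorph (S.coverSummand i k)
    hole := fun k => S.discLift i k '' Metric.ball 0 1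
    disc := S.disc₂.target
    isOpen_hole := fun k => S.isOpen_image_discLift i k Metric.isOpen_ball
    isOpen_disc := S.disc₂.open_target
    isSimplyConnected_disc := by
      rw [← S.range_disc₂, ← image_univ]
      refine (S.isOpenEmbedding_disc₂.isEmbedding.isSimplyConnected_image).2 ?_
      have := (convex_univ (𝕜 := ℝ) (E := EuclideanSpace ℝ (Fin n))).contractibleSpace univ_nonempty
      exact SimplyConnectedSpace.ofContractible _
    isSimplyConnected_hole := fun k => by
      have h1 : S.discLift i k '' Metric.ball 0 1 ∩ {y | y.1.1 ≠ S.disc₁ 0} =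
          S.discLift i k '' (Metric.ball 0 1 \ {0}) := by
        ext y
        constructor
        · rintro ⟨⟨v, hv, rfl⟩, h⟩
          exact ⟨v, ⟨hv, fun h0 => h (congrArg S.disc₁ h0)⟩, rfl⟩
        · rintro ⟨v, ⟨hv, h0⟩, rfl⟩
          exact ⟨⟨v, hv, rfl⟩, S.isOpenEmbedding_disc₁.injective.ne h0⟩
      change IsSimplyConnected (S.discLift i k '' Metric.ball 0 1 ∩ {y | y.1.1 ≠ S.disc₁ 0})
      rw [h1]
      exact ((S.isEmbedding_discLift i k).isSimplyConnected_image).2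
        (isSimplyConnected_ball_diff_zero (by simpa using hn))
    isPathConnected_base := by
      have h1 := (S.isPathConnected_coverBase_source i (by omega)).image e.symm.continuous
      rwa [e.symm.image_eq_preimage_symm] at h1
    cover := fun x => S.mem_cover i (e x)
    cover_base := fun y => by
      by_cases h : y.1.1 = S.disc₁ 0
      · obtain ⟨k, hk⟩ := Circle.exists_int_of_exp_eq (s := y.1.2) (t := S.angle i 0) (by
          rw [y.2, S.exp_angle, h])
        exact .inr ⟨k, 0, by simp, Subtype.ext (Prod.ext h.symm hk.symm)⟩
      · exact .inl h
    cover_summand := fun k x => by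
      by_cases h : x ∈ S.core
      · exact .inl h
      · obtain ⟨v, -, rfl⟩ := not_not.1 h
        exact .inr (S.disc₂_mem v)
    disjoint_summand := fun k l x hk hl =>
      Int.eq_of_two_pi_mul_eq (add_left_cancel (hk.2.2.symm.trans hl.2.2))
    disjoint_hole := by
      rintro k l y ⟨v, -, rfl⟩ ⟨w, -, hw⟩
      obtain rfl : w = v := S.isOpenEmbedding_disc₁.injective (congrArg (fun y => y.1.1) hw)
      exact (Int.eq_of_two_pi_mul_eq (add_left_cancel (congrArg (fun y => y.1.2) hw))).symm
    mem_base_iff := fun k x hx => S.coverSummand_mem_base_iff i k hx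
    period := 2 * Real.pi
    period_pos := Real.two_pi_pos
    bound := N
    bound_pos := by
      rw [hN]
      positivity
    base_bound := fun x hx => by
      replace hx : (e x).1.1 ∈ S.incl₁.target := hx
      have h1 : (S.toTorusCover i (e x)).1.2 = _ := congrArg Prod.snd (S.coe_toTorusCover i hx)
      have h2 := hB' _ (S.mem_incl₁_source.1 (S.incl₁.map_target hx))
      change |f x - (S.toTorusCover i (e x)).1.2| ≤ N
      rw [h1]
      dsimp only
      have h3 := abs_le.1 (h2.trans (le_abs_self _))
      have h4 := abs_le.1 ((hC x).trans (le_abs_self _))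
      refine abs_le.2 ⟨?_, ?_⟩
      · linarith [abs_nonneg A, abs_nonneg B]
      · linarith [abs_nonneg A, abs_nonneg B]
    summand_bound := fun k x hx => by
      replace hx : e x ∈ (S.coverSummand i k).source := hx
      have h1 := hB (S.incl₂.symm (e x).1.1)
        fun h => hx.2.1 (image_mono Metric.ball_subset_closedBall h)
      rw [S.incl₂.right_inv hx.1] at h1
      have h2 := hx.2.2
      have h3 := abs_le.1 (h1.trans (le_abs_self _))
      have h4 := abs_le.1 ((hC x).trans (le_abs_self _))
      refine abs_le.2 ⟨?_, ?_⟩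
      · linarith [abs_nonneg A, abs_nonneg B']
      · linarith [abs_nonneg A, abs_nonneg B']
    hole_bound := by
      rintro k _ ⟨v, hv, rfl⟩
      change |S.angle i v + 2 * Real.pi * k - 2 * Real.pi * k| ≤ N
      rw [add_sub_cancel_right]
      have := (hA v (mem_ball_zero_iff.1 hv).le).trans (le_abs_self _)
      linarith [abs_nonneg B, abs_nonneg B', abs_nonneg C]
    exists_low := fun s => by
      obtain ⟨v, hv⟩ := exists_ne (0 : EuclideanSpace ℝ (Fin n))
      -- Lift a fixed point of the punctured disc to level `-k`, with `k` large enough to absorb its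
      -- angle, its defect and the distance `C` between `f` and the coordinate.
      obtain ⟨k, hk⟩ := exists_nat_gt ((S.angle i v + S.defect i (S.disc₁ v) + C - s) /
        (2 * Real.pi))
      rw [div_lt_iff₀ Real.two_pi_pos] at hk
      have h1 : (S.discLift i (-k) v).1.1 ≠ S.disc₁ 0 := S.isOpenEmbedding_disc₁.injective.ne hv
      have h2 := S.coe_ofTorusCover i h1
      have h3 := (S.coverBase i).map_target h1
      refine ⟨e.symm (S.ofTorusCover i (S.discLift i (-k) v)), ?_, ?_⟩
      · change e (e.symm _) ∈ (S.coverBase i).source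
        rwa [e.apply_symm_apply]
      · have h4 := hC (e.symm (S.ofTorusCover i (S.discLift i (-k) v)))
        rw [e.apply_symm_apply, h2] at h4
        have h5 : (S.discLift i (-k) v).1 = (S.disc₁ v, S.angle i v + 2 * Real.pi * (-k : ℤ)) := rfl
        rw [h5] at h4
        push_cast at h4
        linarith [(abs_le.1 h4).2]
    continuous_fun := hf }⟩

end CollapsedSum

end CollapsedSumCover

/-! ### Primitives of the angular form and circle-valued maps -/

section Forms

open Set

theorem isLocallyConstant_of_hasMFDerivAt_zero {E F M : Type*} [NormedAddCommGroup E]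
    [NormedSpace ℝ E] [NormedAddCommGroup F] [NormedSpace ℝ F] [TopologicalSpace M]
    [ChartedSpace E M] [IsManifold 𝓘(ℝ, E) ∞ M] {g : M → F}
    (h : ∀ x, HasMFDerivAt 𝓘(ℝ, E) 𝓘(ℝ, F) g x 0) : IsLocallyConstant g := by
  refine (IsLocallyConstant.iff_exists_open g).2 fun x => ?_
  let c := chartAt E x
  have h1 : ∀ y ∈ c.target, HasFDerivAt (g ∘ c.symm) (0 : E →L[ℝ] F) y := fun y hy => by
    have h2 : MDifferentiableAt 𝓘(ℝ, E) 𝓘(ℝ, E) c.symm y :=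
      ((contMDiffOn_chart_symm (n := ∞) (I := 𝓘(ℝ, E)) (x := x)).contMDiffAt
        (c.open_target.mem_nhds hy)).mdifferentiableAt (by simp)
    have h3 := (h (c.symm y)).comp y h2.hasMFDerivAt
    rw [ContinuousLinearMap.zero_comp] at h3
    exact hasMFDerivAt_iff_hasFDerivAt.1 h3
  have h2 := c.open_target.isOpen_inter_preimage_of_fderiv_eq_zero
    (fun y hy => (h1 y hy).differentiableAt.differentiableWithinAt)
    (fun y hy => (h1 y hy).fderiv) {g x}
  refine ⟨c.source ∩ c ⁻¹' (c.target ∩ g ∘ c.symm ⁻¹' {g x}), c.isOpen_inter_preimage h2,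
    ⟨mem_chart_source E x, mem_chart_target E x, ?_⟩, ?_⟩
  · simp [c]
  · rintro y ⟨hy, -, h⟩
    simpa [c.left_inv hy] using h

attribute [local instance] finrank_real_complex_fact'

theorem mdifferentiable_coe_circle :
    MDifferentiable (𝓡 1) 𝓘(ℝ, ℂ) (fun w : Circle => (w : ℂ)) := by
  have h : ContMDiff (𝓡 1) 𝓘(ℝ, ℂ) ∞ (fun w : Circle => (w : ℂ)) := contMDiff_coe_sphere
  exact h.mdifferentiable (by simp)

/-- As the squared norm is constant on the circle, a tangent vector at `z` is orthogonal to `z`. Its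
product with the conjugate of `z` is thus purely imaginary, with imaginary part given by the angular
form. -/
theorem mfderiv_coe_circle (z : Circle) (v : TangentSpace (𝓡 1) z) :
    (mfderiv (𝓡 1) 𝓘(ℝ, ℂ) (fun w : Circle => (w : ℂ)) z v : ℂ) =
      ((circleDTheta z v : ℝ) : ℂ) * Complex.I * (z : ℂ) := by
  have h1 := (mdifferentiable_coe_circle z).hasMFDerivAt
  set W : ℂ := mfderiv (𝓡 1) 𝓘(ℝ, ℂ) (fun w : Circle => (w : ℂ)) z v with hW
  have h2 : HasMFDerivAt 𝓘(ℝ, ℂ) 𝓘(ℝ, ℝ) (fun w : ℂ => ‖w‖ ^ 2) (z : ℂ) _ :=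
    (hasStrictFDerivAt_norm_sq (z : ℂ)).hasFDerivAt.hasMFDerivAt
  have h3 := HasMFDerivAt.comp z h2 h1
  have h4 : (fun w : ℂ => ‖w‖ ^ 2) ∘ (fun w : Circle => (w : ℂ)) = fun _ => (1 : ℝ) := by
    funext w
    have := Circle.norm_coe w
    simp only [Function.comp_apply, this, one_pow]
  rw [h4] at h3
  have h5 := DFunLike.congr_fun (hasMFDerivAt_unique h3 (hasMFDerivAt_const (1 : ℝ) z)) v
  have h6 : 2 * inner ℝ (z : ℂ) W = 0 := by
    have h7 : (2 : ℕ) • inner ℝ (z : ℂ) W = 0 := h5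
    rwa [nsmul_eq_mul] at h7
  rw [Complex.inner, mul_comm W] at h6
  have h7 : circleDTheta z v = ((starRingEnd ℂ) (z : ℂ) * W).im := rfl
  have h8 : (starRingEnd ℂ) (z : ℂ) * W = (circleDTheta z v : ℝ) * Complex.I := by
    apply Complex.ext
    · simp only [Complex.mul_re, Complex.I_re, Complex.I_im, Complex.ofReal_re, Complex.ofReal_im]
      have : ((starRingEnd ℂ) (z : ℂ) * W).re = 0 := by linarith
      simpa [Complex.mul_re] using this
    · rw [h7]
      simp
  rw [← h8, mul_right_comm, ← Complex.normSq_eq_conj_mul_self]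
  simp
  rfl

/-- The function `exp(-i g) * c` has zero derivative, so it is constant on the connected manifold;
the constant has the form `exp(i s)`. -/
theorem exists_exp_eq {E M : Type*} [NormedAddCommGroup E]
    [NormedSpace ℝ E] [TopologicalSpace M] [ConnectedSpace M]
    [ChartedSpace E M] [IsManifold 𝓘(ℝ, E) ∞ M] {c : M → Circle} {g : M → ℝ}
    (hc : MDifferentiable 𝓘(ℝ, E) (𝓡 1) c) (hg : MDifferentiable 𝓘(ℝ, E) 𝓘(ℝ, ℝ) g)
    (h : OneForm.d 𝓘(ℝ, E) g = OneForm.pullback 𝓘(ℝ, E) (𝓡 1) c circleDTheta) :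
    ∃ s : ℝ, ∀ x, Circle.exp (g x + s) = c x := by
  let E' : ℝ → ℂ := fun t => Complex.exp (-(t * Complex.I))
  have hE : ∀ t, HasDerivAt E' (-(Complex.I) * E' t) t := fun t => by
    have h1 : HasDerivAt (fun t : ℝ => -((t : ℂ) * Complex.I)) (-(1 * Complex.I)) t :=
      (Complex.ofRealCLM.hasDerivAt.mul_const _).neg
    have h2 := h1.cexp
    rwa [one_mul, mul_comm] at h2
  have key : ∀ x, HasMFDerivAt 𝓘(ℝ, E) 𝓘(ℝ, ℂ)
      ((E' ∘ g) * ((fun w : Circle => (w : ℂ)) ∘ c)) x 0 := fun x => by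
    have h1 := HasMFDerivAt.comp x (hE (g x)).hasFDerivAt.hasMFDerivAt (hg x).hasMFDerivAt
    have h2 := HasMFDerivAt.comp x (mdifferentiable_coe_circle (c x)).hasMFDerivAt
      (hc x).hasMFDerivAt
    refine (h1.mul h2).congr_mfderiv (ContinuousLinearMap.ext fun v => Eq.symm ?_)
    have h3 : mfderiv 𝓘(ℝ, E) 𝓘(ℝ, ℝ) g x v = circleDTheta (c x) (mfderiv 𝓘(ℝ, E) (𝓡 1) c x v) :=
      DFunLike.congr_fun (congrFun h x) v
    let a : ℝ := mfderiv 𝓘(ℝ, E) 𝓘(ℝ, ℝ) g x v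
    let W : ℂ := mfderiv (𝓡 1) 𝓘(ℝ, ℂ) (fun w : Circle => (w : ℂ)) (c x)
      (mfderiv 𝓘(ℝ, E) (𝓡 1) c x v)
    have h4 : W = (a : ℂ) * Complex.I * (c x : ℂ) := by
      rw [show a = _ from h3]
      exact mfderiv_coe_circle (c x) (mfderiv 𝓘(ℝ, E) (𝓡 1) c x v)
    change (0 : ℂ) = E' (g x) * W + (c x : ℂ) * (a • (-(Complex.I) * E' (g x)))
    rw [h4, Complex.real_smul]
    ring
  obtain ⟨x₀⟩ : Nonempty M := inferInstance
  have hconst := fun x => (isLocallyConstant_of_hasMFDerivAt_zero key).apply_eq_of_preconnectedSpace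
    x x₀
  obtain ⟨s, hs⟩ := Circle.exp_surjective (Circle.exp (-g x₀) * c x₀)
  refine ⟨s, fun x => ?_⟩
  have h1 : ∀ t, E' t = (Circle.exp (-t) : ℂ) := fun t => by
    simp [E', Circle.coe_exp, Complex.exp_neg]
  have h2 : Circle.exp (-g x) * c x = Circle.exp (-g x₀) * c x₀ := by
    apply Circle.ext
    have := hconst x
    simpa [h1] using this
  rw [Circle.exp_add, hs, ← h2, ← mul_assoc, ← Circle.exp_add]
  simp

end Forms

/-! ## Identification of the integration cover -/

section IntegrationCover

open Set unitInterval

theorem isLocalHomeomorph_fst_of_exp_eq {Z : Type*} [TopologicalSpace Z] (c : C(Z, Circle)) :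
    IsLocalHomeomorph (fun q : {q : Z × ℝ // Circle.exp q.2 = c q.1} => q.1.1) := by
  refine IsLocalHomeomorph.mk _ fun q => ?_
  let φ := Circle.isCoveringMap_exp.isLocalHomeomorph.localInverseAt q.1.2
  have hφ : ∀ z ∈ φ.source, Circle.exp (φ z) = z := fun z hz =>
    Circle.isCoveringMap_exp.isLocalHomeomorph.apply_localInverseAt_of_mem hz
  have hφ' : ∀ t ∈ φ.target, Circle.exp t ∈ φ.source ∧ φ (Circle.exp t) = t := fun t ht => by
    have h1 : φ.symm t = Circle.exp t := by simp [φ]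
    exact ⟨h1 ▸ φ.map_target ht, h1 ▸ φ.right_inv ht⟩
  let s : Z → {q : Z × ℝ // Circle.exp q.2 = c q.1} := subtypeLift q fun m => (m, φ (c m))
  have hs : ∀ m, c m ∈ φ.source → (s m).1 = (m, φ (c m)) := fun m hm =>
    coe_subtypeLift (P := fun q : Z × ℝ => Circle.exp q.2 = c q.1) (hφ _ hm)
  refine ⟨{
    toFun := fun q => q.1.1
    invFun := s
    source := {q | q.1.2 ∈ φ.target}
    target := {m | c m ∈ φ.source}
    map_source' := fun r hr => by
      rw [mem_ofPred_eq, ← r.2]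
      exact (hφ' _ hr).1
    map_target' := fun m hm => by
      rw [mem_ofPred_eq, hs m hm]
      exact φ.map_source hm
    left_inv' := fun r hr => by
      have h := hφ' _ hr
      rw [r.2] at h
      refine Subtype.ext ?_
      rw [hs _ h.1]
      exact Prod.ext rfl h.2
    right_inv' := fun m hm => by rw [hs m hm]
    open_source := φ.open_target.preimage (by fun_prop)
    open_target := φ.open_source.preimage c.continuous
    continuousOn_toFun := Continuous.continuousOn (by fun_prop)
    continuousOn_invFun := by
      refine continuousOn_subtypeLift _ (continuousOn_id.prodMk ?_) fun m hm => hφ _ hm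
      exact φ.continuousOn.comp c.continuous.continuousOn fun _ hm => hm }, ?_, fun _ _ => rfl⟩
  exact Circle.isCoveringMap_exp.isLocalHomeomorph.self_mem_localInverseAt_target

/-- If the projection of `γ` is homotopic to the projection of a loop at `x`, the two lifts starting
at `x` end at the same point; one ends at `y`, the other at `x`. -/
theorem IsCoveringMap.eq_of_mem_range_map {Q M : Type*} [TopologicalSpace Q] [TopologicalSpace M]
    {p : C(Q, M)} (hp : IsCoveringMap p) {x y : Q} (γ : Path x y) (h : p x = p y)
    (hγ : FundamentalGroup.fromPath (Path.Homotopic.Quotient.mk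
      ((γ.map p.continuous).cast rfl h)) ∈ range (FundamentalGroup.map p x)) : x = y := by
  obtain ⟨g, hg⟩ := hγ
  obtain ⟨δ, rfl⟩ : ∃ δ : Path x x,
      FundamentalGroup.fromPath (Path.Homotopic.Quotient.mk δ) = g := Quotient.exists_rep g
  have h1 : (δ.map p.continuous).Homotopic ((γ.map p.continuous).cast rfl h) :=
    Path.Homotopic.Quotient.exact hg
  have h2 := hp.liftPath_apply_one_eq_of_homotopicRel h1 x (by simp) (by simp)
  have h3 := (hp.eq_liftPath_iff' (γ := (δ.map p.continuous).toContinuousMap) (e := x)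
    (by simp) (Γ := δ.toContinuousMap)).2 ⟨rfl, δ.source⟩
  have h4 := (hp.eq_liftPath_iff' (γ := ((γ.map p.continuous).cast rfl h).toContinuousMap) (e := x)
    (by simp) (Γ := γ.toContinuousMap)).2 ⟨rfl, γ.source⟩
  rw [← h3, ← h4] at h2
  simpa using h2

theorem exists_homeomorph_of_exp_eq {Q M : Type*} [TopologicalSpace Q] [TopologicalSpace M]
    [PathConnectedSpace Q] {p : C(Q, M)} (hp : IsCoveringMap p) (c : C(M, Circle))
    [PathConnectedSpace {q : M × ℝ // Circle.exp q.2 = c q.1}] (g : C(Q, ℝ))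
    (hg : ∀ x, Circle.exp (g x) = c (p x))
    (hker : ∀ (x y : Q) (γ : Path x y) (h : p x = p y), g x = g y →
      FundamentalGroup.fromPath (Path.Homotopic.Quotient.mk
        ((γ.map p.continuous).cast rfl h)) ∈ range (FundamentalGroup.map p x)) :
    ∃ e : Q ≃ₜ {q : M × ℝ // Circle.exp q.2 = c q.1}, ∀ x, (e x).1 = (p x, g x) := by
  let e : Q → {q : M × ℝ // Circle.exp q.2 = c q.1} := fun x => ⟨(p x, g x), hg x⟩
  have he : Continuous e := Continuous.subtype_mk (by fun_prop) _
  have hloc : IsLocalHomeomorph e :=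
    IsLocalHomeomorph.of_comp (g := fun q : {q : M × ℝ // Circle.exp q.2 = c q.1} => q.1.1)
      hp.isLocalHomeomorph (isLocalHomeomorph_fst_of_exp_eq c) he
  have hinj : Function.Injective e := fun x y hxy =>
    hp.eq_of_mem_range_map (PathConnectedSpace.somePath x y) (congrArg (fun q => q.1.1) hxy)
      (hker x y _ _ (congrArg (fun q => q.1.2) hxy))
  have hsurj : Function.Surjective e := fun q => by
    obtain ⟨x⟩ : Nonempty Q := inferInstance
    let δ := PathConnectedSpace.somePath (e x) q
    -- Surjectivity: lift the `M`-component of a path from `e x` to `q`. Along the lift, `g` and the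
    -- real component of the path are lifts of the same path in the circle with the same origin,
    -- hence equal.
    let δ₁ : C(I, M) := ⟨fun t => (δ t).1.1, by fun_prop⟩
    have h0 : δ₁ 0 = p x := by simp [δ₁, e]
    let Γ := hp.liftPath δ₁ x h0
    have hΓ : ∀ t, p (Γ t) = (δ t).1.1 := fun t => congrFun (hp.liftPath_lifts δ₁ x h0) t
    have hΓ0 : Γ 0 = x := hp.liftPath_zero δ₁ x h0
    have h1 : (fun t => g (Γ t)) = fun t => (δ t).1.2 := by
      refine Circle.isCoveringMap_exp.eq_of_comp_eq (by fun_prop) (by fun_prop) ?_ 0 ?_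
      · funext t
        simp only [Function.comp_apply]
        rw [hg, hΓ, (δ t).2]
      · simp [hΓ0, e]
    refine ⟨Γ 1, Subtype.ext (Prod.ext ?_ ?_)⟩
    · simpa using hΓ 1
    · simpa using congrFun h1 1
  exact ⟨hloc.toHomeomorphOfBijective ⟨hinj, hsurj⟩, fun _ => rfl⟩

end IntegrationCover

/-! ### Smooth primitives and periods on the cover -/

section SmoothCover

open Set

/-- In the product charts the coordinate map becomes the linear projection `v ↦ v i`. -/
theorem mdifferentiable_torus_apply {n : ℕ} (i : Fin n) :
    MDifferentiable (torusModel n) (𝓡 1) (fun z : Torus n => z i) := by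
  intro z
  refine (mdifferentiableAt_iff _ _).2 ⟨(continuous_apply i).continuousAt, ?_⟩
  have h : DifferentiableAt ℝ (fun v : Fin n → EuclideanSpace ℝ (Fin 1) => v i)
    (extChartAt (torusModel n) z z) := by fun_prop
  refine h.differentiableWithinAt.congr_of_eventuallyEq ?_ ?_
  · refine Filter.eventually_of_mem (extChartAt_target_mem_nhdsWithin (I := torusModel n) z) ?_
    intro v hv
    have h1 : ∀ j, v j ∈ (chartAt (EuclideanSpace ℝ (Fin 1)) (z j)).target := fun j => by
      exact hv.2 j (mem_univ j)
    exact (chartAt (EuclideanSpace ℝ (Fin 1)) (z i)).right_inv (h1 i)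
  · exact (chartAt (EuclideanSpace ℝ (Fin 1)) (z i)).right_inv (mem_chart_target _ _)

variable {E M Q : Type*} [NormedAddCommGroup E] [NormedSpace ℝ E]
  [TopologicalSpace M] [ChartedSpace E M] [TopologicalSpace Q] [ChartedSpace E Q]

theorem mfderiv_localInverse {p : Q → M} (hp : IsLocalDiffeomorph 𝓘(ℝ, E) 𝓘(ℝ, E) ∞ p) (x : Q)
    {z : M} (hz : z ∈ (hp x).localInverse.source) (v : E) :
    (mfderiv 𝓘(ℝ, E) 𝓘(ℝ, E) p ((hp x).localInverse z)
      (mfderiv 𝓘(ℝ, E) 𝓘(ℝ, E) (hp x).localInverse z v) : E) = v := by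
  have h1 : MDifferentiableAt 𝓘(ℝ, E) 𝓘(ℝ, E) (hp x).localInverse z :=
    ((hp x).localInverse_contMDiffOn.contMDiffAt
      ((hp x).localInverse_open_source.mem_nhds hz)).mdifferentiableAt (by simp)
  have h2 : MDifferentiableAt 𝓘(ℝ, E) 𝓘(ℝ, E) p ((hp x).localInverse z) :=
    (hp _).mdifferentiableAt (by simp)
  have h3 := mfderiv_comp z h2 h1
  have h4 : p ∘ (hp x).localInverse =ᶠ[𝓝 z] id :=
    Filter.eventuallyEq_of_mem ((hp x).localInverse_open_source.mem_nhds hz)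
      (hp x).localInverse_eqOn_right
  rw [h4.mfderiv_eq, mfderiv_id] at h3
  exact (DFunLike.congr_fun h3 v).symm

theorem OneForm.congr_apply {α : OneForm 𝓘(ℝ, E) M} {x y : M} (h : x = y) (v : E) :
    (α x : E →L[ℝ] ℝ) v = (α y : E →L[ℝ] ℝ) v := by
  rw [h]

/-- The integral along the image of a path is the variation of a primitive of the pull-back. -/
theorem OneForm.hasPathIntegral_map {p : C(Q, M)} (hp : IsLocalDiffeomorph 𝓘(ℝ, E) 𝓘(ℝ, E) ∞ p)
    {α : OneForm 𝓘(ℝ, E) M} {g : Q → ℝ} (hg : ContMDiff 𝓘(ℝ, E) 𝓘(ℝ, ℝ) ∞ g)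
    (h : OneForm.d 𝓘(ℝ, E) g = OneForm.pullback 𝓘(ℝ, E) 𝓘(ℝ, E) p α) {x y : Q} (γ : Path x y)
    (hxy : p x = p y) :
    OneForm.HasPathIntegral 𝓘(ℝ, E) α ((γ.map p.continuous).cast rfl hxy) (g y - g x) := by
  refine ⟨fun t => g (γ t), fun t => ?_, by simp⟩
  have hl := hp (γ t)
  refine ⟨hl.localInverse.source, g ∘ hl.localInverse, hl.localInverse_open_source,
    hl.localInverse_mem_source, hg.comp_contMDiffOn hl.localInverse_contMDiffOn, fun z hz => ?_, ?_⟩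
  · have h1 : MDifferentiableAt 𝓘(ℝ, E) 𝓘(ℝ, E) hl.localInverse z :=
      (hl.localInverse_contMDiffOn.contMDiffAt
        (hl.localInverse_open_source.mem_nhds hz)).mdifferentiableAt (by simp)
    have h2 := mfderiv_comp z (hg.mdifferentiableAt (by simp)) h1
    refine ContinuousLinearMap.ext fun v => ?_
    have h3 := DFunLike.congr_fun (congrFun h (hl.localInverse z))
      (mfderiv 𝓘(ℝ, E) 𝓘(ℝ, E) hl.localInverse z v)
    refine (DFunLike.congr_fun h2 v).trans (h3.trans ?_)
    have h4 := mfderiv_localInverse hp (γ t) hz v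
    have h5 := congrArg (fun w : E => (α (p (hl.localInverse z)) : E →L[ℝ] ℝ) w) h4
    exact h5.trans (OneForm.congr_apply (E := E) (hl.localInverse_right_inv hz) v)
  · have h1 : ∀ᶠ s in 𝓝 t, γ s ∈ hl.localInverse.target :=
      γ.continuous.continuousAt (hl.localInverse.open_target.mem_nhds hl.localInverse_mem_target)
    filter_upwards [h1] with s hs
    exact (congrArg g (hl.localInverse_left_inv hs)).symm

theorem OneForm.d_sub_comp {p : Q → M} (hp : MDifferentiable 𝓘(ℝ, E) 𝓘(ℝ, E) p)
    {f : Q → ℝ} (hf : MDifferentiable 𝓘(ℝ, E) 𝓘(ℝ, ℝ) f) {g : M → ℝ}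
    (hg : MDifferentiable 𝓘(ℝ, E) 𝓘(ℝ, ℝ) g) {α : OneForm 𝓘(ℝ, E) M}
    (h : OneForm.d 𝓘(ℝ, E) f = OneForm.pullback 𝓘(ℝ, E) 𝓘(ℝ, E) p (α + OneForm.d 𝓘(ℝ, E) g)) :
    OneForm.d 𝓘(ℝ, E) (fun x => f x - g (p x)) = OneForm.pullback 𝓘(ℝ, E) 𝓘(ℝ, E) p α := by
  funext x
  have h1 := (hg (p x)).hasMFDerivAt.comp x (hp x).hasMFDerivAt
  have h2 := ((hf x).hasMFDerivAt.sub h1).mfderiv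
  refine h2.trans ?_
  have h3 : mfderiv 𝓘(ℝ, E) 𝓘(ℝ, ℝ) f x = _ := congrFun h x
  rw [h3]
  refine ContinuousLinearMap.ext fun v => ?_
  let w : E := mfderiv 𝓘(ℝ, E) 𝓘(ℝ, E) p x v
  exact add_sub_cancel_right ((α (p x) : E →L[ℝ] ℝ) w)
    ((mfderiv 𝓘(ℝ, E) 𝓘(ℝ, ℝ) g (p x) : E →L[ℝ] ℝ) w)

theorem OneForm.pullback_torusDTheta {n : ℕ} (i : Fin n) {π : M → Torus n}
    (hπ : MDifferentiable 𝓘(ℝ, E) (torusModel n) π)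
    {p : Q → M} (hp : MDifferentiable 𝓘(ℝ, E) 𝓘(ℝ, E) p) :
    OneForm.pullback 𝓘(ℝ, E) 𝓘(ℝ, E) p
      (OneForm.pullback 𝓘(ℝ, E) (torusModel n) π (torusDTheta i)) =
      OneForm.pullback 𝓘(ℝ, E) (𝓡 1) (fun x => π (p x) i) circleDTheta := by
  funext x
  have h1 := HasMFDerivAt.comp x (hπ (p x)).hasMFDerivAt (hp x).hasMFDerivAt
  have h2 := (HasMFDerivAt.comp x (mdifferentiable_torus_apply i (π (p x))).hasMFDerivAt h1).mfderiv
  exact congrArg (circleDTheta (π (p x) i)).comp h2.symm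

/-- A primitive of the pull-back of a form cohomologous to the pull-back of `dθ_i`, corrected by a
bounded function, lifts the `i`-th coordinate. -/
theorem exists_exp_eq_of_cohomologous [IsManifold 𝓘(ℝ, E) ∞ Q] [ConnectedSpace Q] {n : ℕ}
    {i : Fin n} {π : M → Torus n} (hπ : ContMDiff 𝓘(ℝ, E) (torusModel n) ∞ π)
    {p : Q → M} (hp : ContMDiff 𝓘(ℝ, E) 𝓘(ℝ, E) ∞ p) {α : OneForm 𝓘(ℝ, E) M}
    (hα : OneForm.Cohomologous 𝓘(ℝ, E) α
      (OneForm.pullback 𝓘(ℝ, E) (torusModel n) π (torusDTheta i)))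
    {f : Q → ℝ} (hf : ContMDiff 𝓘(ℝ, E) 𝓘(ℝ, ℝ) ∞ f)
    (hfα : OneForm.d 𝓘(ℝ, E) f = OneForm.pullback 𝓘(ℝ, E) 𝓘(ℝ, E) p α) :
    ∃ g : M → ℝ, ContMDiff 𝓘(ℝ, E) 𝓘(ℝ, ℝ) ∞ g ∧
      OneForm.d 𝓘(ℝ, E) (fun x => f x - g (p x)) = OneForm.pullback 𝓘(ℝ, E) 𝓘(ℝ, E) p
        (OneForm.pullback 𝓘(ℝ, E) (torusModel n) π (torusDTheta i)) ∧
      ∀ x, Circle.exp (f x - g (p x)) = π (p x) i := by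
  obtain ⟨g, hg, rfl⟩ := hα
  have hp' := hp.mdifferentiable (n := ∞) (by simp)
  have hg' := hg.mdifferentiable (by simp)
  have hf' := hf.mdifferentiable (by simp)
  have hπ' := hπ.mdifferentiable (n := ∞) (by simp)
  have hfg : MDifferentiable 𝓘(ℝ, E) 𝓘(ℝ, ℝ) (fun x => f x - g (p x)) := hf'.sub (hg'.comp hp')
  have h2 := OneForm.d_sub_comp hp' hf' hg' hfα
  have hc : MDifferentiable 𝓘(ℝ, E) (𝓡 1) (fun x => π (p x) i) :=
    (mdifferentiable_torus_apply i).comp (hπ'.comp hp')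
  obtain ⟨s, hs⟩ := exists_exp_eq hc hfg (h2.trans (OneForm.pullback_torusDTheta i hπ' hp'))
  -- The constant `s` is absorbed into `g`; this does not change the differential.
  refine ⟨fun m => g m - s, hg.sub contMDiff_const, ?_, fun x => ?_⟩
  · rw [← h2]
    funext x
    have h3 : (fun x => f x - (g (p x) - s)) = (fun x => f x - g (p x)) + fun _ => s := by
      funext x
      simp only [Pi.add_apply]
      ring
    rw [h3]
    refine ((hfg x).hasMFDerivAt.add (hasMFDerivAt_const s x)).mfderiv.trans ?_
    exact add_zero _
  · rw [← hs x]
    congr 1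
    ring

end SmoothCover

/-! ## The main theorem -/

/-- The topological data underlying a smooth connected sum with a collapse. -/
noncomputable def ConnectedSum.toCollapsedSum {n : ℕ} {E₂ H₂ E H : Type*}
    [NormedAddCommGroup E₂] [NormedSpace ℝ E₂] [TopologicalSpace H₂]
    [NormedAddCommGroup E] [NormedSpace ℝ E] [TopologicalSpace H]
    {I₂ : ModelWithCorners ℝ E₂ H₂} {I : ModelWithCorners ℝ E H}
    {X : Type*} [TopologicalSpace X] [ChartedSpace H₂ X]
    {M : Type*} [TopologicalSpace M] [ChartedSpace H M]
    (S : ConnectedSum n (torusModel n) I₂ I (Torus n) X M) {π : M → Torus n}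
    (hπ : S.IsCollapse π) : CollapsedSum n X M where
  disc₁ := S.disc₁.toOpenPartialHomeomorph
  disc₁_source := S.disc₁_source
  disc₂ := S.disc₂.toOpenPartialHomeomorph
  disc₂_source := S.disc₂_source
  incl₁ := S.incl₁.toOpenPartialHomeomorph
  incl₁_source := S.incl₁_source
  incl₂ := S.incl₂.toOpenPartialHomeomorph
  incl₂_source := S.incl₂_source
  target_union := S.target_union
  glue := S.glue
  proj := ⟨π, hπ.contMDiff.continuous⟩
  eq_self := hπ.eq_self
  mapsTo_disc := fun x hx => by
    obtain ⟨v, hv⟩ := hπ.mapsTo_disc x hx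
    have := S.disc₁.map_source (S.disc₁_source ▸ Set.mem_univ v)
    rw [hv] at this
    exact this
  collapse := hπ.collapse

theorem mainTheorem9 {n : ℕ} (hn : 4 ≤ n)
    {X : Type*} [TopologicalSpace X] [ChartedSpace (EuclideanSpace ℝ (Fin n)) X]
    [IsManifold (𝓡 n) ∞ X] [T2Space X] [CompactSpace X] [ConnectedSpace X]
    {M : Type*} [TopologicalSpace M] [ChartedSpace (EuclideanSpace ℝ (Fin n)) M]
    [IsManifold (𝓡 n) ∞ M] [T2Space M] [CompactSpace M]
    (S : ConnectedSum n (torusModel n) (𝓡 n) (𝓡 n) (Torus n) X M)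
    (π : M → Torus n) (hπ : S.IsCollapse π)
    {M' : Type*} [TopologicalSpace M'] [ChartedSpace (EuclideanSpace ℝ (Fin n)) M']
    [IsManifold (𝓡 n) ∞ M']
    (p : C(M', M))
    (hp : IsMinimalIntegrationCover (𝓡 n) (𝓡 n) p
      (OneForm.pullback (𝓡 n) (torusModel n) π (torusDTheta (⟨0, by omega⟩ : Fin n))))
    (α : OneForm (𝓡 n) M)
    (hα : OneForm.Cohomologous (𝓡 n) α
      (OneForm.pullback (𝓡 n) (torusModel n) π (torusDTheta (⟨0, by omega⟩ : Fin n))))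
    (f : M' → ℝ) (hf : ContMDiff (𝓡 n) 𝓘(ℝ, ℝ) ∞ f)
    (hfα : OneForm.d (𝓡 n) f = OneForm.pullback (𝓡 n) (𝓡 n) p α)
    (x₀ : X) :
    ∃ h : UnboundedBelow f,
      Nonempty (NovikovPi1 f h ≃* FreePowerLimit (FundamentalGroup X x₀)) := by
  have : ConnectedSpace M' := hp.connected
  have : NeZero n := ⟨by omega⟩
  have : LocallyPathConnectedSpace M' :=
    ChartedSpace.locallyPathConnectedSpace (EuclideanSpace ℝ (Fin n)) M'
  have : LocallyPathConnectedSpace X :=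
    ChartedSpace.locallyPathConnectedSpace (EuclideanSpace ℝ (Fin n)) X
  have : PathConnectedSpace M' := pathConnectedSpace_iff_connectedSpace.2 inferInstance
  have : PathConnectedSpace X := pathConnectedSpace_iff_connectedSpace.2 inferInstance
  have hps : ContMDiff (𝓡 n) (𝓡 n) ∞ p := hp.isLocalDiffeomorph.contMDiff
  obtain ⟨g, hg, hd, hexp⟩ := exists_exp_eq_of_cohomologous hπ.contMDiff hps hα hf hfα
  have hg0 : ContMDiff (𝓡 n) 𝓘(ℝ, ℝ) ∞ (fun x => f x - g (p x)) := hf.sub (hg.comp hps)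
  let T := S.toCollapsedSum hπ
  let i : Fin n := ⟨0, by omega⟩
  have : PathConnectedSpace
      {q : M × ℝ // Circle.exp q.2 = ((ContinuousMap.eval i).comp T.proj) q.1} :=
    T.pathConnectedSpace_cover i (by omega)
  obtain ⟨e, he⟩ := exists_homeomorph_of_exp_eq hp.isCoveringMap
    ((ContinuousMap.eval i).comp T.proj) ⟨fun x => f x - g (p x), hg0.continuous⟩ hexp
    fun x y γ h hxy => by
      -- Two points of one fibre with the same value of the corrected primitive are joined by a path
      -- whose projection has zero period, so its class lies in the image of π₁ of the cover.
      rw [hp.range_eq x]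
      refine ⟨_, rfl, ?_⟩
      have := OneForm.hasPathIntegral_map hp.isLocalDiffeomorph hg0 hd γ h
      have h0 : f y - g (p y) - (f x - g (p x)) = 0 := sub_eq_zero.2 hxy.symm
      rwa [h0] at this
  -- The correction `g` lives on the compact `M`, so changing the form within its class moves the
  -- primitive by a bounded amount only.
  obtain ⟨C, hC⟩ := isCompact_univ.exists_bound_of_continuousOn (f := g) hg.continuous.continuousOn
  have hbound : ∀ x, |f x - (e x).1.2| ≤ C := fun x => by
    rw [he x]
    simpa using hC (p x) (Set.mem_univ _)
  obtain ⟨P⟩ := T.nonempty_periodicSum i (by omega) e hf.continuous hbound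
  exact ⟨P.unboundedBelow, P.nonempty_mulEquiv fun x =>
    FundamentalGroup.fundamentalGroupMulEquivOfPathConnected x x₀⟩
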